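/- **Setting.** Let $q,\mu\in\mathbb C$ with $q\notin\{0,1,-1\}$ and $\mu\notin\{0,q,-q^{-1}\}$. Put $i_q=(q^i-q^{-i})/(q-q^{-1})$ and $\eta=\frac{(q-\mu)(q^{-1}+\mu)}{\mu(q-q^{-1})}$. *BMW algebra.* $\mathcal W_n(q,\mu)$ is the quotient of the group algebra over $\mathbb C$ of the braid group on $n$ strands (Artin generators $\sigma_1,\dots,\sigma_{n-1}$) by the relations $\sigma_i\kappa_i=\kappa_i\sigma_i=\mu\kappa_i$ and $\kappa_i\sigma_{i+1}^{\pm1}\kappa_i=\mu^{\mp1}\kappa_i$, where $\kappa_i=\frac{(q-\sigma_i)(q^{-1}+\sigma_i)}{\mu(q-q^{-1})}$. For $\varepsilon=\pm1$ put $\alpha_\varepsilon=-\varepsilon q^{-\varepsilon}\mu^{-1}$ and $$\sigma_i^{\varepsilon}(x)=1+\frac{x-1}{q-q^{-1}}\,\sigma_i+\frac{x-1}{\alpha_\varepsilon x+1}\,\kappa_i .$$ The antisymmetrizers $a^{(i)}$ and symmetrizers $s^{(i)}$ are defined by $a^{(1)}=s^{(1)}=1$ and $$a^{(i+1)}=\frac{q^i}{(i+1)_q}\,a^{(i)}\sigma_i^{-}(q^{-2i})\,a^{(i)},\qquad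 s^{(i+1)}=\frac{q^{-i}}{(i+1)_q}\,s^{(i)}\sigma_i^{+}(q^{2i})\,s^{(i)} .$$ *R-matrices.* Let $V$ be a finite-dimensional complex vector space with a fixed basis. For $X\in\mathrm{End}(V^{\otimes2})$ write $X_{ab}$ for $X$ acting in the tensor factors $a,b$ of $V^{\otimes n}$, and $X_a=X_{a\,a+1}$; let $P$ be the permutation operator. $X$ is *skew invertible* if there is $\Psi_X\in\mathrm{End}(V^{\otimes2})$ with $\mathrm{Tr}_{(2)}X_{12}(\Psi_X)_{23}=\mathrm{Tr}_{(2)}(\Psi_X)_{12}X_{23}=P_{13}$; then $C_X=\mathrm{Tr}_{(1)}(\Psi_X)_{12}$ and $D_X=\mathrm{Tr}_{(2)}(\Psi_X)_{12}$, and $X$ is *strict skew invertible* if $C_X$ or $D_X$ is invertible. An *R-matrix* is an invertible $R\in\mathrm{End}(V^{\otimes 2})$ with $R_1R_2R_1=R_2R_1R_2$. It is *of BMW-type* (with parameters $q,\mu$) if its minimal polynomial is $(x-q)(x+q^{-1})(x-\mu)$ and $K=\frac{(q-R)(q^{-1}+R)}{\mu(q-q^{-1})}$ satisfies $K_2K_1=R_1^{\pm1}R_2^{\pm1}K_1$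 and $K_1K_2K_1=K_1$; then $\sigma_i\mapsto R_i$ defines representations $\rho_R:\mathcal W_n(q,\mu)\to\mathrm{End}(V^{\otimes n})$. A pair $\{R,F\}$ of R-matrices is *compatible* if $R_1F_2F_1=F_2F_1R_2$ and $R_2F_1F_2=F_1F_2R_1$. *Quantum matrix algebra.* Let $\{R,F\}$ be a compatible pair of strict skew invertible R-matrices with $R$ of BMW-type. The BMW-type quantum matrix algebra $\mathcal M(R,F)$ is the unital associative $\mathbb C$-algebra generated by the entries of a $\dim V\times\dim V$ matrix $M=\|M_a^b\|$ subject to $R_1M_{\overline1}M_{\overline2}=M_{\overline1}M_{\overline2}R_1$, where $M_{\overline1}=M_1$ and $M_{\overline{i+1}}=F_iM_{\overline i}F_i^{-1}$. For $\alpha\in\mathcal W_n(q,\mu)$ put $$ch(\alpha)=\mathrm{Tr}_{(1,\dots,n)}\bigl((D_R)_1\cdots(D_R)_n\,M_{\overline1}\cdots M_{\overline n}\,\rho_R(\alpha)\bigr)\in\mathcal M(R,F).$$ Define $p_1=ch(1)=\mathrm{Tr}(D_RM)$, $p_i=ch(\sigma_{i-1}\cdots\sigma_2\sigma_1)$ for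 $i\ge2$, $a_0=s_0=1$, $a_i=ch(a^{(i)})$ and $s_i=ch(s^{(i)})$ for $i\ge1$, and the 2-contraction $g=\eta^{-1}ch(\kappa_1)$ with $\kappa_1\in\mathcal W_2(q,\mu)$. **Theorem.** Let $n\ge0$. 1. If $j_q\ne0$ and $\mu\ne-q^{-2j+3}$ for all $j=2,\dots,n$ (so that $a_0,\dots,a_n$ are defined), then $$\sum_{i=0}^{n-1}(-q)^i a_i\,p_{n-i}=(-1)^{n-1}n_q\,a_n+(-1)^n\sum_{i=1}^{\lfloor n/2\rfloor}\bigl(\mu q^{n-2i}-q^{1-n+2i}\bigr)a_{n-2i}\,g^i .$$ 2. If $j_q\ne0$ and $\mu\ne q^{2j-3}$ for all $j=2,\dots,n$ (so that $s_0,\dots,s_n$ are defined), then $$\sum_{i=0}^{n-1}q^{-i}s_i\,p_{n-i}=n_q\,s_n+\sum_{i=1}^{\lfloor n/2\rfloor}\bigl(\mu q^{2i-n}+q^{n-2i-1}\bigr)s_{n-2i}\,g^i .$$ 3. If the conditions of both 1 and 2 hold, then $$\sum_{i=0}^{n}(-1)^i a_i\,s_{n-i}=\delta_{n,0}-\delta_{n,2}\,g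 .$$ -/

import Mathlib

namespace BMWQuantum

/-! ### Operators on tensor powers

`V` is a finite dimensional complex vector space with a basis indexed by the finite type `ι`.
An operator on `V^{⊗n}` with entries in `S` is a square matrix indexed by `Fin n → ι`. -/

/-- `End(V^{⊗n})` with entries in `S`, in the basis of `V^{⊗n}` indexed by `Fin n → ι`. -/
abbrev TMat (ι : Type*) (n : ℕ) (S : Type*) := Matrix (Fin n → ι) (Fin n → ι) S

/-- Leg numbering notation: `place f X` is the operator on `V^{⊗n}` that acts as `X` on the
tensor factors `f 0, f 1, …` (in this order) and as the identity on all the other factors.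
It is used for injective `f`; e.g. `place ![a, b] X` is the operator `X_{ab}`. -/
def place {ι S : Type*} [DecidableEq ι] [Zero S] {m n : ℕ} (f : Fin m → Fin n)
    (X : TMat ι m S) : TMat ι n S :=
  Matrix.of fun i j =>
    if ∀ k, (∀ l, f l ≠ k) → i k = j k then X (fun l => i (f l)) (fun l => j (f l)) else 0

section placeFacts

variable {ι : Type*} [DecidableEq ι]

theorem place_one {m n : ℕ} (f : Fin m → Fin n) : place f (1 : TMat ι m ℂ) = 1 := by
  ext i j
  simp only [place, Matrix.of_apply, Matrix.one_apply]
  by_cases h : i = j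
  · subst h; simp
  · rw [if_neg h]
    split_ifs with h1 h2
    · exfalso
      apply h
      funext k
      by_cases hk : ∀ l, f l ≠ k
      · exact h1 k hk
      · push Not at hk
        obtain ⟨l, rfl⟩ := hk
        exact congrFun h2 l
    · rfl
    · rfl

theorem place_add {m n : ℕ} (f : Fin m → Fin n) (X Y : TMat ι m ℂ) :
    place f (X + Y) = place f X + place f Y := by
  ext i j
  simp only [place, Matrix.of_apply, Matrix.add_apply]
  split_ifs <;> simp

theorem place_smul {m n : ℕ} (f : Fin m → Fin n) (c : ℂ) (X : TMat ι m ℂ) :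
    place f (c • X) = c • place f X := by
  ext i j
  simp only [place, Matrix.of_apply, Matrix.smul_apply]
  split_ifs <;> simp

theorem place_mul [Fintype ι] {m n : ℕ} (f : Fin m → Fin n) (hf : Function.Injective f)
    (X Y : TMat ι m ℂ) : place f (X * Y) = place f X * place f Y := by
  ext i j
  simp only [place, Matrix.of_apply, Matrix.mul_apply]
  -- the intermediate index agrees with `i` off the range of `f`
  let g : (Fin m → ι) → (Fin n → ι) := fun a k => Function.extend f a i k
  have hg1 : ∀ a l, g a (f l) = a l := fun a l => hf.extend_apply a i l
  have hg2 : ∀ a k, (∀ l, f l ≠ k) → g a k = i k := fun a k hk =>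
    Function.extend_apply' a i k (fun ⟨l, hl⟩ => hk l hl)
  have hginj : Function.Injective g := fun a b hab => by
    funext l
    rw [← hg1 a l, ← hg1 b l, hab]
  rw [← Finset.sum_subset (Finset.subset_univ (Finset.univ.map ⟨g, hginj⟩))]
  · rw [Finset.sum_map]
    split_ifs with h
    · refine Finset.sum_congr rfl fun a _ => ?_
      simp only [Function.Embedding.coeFn_mk, hg1]
      rw [if_pos (fun k hk => (hg2 a k hk).symm),
        if_pos (fun k hk => (hg2 a k hk).trans (h k hk))]
    · symm
      refine Finset.sum_eq_zero fun a _ => ?_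
      simp only [Function.Embedding.coeFn_mk]
      rw [if_neg (c := ∀ k, (∀ l, f l ≠ k) → g a k = j k), mul_zero]
      intro h'
      exact h fun k hk => (hg2 a k hk).symm.trans (h' k hk)
  · intro l _ hl
    rw [if_neg, zero_mul]
    intro h
    apply hl
    rw [Finset.mem_map]
    refine ⟨fun a => l (f a), Finset.mem_univ _, ?_⟩
    funext k
    simp only [Function.Embedding.coeFn_mk]
    by_cases hk : ∀ a, f a ≠ k
    · rw [hg2 _ k hk, h k hk]
    · push Not at hk
      obtain ⟨a, rfl⟩ := hk
      exact hg1 _ a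

theorem place_place {p m n : ℕ} (f : Fin m → Fin n) (hf : Function.Injective f)
    (g : Fin p → Fin m) (X : TMat ι p ℂ) : place f (place g X) = place (f ∘ g) X := by
  ext i j
  simp only [place, Matrix.of_apply, Function.comp]
  rw [← ite_and]
  congr 1
  rw [eq_iff_iff]
  constructor
  · rintro ⟨h1, h2⟩ k hk
    by_cases hk' : ∀ l, f l ≠ k
    · exact h1 k hk'
    · push Not at hk'
      obtain ⟨l, rfl⟩ := hk'
      exact h2 l fun a ha => hk a (by rw [ha])
  · intro h
    refine ⟨fun k hk => h k fun l => hk _, fun k hk => h _ fun l hl => hk l (hf hl)⟩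

theorem place_commute [Fintype ι] {p m n : ℕ} (f : Fin m → Fin n) (g : Fin p → Fin n)
    (hfg : ∀ a b, f a ≠ g b) (X : TMat ι m ℂ) (Y : TMat ι p ℂ) :
    place f X * place g Y = place g Y * place f X := by
  classical
  have key : ∀ {p m : ℕ} (f : Fin m → Fin n) (g : Fin p → Fin n)
      (_ : ∀ a b, f a ≠ g b) (X : TMat ι m ℂ) (Y : TMat ι p ℂ) (i j : Fin n → ι),
      (place f X * place g Y) i j =
        if ∀ k, (∀ l, f l ≠ k) → (∀ l, g l ≠ k) → i k = j k then
          X (fun l => i (f l)) (fun l => j (f l)) * Y (fun l => i (g l)) (fun l => j (g l))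
        else 0 := by
    intro p m f g hfg X Y i j
    rw [Matrix.mul_apply]
    let c : Fin n → ι := fun k => if ∃ l, f l = k then j k else i k
    have hc1 : ∀ l, c (f l) = j (f l) := fun l => if_pos ⟨l, rfl⟩
    have hc2 : ∀ k, (∀ l, f l ≠ k) → c k = i k := fun k hk =>
      if_neg (fun ⟨l, hl⟩ => hk l hl)
    rw [Finset.sum_eq_single c]
    · simp only [place, Matrix.of_apply]
      rw [if_pos (fun k hk => (hc2 k hk).symm)]
      simp only [hc1, hc2 _ (fun l => hfg l _)]
      rw [mul_ite, mul_zero]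
      congr 1
      rw [eq_iff_iff]
      constructor
      · intro h k hk1 hk2
        rw [← hc2 k hk1, h k hk2]
      · intro h k hk2
        by_cases hk1 : ∀ l, f l ≠ k
        · rw [hc2 k hk1, h k hk1 hk2]
        · push Not at hk1
          obtain ⟨l, rfl⟩ := hk1
          exact hc1 l
    · intro b _ hb
      simp only [place, Matrix.of_apply]
      by_cases h1 : ∀ k, (∀ l, f l ≠ k) → i k = b k
      · by_cases h2 : ∀ k, (∀ l, g l ≠ k) → b k = j k
        · exfalso
          apply hb
          funext k
          by_cases hk : ∀ l, f l ≠ k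
          · rw [hc2 k hk, h1 k hk]
          · push Not at hk
            obtain ⟨l, rfl⟩ := hk
            rw [hc1, h2 _ (fun a ha => hfg l a ha.symm)]
        · rw [if_neg h2, mul_zero]
      · rw [if_neg h1, zero_mul]
    · intro h
      exact absurd (Finset.mem_univ _) h
  ext i j
  rw [key f g hfg, key g f (fun a b h => hfg b a h.symm)]
  congr 1
  · rw [eq_iff_iff]
    exact ⟨fun h k h1 h2 => h k h2 h1, fun h k h1 h2 => h k h2 h1⟩
  · exact mul_comm _ _

/-- For injective `f`, leg numbering is a homomorphism of algebras. -/
def placeHom [Fintype ι] {m n : ℕ} (f : Fin m → Fin n) (hf : Function.Injective f) :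
    TMat ι m ℂ →ₐ[ℂ] TMat ι n ℂ :=
  AlgHom.ofLinearMap
    { toFun := place f
      map_add' := place_add f
      map_smul' := place_smul f } (place_one f) (place_mul f hf)

theorem placeHom_apply [Fintype ι] {m n : ℕ} (f : Fin m → Fin n) (hf : Function.Injective f)
    (X : TMat ι m ℂ) : placeHom f hf X = place f X := rfl

end placeFacts

/-- The pair of neighbouring legs `k, k+1` (counted from `0`). -/
def adj {n : ℕ} (k : ℕ) (h : k + 1 < n) : Fin 2 → Fin n :=
  ![⟨k, Nat.lt_of_succ_lt h⟩, ⟨k + 1, h⟩]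

/-- The operator `X_{k+1} = X_{k+1,k+2}` on `V^{⊗n}` (the index `k` counts legs from `0`). -/
def leg {ι S : Type*} [DecidableEq ι] [Zero S] {n : ℕ} (X : TMat ι 2 S) (k : ℕ) (h : k + 1 < n) :
    TMat ι n S :=
  place (adj k h) X

section RMatrices

variable {ι : Type*} [Fintype ι] [DecidableEq ι]

/-- The permutation operator `P(u ⊗ v) = v ⊗ u`. -/
def permOp (ι : Type*) [DecidableEq ι] : TMat ι 2 ℂ :=
  Matrix.of fun i j => if i 0 = j 1 ∧ i 1 = j 0 then 1 else 0

/-- The trace over the second of three tensor factors, `Tr_{(2)}`. -/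
def trMid (X : TMat ι 3 ℂ) : TMat ι 2 ℂ :=
  Matrix.of fun i j => ∑ b, X ![i 0, b, i 1] ![j 0, b, j 1]

/-- `Ψ` is a skew inverse of `X`:
`Tr_{(2)} X₁₂ Ψ₂₃ = Tr_{(2)} Ψ₁₂ X₂₃ = P₁₃`. -/
def IsSkewInverse (X Ψ : TMat ι 2 ℂ) : Prop :=
  trMid (place ![0, 1] X * place ![1, 2] Ψ) = permOp ι ∧
  trMid (place ![0, 1] Ψ * place ![1, 2] X) = permOp ι

/-- `X` is skew invertible. -/
def SkewInvertible (X : TMat ι 2 ℂ) : Prop := ∃ Ψ, IsSkewInverse X Ψ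

open Classical in
/-- The skew inverse `Ψ_X` of a skew invertible operator (it is unique). -/
noncomputable def skewInv (X : TMat ι 2 ℂ) : TMat ι 2 ℂ :=
  if h : SkewInvertible X then h.choose else 0

/-- `C_X = Tr_{(1)} (Ψ_X)₁₂`. -/
noncomputable def matC (X : TMat ι 2 ℂ) : Matrix ι ι ℂ :=
  Matrix.of fun b c => ∑ a, skewInv X ![a, b] ![a, c]

/-- `D_X = Tr_{(2)} (Ψ_X)₁₂`. -/
noncomputable def matD (X : TMat ι 2 ℂ) : Matrix ι ι ℂ :=
  Matrix.of fun a c => ∑ b, skewInv X ![a, b] ![c, b]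

/-- `X` is strict skew invertible. -/
def StrictSkewInvertible (X : TMat ι 2 ℂ) : Prop :=
  SkewInvertible X ∧ (IsUnit (matC X) ∨ IsUnit (matD X))

/-- `R` is an R-matrix: an invertible solution of the Yang-Baxter equation. -/
structure IsRMatrix (R : TMat ι 2 ℂ) : Prop where
  isUnit : IsUnit R
  yangBaxter : (place ![0, 1] R * place ![1, 2] R * place ![0, 1] R : TMat ι 3 ℂ) =
    place ![1, 2] R * place ![0, 1] R * place ![1, 2] R

/-- The twist relations for a compatible pair `{R, F}`. -/
structure Compatible (R F : TMat ι 2 ℂ) : Prop where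
  twist₁ : (place ![0, 1] R * place ![1, 2] F * place ![0, 1] F : TMat ι 3 ℂ) =
    place ![1, 2] F * place ![0, 1] F * place ![1, 2] R
  twist₂ : (place ![1, 2] R * place ![0, 1] F * place ![1, 2] F : TMat ι 3 ℂ) =
    place ![0, 1] F * place ![1, 2] F * place ![0, 1] R

/-- The element `κ = (q - σ)(q⁻¹ + σ) / (μ (q - q⁻¹))` of a complex algebra. -/
noncomputable def kappaOf {B : Type*} [Ring B] [Algebra ℂ B] (q μ : ℂ) (σ : B) : B :=
  (μ * (q - q⁻¹))⁻¹ • ((algebraMap ℂ B q - σ) * (algebraMap ℂ B q⁻¹ + σ))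

/-- The domain of the parameters of the BMW algebras. -/
structure BMWParams (q μ : ℂ) : Prop where
  q_ne_zero : q ≠ 0
  q_ne_one : q ≠ 1
  q_ne_neg_one : q ≠ -1
  μ_ne_zero : μ ≠ 0
  μ_ne_q : μ ≠ q
  μ_ne_neg_inv : μ ≠ -q⁻¹

open Polynomial in
/-- `R` is an R-matrix of BMW-type with parameters `q`, `μ`: its minimal polynomial is
`(x - q)(x + q⁻¹)(x - μ)`, and `K = (q - R)(q⁻¹ + R) / (μ (q - q⁻¹))` satisfies
`K₂ K₁ = R₁^{±1} R₂^{±1} K₁` and `K₁ K₂ K₁ = K₁`. -/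
structure IsBMWType (q μ : ℂ) (R : TMat ι 2 ℂ) : Prop extends IsRMatrix R where
  params : BMWParams q μ
  minimal : minpoly ℂ R = (X - C q) * (X + C q⁻¹) * (X - C μ)
  kk : (place ![1, 2] (kappaOf q μ R) * place ![0, 1] (kappaOf q μ R) : TMat ι 3 ℂ) =
    place ![0, 1] R * place ![1, 2] R * place ![0, 1] (kappaOf q μ R)
  kk_inv : (place ![1, 2] (kappaOf q μ R) * place ![0, 1] (kappaOf q μ R) : TMat ι 3 ℂ) =
    place ![0, 1] R⁻¹ * place ![1, 2] R⁻¹ * place ![0, 1] (kappaOf q μ R)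
  kkk : (place ![0, 1] (kappaOf q μ R) * place ![1, 2] (kappaOf q μ R) *
    place ![0, 1] (kappaOf q μ R) : TMat ι 3 ℂ) = place ![0, 1] (kappaOf q μ R)

end RMatrices

/-! ### Braid groups and Birman-Murakami-Wenzl algebras -/

/-- The Artin relations. The generators `σ₁, …, σ_{n-1}` are indexed by `Fin (n - 1)`, so that
the index `k` stands for `σ_{k+1}`. -/
inductive BraidRel (n : ℕ) : FreeGroup (Fin (n - 1)) → Prop
  | braid (i j : Fin (n - 1)) (h : (i : ℕ) + 1 = j) :
      BraidRel n (.of i * .of j * .of i * (.of j * .of i * .of j)⁻¹)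
  | comm (i j : Fin (n - 1)) (h : (i : ℕ) + 1 < j) :
      BraidRel n (.of i * .of j * (.of j * .of i)⁻¹)

/-- The braid group on `n` strands. -/
abbrev BraidGroup (n : ℕ) := PresentedGroup {r | BraidRel n r}

/-- The group algebra of the braid group. -/
abbrev BraidAlgebra (n : ℕ) := MonoidAlgebra ℂ (BraidGroup n)

/-- The generator `σ_{k+1}` in the group algebra of the braid group. -/
noncomputable def braidGen (n : ℕ) (k : Fin (n - 1)) : BraidAlgebra n :=
  MonoidAlgebra.of ℂ (BraidGroup n) (PresentedGroup.of k)

/-- The inverse generator `σ_{k+1}⁻¹` in the group algebra of the braid group. -/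
noncomputable def braidGenInv (n : ℕ) (k : Fin (n - 1)) : BraidAlgebra n :=
  MonoidAlgebra.of ℂ (BraidGroup n) (PresentedGroup.of k)⁻¹

/-- The defining relations of the BMW algebra as a quotient of the group algebra of the braid
group: `σᵢ κᵢ = κᵢ σᵢ = μ κᵢ` and `κᵢ σ_{i+1}^{±1} κᵢ = μ^{∓1} κᵢ`. -/
inductive BMWRel (q μ : ℂ) (n : ℕ) : BraidAlgebra n → BraidAlgebra n → Prop
  | sigma_kappa (i : Fin (n - 1)) :
      BMWRel q μ n (braidGen n i * kappaOf q μ (braidGen n i)) (μ • kappaOf q μ (braidGen n i))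
  | kappa_sigma (i : Fin (n - 1)) :
      BMWRel q μ n (kappaOf q μ (braidGen n i) * braidGen n i) (μ • kappaOf q μ (braidGen n i))
  | kappa_sigma_kappa (i j : Fin (n - 1)) (h : (i : ℕ) + 1 = j) :
      BMWRel q μ n (kappaOf q μ (braidGen n i) * braidGen n j * kappaOf q μ (braidGen n i))
        (μ⁻¹ • kappaOf q μ (braidGen n i))
  | kappa_sigma_inv_kappa (i j : Fin (n - 1)) (h : (i : ℕ) + 1 = j) :
      BMWRel q μ n (kappaOf q μ (braidGen n i) * braidGenInv n j * kappaOf q μ (braidGen n i))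
        (μ • kappaOf q μ (braidGen n i))

/-- The Birman-Murakami-Wenzl algebra `W_n(q, μ)`. -/
abbrev BMWAlgebra (q μ : ℂ) (n : ℕ) := RingQuot (BMWRel q μ n)

section BMWElements

variable (q μ : ℂ) (n : ℕ)

/-- The generator `σ_{k+1}` of `W_n(q, μ)`. -/
noncomputable def sig (k : ℕ) (h : k + 1 < n) : BMWAlgebra q μ n :=
  RingQuot.mkAlgHom ℂ (BMWRel q μ n) (braidGen n ⟨k, by omega⟩)

/-- The element `κ_{k+1}` of `W_n(q, μ)`. -/
noncomputable def kap (k : ℕ) (h : k + 1 < n) : BMWAlgebra q μ n :=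
  kappaOf q μ (sig q μ n k h)

/-- The `q`-number `i_q = (q^i - q^{-i}) / (q - q⁻¹)`. -/
noncomputable def qNum (q : ℂ) (i : ℕ) : ℂ := (q ^ i - (q ^ i)⁻¹) / (q - q⁻¹)

/-- `η = (q - μ)(q⁻¹ + μ) / (μ (q - q⁻¹))`. -/
noncomputable def eta (q μ : ℂ) : ℂ := (q - μ) * (q⁻¹ + μ) / (μ * (q - q⁻¹))

/-- `α_ε = -ε q^{-ε} μ⁻¹`. -/
noncomputable def alphaC (ε : ℤ) : ℂ := -(ε : ℂ) * q ^ (-ε) * μ⁻¹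

/-- The baxterized element
`σ^ε_{k+1}(x) = 1 + (x-1)/(q-q⁻¹) σ_{k+1} + (x-1)/(α_ε x + 1) κ_{k+1}`. -/
noncomputable def bax (ε : ℤ) (k : ℕ) (h : k + 1 < n) (x : ℂ) : BMWAlgebra q μ n :=
  1 + ((x - 1) / (q - q⁻¹)) • sig q μ n k h + ((x - 1) / (alphaC q μ ε * x + 1)) • kap q μ n k h

/-- The antisymmetrizer `a^{(i)}`, `1 ≤ i ≤ n`, in `W_n(q, μ)`: `a^{(1)} = 1` and
`a^{(i+1)} = q^i / (i+1)_q · a^{(i)} σ^-_i(q^{-2i}) a^{(i)}`. -/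
noncomputable def antisymmetrizer : (i : ℕ) → i ≤ n → BMWAlgebra q μ n
  | 0, _ => 1
  | 1, _ => 1
  | i + 2, h => (q ^ (i + 1) / qNum q (i + 2)) •
      (antisymmetrizer (i + 1) (by omega) * bax q μ n (-1) i (by omega) (q ^ (-2 * ((i : ℤ) + 1))) *
        antisymmetrizer (i + 1) (by omega))

/-- The symmetrizer `s^{(i)}`, `1 ≤ i ≤ n`, in `W_n(q, μ)`: `s^{(1)} = 1` and
`s^{(i+1)} = q^{-i} / (i+1)_q · s^{(i)} σ^+_i(q^{2i}) s^{(i)}`. -/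
noncomputable def symmetrizer : (i : ℕ) → i ≤ n → BMWAlgebra q μ n
  | 0, _ => 1
  | 1, _ => 1
  | i + 2, h => ((q ^ (i + 1))⁻¹ / qNum q (i + 2)) •
      (symmetrizer (i + 1) (by omega) * bax q μ n 1 i (by omega) (q ^ (2 * ((i : ℤ) + 1))) *
        symmetrizer (i + 1) (by omega))

end BMWElements

/-- The conditions under which the antisymmetrizers `a^{(i)}`, `i ≤ n`, are defined. -/
def AntisymDefined (q μ : ℂ) (n : ℕ) : Prop :=
  ∀ j : ℕ, 2 ≤ j → j ≤ n → qNum q j ≠ 0 ∧ μ ≠ -q ^ (-2 * (j : ℤ) + 3)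

/-- The conditions under which the symmetrizers `s^{(i)}`, `i ≤ n`, are defined. -/
def SymDefined (q μ : ℂ) (n : ℕ) : Prop :=
  ∀ j : ℕ, 2 ≤ j → j ≤ n → qNum q j ≠ 0 ∧ μ ≠ q ^ (2 * (j : ℤ) - 3)

/-! ### R-matrix representations -/

section Representations

variable {ι : Type*} [Fintype ι] [DecidableEq ι]

theorem adj_injective {n : ℕ} (k : ℕ) (h : k + 1 < n) : Function.Injective (adj k h) := by
  intro a b hab
  fin_cases a <;> fin_cases b <;> simp_all [adj]

theorem triple_injective {n : ℕ} (k : ℕ) (h : k + 2 < n) : Function.Injective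
    (![⟨k, by omega⟩, ⟨k + 1, by omega⟩, ⟨k + 2, h⟩] : Fin 3 → Fin n) := by
  intro a b hab
  fin_cases a <;> fin_cases b <;> simp_all

/-- The invertible operator `R_{k+1}` on `V^{⊗n}`. -/
noncomputable def legUnit {R : TMat ι 2 ℂ} (hR : IsRMatrix R) (n k : ℕ) (h : k + 1 < n) :
    (TMat ι n ℂ)ˣ :=
  Units.map (placeHom (ι := ι) (adj k h) (adj_injective k h)).toRingHom.toMonoidHom hR.isUnit.unit

theorem coe_legUnit {R : TMat ι 2 ℂ} (hR : IsRMatrix R) (n k : ℕ) (h : k + 1 < n) :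
    (legUnit hR n k h : TMat ι n ℂ) = leg R k h := rfl

theorem coe_inv_legUnit {R : TMat ι 2 ℂ} (hR : IsRMatrix R) (n k : ℕ) (h : k + 1 < n) :
    (((legUnit hR n k h)⁻¹ : (TMat ι n ℂ)ˣ) : TMat ι n ℂ) = leg R⁻¹ k h := by
  have h1 : ((hR.isUnit.unit⁻¹ : (TMat ι 2 ℂ)ˣ) : TMat ι 2 ℂ) = R⁻¹ := by
    rw [Matrix.coe_units_inv]; rfl
  rw [legUnit, ← map_inv, Units.coe_map, h1]
  rfl

theorem leg_eq_place_left {ι : Type*} [DecidableEq ι] {n : ℕ} (X : TMat ι 2 ℂ) (k : ℕ) (h : k + 2 < n) :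
    leg X k (by omega) = place (![⟨k, by omega⟩, ⟨k + 1, by omega⟩, ⟨k + 2, h⟩] : Fin 3 → Fin n)
      (place ![0, 1] X) := by
  rw [place_place _ (triple_injective k h), leg]
  congr 1
  funext a
  fin_cases a <;> rfl

theorem leg_eq_place_right {ι : Type*} [DecidableEq ι] {n : ℕ} (X : TMat ι 2 ℂ) (k : ℕ) (h : k + 2 < n) :
    leg X (k + 1) h = place (![⟨k, by omega⟩, ⟨k + 1, by omega⟩, ⟨k + 2, h⟩] : Fin 3 → Fin n)
      (place ![1, 2] X) := by
  rw [place_place _ (triple_injective k h), leg]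
  congr 1
  funext a
  fin_cases a <;> rfl

theorem leg_braid {R : TMat ι 2 ℂ} (hR : IsRMatrix R) (n k : ℕ) (h : k + 2 < n) :
    (leg R k (by omega) * leg R (k + 1) h * leg R k (by omega) : TMat ι n ℂ) =
      leg R (k + 1) h * leg R k (by omega) * leg R (k + 1) h := by
  rw [leg_eq_place_left R k h, leg_eq_place_right R k h]
  simp only [← place_mul _ (triple_injective k h)]
  rw [hR.yangBaxter]

theorem leg_comm (X Y : TMat ι 2 ℂ) (n k l : ℕ) (hk : k + 1 < n) (hl : l + 1 < n)
    (h : k + 1 < l) : (leg X k hk * leg Y l hl : TMat ι n ℂ) = leg Y l hl * leg X k hk := by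
  apply place_commute
  intro a b
  fin_cases a <;> fin_cases b <;> simp [adj] <;> omega

/-- The representation of the braid group on `V^{⊗n}`, `σ_i ↦ R_i`. -/
noncomputable def braidRep {R : TMat ι 2 ℂ} (hR : IsRMatrix R) (n : ℕ) :
    BraidGroup n →* (TMat ι n ℂ)ˣ :=
  PresentedGroup.toGroup (f := fun k : Fin (n - 1) => legUnit hR n k (by omega)) (by
    rintro r hr
    cases hr with
    | braid i j h =>
      obtain ⟨j, hj⟩ := j
      simp only at h
      subst h
      simp only [map_mul, map_inv, FreeGroup.lift_apply_of]
      rw [mul_inv_eq_one]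
      ext1
      simp only [Units.val_mul, coe_legUnit]
      exact leg_braid hR n i (by omega)
    | comm i j h =>
      simp only [map_mul, map_inv, FreeGroup.lift_apply_of]
      rw [mul_inv_eq_one]
      ext1
      simp only [Units.val_mul, coe_legUnit]
      exact leg_comm R R n i j _ _ h)

/-- The representation `ρ_R` of the group algebra of the braid group on `V^{⊗n}`. -/
noncomputable def braidAlgebraRep {R : TMat ι 2 ℂ} (hR : IsRMatrix R) (n : ℕ) :
    BraidAlgebra n →ₐ[ℂ] TMat ι n ℂ :=
  MonoidAlgebra.lift ℂ (TMat ι n ℂ) (BraidGroup n) ((Units.coeHom _).comp (braidRep hR n))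

theorem braidAlgebraRep_gen {R : TMat ι 2 ℂ} (hR : IsRMatrix R) (n : ℕ) (k : Fin (n - 1)) :
    braidAlgebraRep hR n (braidGen n k) = leg R k (by omega) := by
  rw [braidAlgebraRep, braidGen, MonoidAlgebra.lift_of, MonoidHom.comp_apply, braidRep,
    PresentedGroup.toGroup.of]
  rfl

theorem braidAlgebraRep_genInv {R : TMat ι 2 ℂ} (hR : IsRMatrix R) (n : ℕ) (k : Fin (n - 1)) :
    braidAlgebraRep hR n (braidGenInv n k) = leg R⁻¹ k (by omega) := by
  rw [braidAlgebraRep, braidGenInv, MonoidAlgebra.lift_of, MonoidHom.comp_apply, braidRep,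
    map_inv, PresentedGroup.toGroup.of, Units.coeHom_apply, coe_inv_legUnit]

theorem map_kappaOf {B B' : Type*} [Ring B] [Algebra ℂ B] [Ring B'] [Algebra ℂ B'] (q μ : ℂ)
    (f : B →ₐ[ℂ] B') (x : B) : f (kappaOf q μ x) = kappaOf q μ (f x) := by
  simp [kappaOf]

theorem leg_kappa (q μ : ℂ) (R : TMat ι 2 ℂ) {n : ℕ} (k : ℕ) (h : k + 1 < n) :
    kappaOf q μ (leg R k h : TMat ι n ℂ) = leg (kappaOf q μ R) k h := by
  have h1 := map_kappaOf q μ (placeHom (ι := ι) (adj k h) (adj_injective k h)) R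
  rw [placeHom_apply, placeHom_apply] at h1
  exact h1.symm

theorem IsBMWType.mul_kappa {q μ : ℂ} {R : TMat ι 2 ℂ} (hR : IsBMWType q μ R) :
    R * kappaOf q μ R = μ • kappaOf q μ R := by
  have h := minpoly.aeval ℂ R
  rw [hR.minimal] at h
  simp only [map_mul, map_sub, map_add, Polynomial.aeval_X, Polynomial.aeval_C,
    Algebra.algebraMap_eq_smul_one] at h
  simp only [kappaOf, Algebra.algebraMap_eq_smul_one]
  rw [mul_smul_comm, smul_comm μ]
  congr 1
  rw [← sub_eq_zero, ← neg_eq_zero, ← h]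
  simp only [mul_sub, sub_mul, mul_add, add_mul, smul_mul_assoc, mul_smul_comm, one_mul, mul_one,
    smul_sub, smul_add, smul_smul, mul_assoc]
  module

theorem IsBMWType.kappa_mul {q μ : ℂ} {R : TMat ι 2 ℂ} (hR : IsBMWType q μ R) :
    kappaOf q μ R * R = μ • kappaOf q μ R := by
  rw [← hR.mul_kappa]
  simp only [kappaOf, Algebra.algebraMap_eq_smul_one]
  simp only [mul_sub, sub_mul, mul_add, add_mul, smul_mul_assoc, mul_smul_comm, one_mul, mul_one,
    smul_sub, smul_add, smul_smul, mul_assoc]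

theorem IsBMWType.kappa_mul_inv {q μ : ℂ} {R : TMat ι 2 ℂ} (hR : IsBMWType q μ R) :
    kappaOf q μ R * R⁻¹ = μ⁻¹ • kappaOf q μ R := by
  have hdet : IsUnit R.det := (Matrix.isUnit_iff_isUnit_det R).mp hR.isUnit
  have h := congrArg (fun Y => μ⁻¹ • (Y * R⁻¹)) hR.kappa_mul
  simp only [mul_assoc, Matrix.mul_nonsing_inv R hdet, mul_one, smul_mul_assoc, smul_smul,
    inv_mul_cancel₀ hR.params.μ_ne_zero, one_smul] at h
  exact h.symm

theorem place_kappa_sigma_kappa {q μ : ℂ} {R : TMat ι 2 ℂ} (hR : IsBMWType q μ R) :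
    (place ![0, 1] (kappaOf q μ R) * place ![1, 2] R * place ![0, 1] (kappaOf q μ R) :
      TMat ι 3 ℂ) = μ⁻¹ • place ![0, 1] (kappaOf q μ R) := by
  have hinj : Function.Injective (![0, 1] : Fin 2 → Fin 3) := by decide
  have h := hR.kkk
  rw [mul_assoc, hR.kk, ← mul_assoc, ← mul_assoc, ← place_mul _ hinj, hR.kappa_mul,
    place_smul] at h
  simp only [smul_mul_assoc] at h
  rw [← h, smul_smul, inv_mul_cancel₀ hR.params.μ_ne_zero, one_smul, h]

theorem place_kappa_sigma_inv_kappa {q μ : ℂ} {R : TMat ι 2 ℂ} (hR : IsBMWType q μ R) :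
    (place ![0, 1] (kappaOf q μ R) * place ![1, 2] R⁻¹ * place ![0, 1] (kappaOf q μ R) :
      TMat ι 3 ℂ) = μ • place ![0, 1] (kappaOf q μ R) := by
  have hinj : Function.Injective (![0, 1] : Fin 2 → Fin 3) := by decide
  have h := hR.kkk
  rw [mul_assoc, hR.kk_inv, ← mul_assoc, ← mul_assoc, ← place_mul _ hinj, hR.kappa_mul_inv,
    place_smul] at h
  simp only [smul_mul_assoc] at h
  rw [← h, smul_smul, mul_inv_cancel₀ hR.params.μ_ne_zero, one_smul, h]

/-- The representation `ρ_R` of the BMW algebra `W_n(q, μ)` on `V^{⊗n}`, `σ_i ↦ R_i`. -/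
noncomputable def rho {q μ : ℂ} {R : TMat ι 2 ℂ} (hR : IsBMWType q μ R) (n : ℕ) :
    BMWAlgebra q μ n →ₐ[ℂ] TMat ι n ℂ :=
  RingQuot.liftAlgHom ℂ ⟨braidAlgebraRep hR.toIsRMatrix n, by
    intro x y hxy
    cases hxy with
    | sigma_kappa i =>
      rw [map_mul, map_smul, map_kappaOf, braidAlgebraRep_gen, leg_kappa, leg, leg,
        ← place_mul _ (adj_injective _ _), hR.mul_kappa, place_smul]
    | kappa_sigma i =>
      rw [map_mul, map_smul, map_kappaOf, braidAlgebraRep_gen, leg_kappa, leg, leg,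
        ← place_mul _ (adj_injective _ _), hR.kappa_mul, place_smul]
    | kappa_sigma_kappa i j h =>
      obtain ⟨j, hj⟩ := j
      simp only at h
      subst h
      rw [map_mul, map_mul, map_smul, map_kappaOf, braidAlgebraRep_gen, braidAlgebraRep_gen,
        leg_kappa, leg_eq_place_left _ (i : ℕ) (by omega), leg_eq_place_right _ (i : ℕ) (by omega),
        ← place_mul _ (triple_injective _ _), ← place_mul _ (triple_injective _ _),
        place_kappa_sigma_kappa hR, place_smul]
    | kappa_sigma_inv_kappa i j h =>
      obtain ⟨j, hj⟩ := j
      simp only at h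
      subst h
      rw [map_mul, map_mul, map_smul, map_kappaOf, braidAlgebraRep_gen, braidAlgebraRep_genInv,
        leg_kappa, leg_eq_place_left _ (i : ℕ) (by omega), leg_eq_place_right _ (i : ℕ) (by omega),
        ← place_mul _ (triple_injective _ _), ← place_mul _ (triple_injective _ _),
        place_kappa_sigma_inv_kappa hR, place_smul]⟩

end Representations

/-! ### Quantum matrix algebras -/

section QuantumMatrices

variable {ι : Type*} [Fintype ι] [DecidableEq ι]

/-- The matrix copies: `matCopy F M n k` is `M_{\overline{k+1}}` on `V^{⊗n}`, where
`M_{\overline 1} = M₁` and `M_{\overline{i+1}} = F_i M_{\overline i} F_i⁻¹`. -/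
noncomputable def matCopy {A : Type*} [Ring A] [Algebra ℂ A] (F : TMat ι 2 ℂ) (M : Matrix ι ι A)
    (n : ℕ) : (k : ℕ) → k < n → TMat ι n A
  | 0, h => place ![⟨0, h⟩] (M.submatrix (fun i => i 0) (fun i => i 0))
  | k + 1, h => (leg F k h).map (algebraMap ℂ A) * matCopy F M n k (by omega) *
      (leg F⁻¹ k h).map (algebraMap ℂ A)

/-- The product `M_{\overline 1} M_{\overline 2} ⋯ M_{\overline n}` on `V^{⊗n}`. -/
noncomputable def matCopies {A : Type*} [Ring A] [Algebra ℂ A] (F : TMat ι 2 ℂ)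
    (M : Matrix ι ι A) (n : ℕ) : TMat ι n A :=
  (List.ofFn fun k : Fin n => matCopy F M n k k.isLt).prod

/-- The matrix of generators of the free algebra `ℂ⟨M_a^b⟩`. -/
def freeM (ι : Type*) : Matrix ι ι (FreeAlgebra ℂ (ι × ι)) :=
  Matrix.of fun a b => FreeAlgebra.ι ℂ (a, b)

/-- The entries of the matrix relation `R₁ M_{\overline 1} M_{\overline 2} =
M_{\overline 1} M_{\overline 2} R₁`. -/
inductive QMRel (R F : TMat ι 2 ℂ) : FreeAlgebra ℂ (ι × ι) → FreeAlgebra ℂ (ι × ι) → Prop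
  | entry (i j : Fin 2 → ι) : QMRel R F
      ((R.map (algebraMap ℂ (FreeAlgebra ℂ (ι × ι))) * matCopies F (freeM ι) 2) i j)
      ((matCopies F (freeM ι) 2 * R.map (algebraMap ℂ (FreeAlgebra ℂ (ι × ι)))) i j)

/-- The quantum matrix algebra `M(R, F)`. -/
abbrev QMAlgebra (R F : TMat ι 2 ℂ) := RingQuot (QMRel R F)

/-- The matrix `M` of the generators of `M(R, F)`. -/
noncomputable def genM (R F : TMat ι 2 ℂ) : Matrix ι ι (QMAlgebra R F) :=
  (freeM ι).map (RingQuot.mkAlgHom ℂ (QMRel R F))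

/-- The multiple R-trace `Tr_{R(1,…,n)}(Y) = Tr_{(1,…,n)}((D_R)₁ ⋯ (D_R)_n Y)`. -/
noncomputable def rTrace {A : Type*} [Ring A] [Algebra ℂ A] (R : TMat ι 2 ℂ) {n : ℕ}
    (Y : TMat ι n A) : A :=
  ∑ i, ∑ j, (∏ k, matD R (i k) (j k)) • Y j i

variable {q μ : ℂ} {R : TMat ι 2 ℂ}

/-- `ch(α) = Tr_{R(1,…,n)}(M_{\overline 1} ⋯ M_{\overline n} ρ_R(α))`, for `α ∈ W_n(q, μ)`. -/
noncomputable def ch (hR : IsBMWType q μ R) (F : TMat ι 2 ℂ) {n : ℕ} (α : BMWAlgebra q μ n) :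
    QMAlgebra R F :=
  rTrace R (matCopies F (genM R F) n * (rho hR n α).map (algebraMap ℂ (QMAlgebra R F)))

/-- The power sums: `p₀ = Tr_R I`, `p₁ = Tr_R M` and `p_i = ch(σ_{i-1} ⋯ σ₂ σ₁)`. -/
noncomputable def powerSum (hR : IsBMWType q μ R) (F : TMat ι 2 ℂ) : ℕ → QMAlgebra R F
  | 0 => algebraMap ℂ (QMAlgebra R F) (matD R).trace
  | i + 1 => ch hR F
      (List.ofFn fun k : Fin i => sig q μ (i + 1) k (by omega)).reverse.prod

/-- `a₀ = 1` and `a_i = ch(a^{(i)})`. -/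
noncomputable def elemA (hR : IsBMWType q μ R) (F : TMat ι 2 ℂ) : ℕ → QMAlgebra R F
  | 0 => 1
  | i + 1 => ch hR F (antisymmetrizer q μ (i + 1) (i + 1) le_rfl)

/-- `s₀ = 1` and `s_i = ch(s^{(i)})`. -/
noncomputable def elemS (hR : IsBMWType q μ R) (F : TMat ι 2 ℂ) : ℕ → QMAlgebra R F
  | 0 => 1
  | i + 1 => ch hR F (symmetrizer q μ (i + 1) (i + 1) le_rfl)

/-- The 2-contraction `g = ch(c^{(2)})`, where `c^{(2)} = η⁻¹ κ₁`. -/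
noncomputable def contraction (hR : IsBMWType q μ R) (F : TMat ι 2 ℂ) : QMAlgebra R F :=
  ch hR F ((eta q μ)⁻¹ • kap q μ 2 0 (by omega))

end QuantumMatrices

end BMWQuantum

/-! The map `ch` behaves like the closure of a diagram around an annulus. It is a trace on the
algebra generated by the operators `R_k`, it turns juxtaposition of strands into multiplication, and
its values on that algebra commute. `BMWTrace` records exactly these properties together with the
BMW relations, and all three identities are derived from them.

Write H(i,m) = ch(a^{(i)} σ_{i+m-1}⋯σ_i) (`hook`) and K(i,m) = ch(a^{(i)} σ_{i+m}⋯σ_{i+1} κ_i)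
(`kook`). In the recursion for a^{(i+1)}, cyclicity and idempotence remove one of the two outer
copies of a^{(i)}. The three terms of the baxterized element then give (i+1)_q H(i+1,m) = q^i a_i
p_{m+1} - i_q H(i,m+1) - c_i K(i,m) (`hook_succ`). In the alternating sum over i the hooks telescope
to n_q a_n, and a sum of K's remains (`newton_aux`). The same expansion, written with σ⁻¹, expresses
K(i+1,m+1) as g times a combination of a_i p_{m+1}, K(i,m) and H(i,m+1) (`kook_succ_succ`).
Eliminating a_i p_{m+1} by the hook recursion produces a second telescoping sum, so the remainder on
n+2 strands is g times the remainder on n strands plus a multiple of a_n g (`newtonSum_add_two`).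
Unrolling this gives the sum over contractions.

The relations are invariant under q ↦ -q⁻¹, which exchanges antisymmetrizers and symmetrizers; part
2 is part 1 for the new parameter. For part 3 the Newton relations are read as congruences of power
series modulo X^{n+1}. Eliminating the power sums leaves W(q⁻¹X)(1 - q²gX²) ≡ W(qX)(1 - q⁻²gX²),
where W is the generating series of the alternating sums. Comparing coefficients forces W ≡ 1 - gX²
(`wronski_of_newton`).

It remains to verify the axioms for `ch`. One computation with the skew inverse
(`sum_smul_mul_eq_of_rll`) shows that the partial R-trace is unchanged by conjugation with `F`, and
that D_R ⊗ D_R commutes with `R`. The first fact gives multiplicativity (`chOp_mul`), the second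
cyclicity (`chOp_mul_comm`). Commutativity (`chOp_commute`) holds because powers of R_1⋯R_n permute
blocks of strands, and the full twist (R_1⋯R_n)^{n+1} is central. -/

namespace BMWQuantum

/-! ### Consequences of the BMW relations. -/

section Generators

/-- Elements `s i`, `i < N`, of an algebra, with inverses `t i`, that satisfy the relations of the
generators of a Birman-Murakami-Wenzl algebra, with `k i` in the role of `κ`. -/
structure BMWGens (q μ : ℂ) {B : Type*} [Ring B] [Algebra ℂ B] (N : ℕ) (s t k : ℕ → B) :
    Prop where
  params : BMWParams q μ
  st : ∀ i, i < N → s i * t i = 1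
  ts : ∀ i, i < N → t i * s i = 1
  t_eq : ∀ i, i < N → t i = s i - (q - q⁻¹) • 1 + (q - q⁻¹) • k i
  sk : ∀ i, i < N → s i * k i = μ • k i
  ks : ∀ i, i < N → k i * s i = μ • k i
  braid : ∀ i, i + 1 < N → s i * s (i + 1) * s i = s (i + 1) * s i * s (i + 1)
  comm : ∀ i j, i + 1 < j → j < N → Commute (s i) (s j)
  k_succ_mul_k : ∀ i, i + 1 < N → k (i + 1) * k i = s i * s (i + 1) * k i
  k_mul_k_succ : ∀ i, i + 1 < N → k i * k (i + 1) = s (i + 1) * s i * k (i + 1)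
  kkk : ∀ i, i + 1 < N → k i * k (i + 1) * k i = k i
  kkk' : ∀ i, i + 1 < N → k (i + 1) * k i * k (i + 1) = k (i + 1)

theorem BMWParams.sub_inv_ne_zero {q μ : ℂ} (h : BMWParams q μ) : q - q⁻¹ ≠ 0 := by
  have h0 := h.q_ne_zero
  intro h1
  have h2 : (q - 1) * (q + 1) = 0 := by
    field_simp at h1
    linear_combination h1
  rcases mul_eq_zero.mp h2 with h3 | h3
  · exact h.q_ne_one (sub_eq_zero.mp h3)
  · exact h.q_ne_neg_one (eq_neg_of_add_eq_zero_left h3)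

theorem BMWParams.eta_ne_zero {q μ : ℂ} (h : BMWParams q μ) : eta q μ ≠ 0 := by
  have h1 : q - μ ≠ 0 := sub_ne_zero.mpr h.μ_ne_q.symm
  have h2 : q⁻¹ + μ ≠ 0 := fun h2 => h.μ_ne_neg_inv (eq_neg_of_add_eq_zero_right h2)
  exact div_ne_zero (mul_ne_zero h1 h2) (mul_ne_zero h.μ_ne_zero h.sub_inv_ne_zero)

theorem BMWParams.eta_eq {q μ : ℂ} (h : BMWParams q μ) :
    (q - q⁻¹) * eta q μ = μ⁻¹ - μ + (q - q⁻¹) := by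
  have h0 := h.q_ne_zero
  have h1 := h.sub_inv_ne_zero
  have h2 := h.μ_ne_zero
  rw [eta, mul_comm μ, ← div_div, mul_div_assoc', mul_div_cancel₀ _ h1]
  field_simp
  ring

variable {q μ : ℂ} {B : Type*} [Ring B] [Algebra ℂ B] {N : ℕ} {s t k : ℕ → B}

namespace BMWGens

variable (H : BMWGens q μ N s t k)
include H

/-- Since κ is a linear combination of 1, σ and σ⁻¹, whatever commutes with the σ's or permutes
their indices does the same to the κ's; `commute_k` and `conj_k` rest on this. -/
theorem k_eq (i : ℕ) (hi : i < N) : k i = 1 + (q - q⁻¹)⁻¹ • (t i - s i) := by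
  have h := H.params.sub_inv_ne_zero
  have e : (q - q⁻¹) • k i = (q - q⁻¹) • (1 + (q - q⁻¹)⁻¹ • (t i - s i)) := by
    rw [smul_add, smul_smul, mul_inv_cancel₀ h, H.t_eq i hi]
    module
  exact (smul_right_injective B h) e

theorem commute_t {x : B} (i : ℕ) (hi : i < N) (h : Commute x (s i)) : Commute x (t i) := by
  rw [commute_iff_eq]
  calc x * t i = t i * (s i * x) * t i := by rw [← mul_assoc, H.ts i hi, one_mul]
    _ = t i * x * (s i * t i) := by rw [← h.eq]; simp only [mul_assoc]
    _ = t i * x := by rw [H.st i hi, mul_one]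

theorem commute_k {x : B} (i : ℕ) (hi : i < N) (h : Commute x (s i)) : Commute x (k i) := by
  rw [H.k_eq i hi]
  exact (Commute.one_right x).add_right (((H.commute_t i hi h).sub_right h).smul_right _)

theorem comm_k (i j : ℕ) (h : i + 1 < j) (hj : j < N) : Commute (k i) (k j) :=
  H.commute_k j hj (H.commute_k i (by omega) (H.comm i j h hj).symm).symm

theorem tk (i : ℕ) (hi : i < N) : t i * k i = μ⁻¹ • k i := by
  have h := congrArg (fun x => μ⁻¹ • (t i * x)) (H.sk i hi)
  simp only [mul_smul_comm, smul_smul, inv_mul_cancel₀ H.params.μ_ne_zero, one_smul] at h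
  rw [← h, ← mul_assoc, H.ts i hi, one_mul]

/-- Two evaluations of σ⁻¹κ are compared: the scalar μ⁻¹, and the expression of σ⁻¹ through σ and κ.
-/
theorem kk (i : ℕ) (hi : i < N) : k i * k i = eta q μ • k i := by
  have h := H.tk i hi
  rw [H.t_eq i hi, add_mul, sub_mul, smul_mul_assoc, smul_mul_assoc, one_mul, H.sk i hi] at h
  have e : (q - q⁻¹) • (k i * k i) = (q - q⁻¹) • (eta q μ • k i) := by
    rw [smul_smul, H.params.eta_eq]
    linear_combination (norm := module) (1 : ℂ) • h
  exact (smul_right_injective B H.params.sub_inv_ne_zero) e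

theorem s_sq (i : ℕ) (hi : i < N) :
    s i * s i = 1 + (q - q⁻¹) • s i - ((q - q⁻¹) * μ) • k i := by
  have h := H.st i hi
  rw [H.t_eq i hi, mul_add, mul_sub, mul_smul_comm, mul_smul_comm, mul_one, H.sk i hi] at h
  linear_combination (norm := module) (1 : ℂ) • h

theorem conj_t (x : B) (i j : ℕ) (hi : i < N) (hj : j < N) (h : x * s i = s j * x) :
    x * t i = t j * x := by
  calc x * t i = t j * (s j * x) * t i := by rw [← mul_assoc, H.ts j hj, one_mul]
    _ = t j * x * (s i * t i) := by rw [← h]; simp only [mul_assoc]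
    _ = t j * x := by rw [H.st i hi, mul_one]

theorem conj_k (x : B) (i j : ℕ) (hi : i < N) (hj : j < N) (h : x * s i = s j * x) :
    x * k i = k j * x := by
  rw [H.k_eq i hi, H.k_eq j hj, mul_add, add_mul, mul_smul_comm, smul_mul_assoc, mul_sub, sub_mul,
    h, H.conj_t x i j hi hj h, mul_one, one_mul]

theorem ssk (i : ℕ) (hi : i + 1 < N) : s i * s (i + 1) * k i = k (i + 1) * (s i * s (i + 1)) :=
  H.conj_k _ _ _ (by omega) hi (by rw [H.braid i hi, mul_assoc])

theorem ssk' (i : ℕ) (hi : i + 1 < N) : s (i + 1) * s i * k (i + 1) = k i * (s (i + 1) * s i) :=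
  H.conj_k _ _ _ hi (by omega) (by rw [← H.braid i hi, mul_assoc])

/-- Replace κ_{i+1}κ_i by σ_iσ_{i+1}κ_i inside κ_iκ_{i+1}κ_i = κ_i; the left κ_i then absorbs σ_i at
the cost of a factor μ. -/
theorem ksk (i : ℕ) (hi : i + 1 < N) : k i * s (i + 1) * k i = μ⁻¹ • k i := by
  have h := H.kkk i hi
  rw [mul_assoc, H.k_succ_mul_k i hi, ← mul_assoc, ← mul_assoc, H.ks i (by omega), smul_mul_assoc,
    smul_mul_assoc] at h
  conv_rhs => rw [← h]
  rw [smul_smul, inv_mul_cancel₀ H.params.μ_ne_zero, one_smul]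

theorem ksk' (i : ℕ) (hi : i + 1 < N) : k (i + 1) * s i * k (i + 1) = μ⁻¹ • k (i + 1) := by
  have h := H.kkk' i hi
  rw [mul_assoc, H.k_mul_k_succ i hi, ← mul_assoc, ← mul_assoc, H.ks _ hi, smul_mul_assoc,
    smul_mul_assoc] at h
  conv_rhs => rw [← h]
  rw [smul_smul, inv_mul_cancel₀ H.params.μ_ne_zero, one_smul]

theorem ktk' (i : ℕ) (hi : i + 1 < N) : k (i + 1) * t i * k (i + 1) = μ • k (i + 1) := by
  rw [H.t_eq i (by omega), mul_add, add_mul, mul_sub, sub_mul, mul_smul_comm, mul_smul_comm,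
    smul_mul_assoc, smul_mul_assoc, mul_one, H.ksk' i hi, H.kkk' i hi, H.kk _ hi, smul_smul,
    H.params.eta_eq]
  module

theorem s_succ_mul_k (i : ℕ) (hi : i + 1 < N) : s (i + 1) * k i = t i * (k (i + 1) * k i) := by
  rw [H.k_succ_mul_k i hi, ← mul_assoc, ← mul_assoc, H.ts i (by omega), one_mul]

theorem t_mul_k_succ (i : ℕ) (hi : i + 1 < N) : t i * k (i + 1) = s (i + 1) * k i * k (i + 1) := by
  have e := H.kkk' i hi
  rw [H.s_succ_mul_k i hi, mul_assoc, e]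

theorem k_succ_mul_s_mul_s (i : ℕ) (hi : i + 1 < N) :
    k (i + 1) * s i * s (i + 1) = k (i + 1) * k i := by
  rw [H.k_succ_mul_k i hi, H.ssk i hi, mul_assoc]

theorem k_succ_mul_k_mul_s (i : ℕ) (hi : i + 1 < N) :
    k (i + 1) * k i * s (i + 1) = k (i + 1) * t i := by
  have e := H.kkk' i hi
  rw [mul_assoc, H.k_mul_k_succ i hi, H.ssk' i hi] at e
  have e2 := congrArg (· * t i) e
  simp only [mul_assoc, H.st i (by omega), mul_one] at e2
  rw [mul_assoc, e2]

end BMWGens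

end Generators

/-! ### Idempotence and absorption for the antisymmetrizers. -/

section Antisymmetrizers

variable (q μ : ℂ) {B : Type*} [Ring B] [Algebra ℂ B]

/-- The recursion for the antisymmetrizers, in an arbitrary algebra. -/
noncomputable def asym (s k : ℕ → B) : ℕ → B
  | 0 => 1
  | 1 => 1
  | i + 2 => (q ^ (i + 1) / qNum q (i + 2)) •
      (asym s k (i + 1) *
        (1 + ((q ^ (-2 * ((i : ℤ) + 1)) - 1) / (q - q⁻¹)) • s i +
          ((q ^ (-2 * ((i : ℤ) + 1)) - 1) / (alphaC q μ (-1) * q ^ (-2 * ((i : ℤ) + 1)) + 1)) •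
            k i) *
        asym s k (i + 1))

/-- The coefficient of `κ` in the recursion for the antisymmetrizers. -/
noncomputable def kapCoeff (i : ℕ) : ℂ :=
  (q ^ (i + 1) - (q ^ (i + 1))⁻¹) * (μ * (q ^ (i + 1)) ^ 2 / (μ * (q ^ (i + 1)) ^ 2 + q))

variable {q μ} {N : ℕ} {s t k : ℕ → B}

/-- The value of μ excluded at j = i + 2 is the zero of the denominator in `kapCoeff`. -/
theorem AntisymDefined.ne_zero {n : ℕ} (h : AntisymDefined q μ n) (hq : q ≠ 0) (i : ℕ)
    (hi : i + 2 ≤ n) : μ * (q ^ (i + 1)) ^ 2 + q ≠ 0 := by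
  intro h0
  apply (h (i + 2) (by omega) hi).2
  have e : (q : ℂ) ^ (-2 * ((i + 2 : ℕ) : ℤ) + 3) = q * ((q ^ (i + 1)) ^ 2)⁻¹ := by
    rw [show (-2 * ((i + 2 : ℕ) : ℤ) + 3) = 1 + -(((i + 1) * 2 : ℕ) : ℤ) by push_cast; ring,
      zpow_add₀ hq, zpow_neg, zpow_natCast, pow_mul, zpow_one]
  rw [e]
  have hp : (q ^ (i + 1)) ^ 2 ≠ 0 := pow_ne_zero _ (pow_ne_zero _ hq)
  field_simp
  linear_combination h0

theorem qNum_mul {i : ℕ} (h : q - q⁻¹ ≠ 0) : (q - q⁻¹) * qNum q i = q ^ i - (q ^ i)⁻¹ := by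
  rw [qNum, mul_div_cancel₀ _ h]

/-- With q^{i+1} multiplied in, all coefficients of the baxterized element become functions of p =
q^{i+1}, which later computations treat as a free variable. -/
theorem qNum_smul_asym (hp : BMWParams q μ) {n : ℕ} (h : AntisymDefined q μ n) (i : ℕ)
    (hi : i + 2 ≤ n) :
    qNum q (i + 2) • asym q μ s k (i + 2) = asym q μ s k (i + 1) *
      (q ^ (i + 1) • 1 - qNum q (i + 1) • s i - kapCoeff q μ i • k i) *
        asym q μ s k (i + 1) := by
  have h0 := hp.q_ne_zero
  have h1 := hp.sub_inv_ne_zero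
  have h2 := hp.μ_ne_zero
  have h3 := h.ne_zero h0 i hi
  have h4 := (h (i + 2) (by omega) hi).1
  rw [asym, smul_smul, mul_div_cancel₀ _ h4]
  have e : (q : ℂ) ^ (-2 * ((i : ℤ) + 1)) = ((q ^ (i + 1)) ^ 2)⁻¹ := by
    rw [show (-2 * ((i : ℤ) + 1)) = -(((i + 1) * 2 : ℕ) : ℤ) by push_cast; ring,
      zpow_neg, zpow_natCast, pow_mul]
  have ea : alphaC q μ (-1) = q * μ⁻¹ := by simp [alphaC]
  rw [e, ea, ← smul_mul_assoc, ← mul_smul_comm]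
  congr 2
  have hp0 : q ^ (i + 1) ≠ 0 := pow_ne_zero _ h0
  rw [kapCoeff, qNum]
  generalize q ^ (i + 1) = p at *
  have c1 : p * (((p ^ 2)⁻¹ - 1) / (q - q⁻¹)) = -((p - p⁻¹) / (q - q⁻¹)) := by
    rw [mul_div_assoc', ← neg_div]
    congr 1
    field_simp
    ring
  have c2 : p * (((p ^ 2)⁻¹ - 1) / (q * μ⁻¹ * (p ^ 2)⁻¹ + 1)) =
      -((p - p⁻¹) * (μ * p ^ 2 / (μ * p ^ 2 + q))) := by
    have h5 : q * μ⁻¹ * (p ^ 2)⁻¹ + 1 ≠ 0 := by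
      intro h5
      apply h3
      field_simp at h5
      linear_combination h5
    field_simp
    ring
  rw [smul_add, smul_add, smul_smul, smul_smul, c1, c2]
  module

theorem asym_mem {S : Subalgebra ℂ B} (i : ℕ) (hs : ∀ j, j + 1 < i → s j ∈ S)
    (hk : ∀ j, j + 1 < i → k j ∈ S) : asym q μ s k i ∈ S := by
  induction i with
  | zero => exact one_mem _
  | succ i ih =>
    cases i with
    | zero => exact one_mem _
    | succ i =>
      have h := ih (fun j hj => hs j (by omega)) (fun j hj => hk j (by omega))
      exact Subalgebra.smul_mem _ (mul_mem (mul_mem h (add_mem (add_mem (one_mem _)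
        (Subalgebra.smul_mem _ (hs i (by omega)) _)) (Subalgebra.smul_mem _ (hk i (by omega)) _)))
        h) _

theorem asym_commute {x : B} (i : ℕ) (hs : ∀ j, j + 1 < i → Commute (s j) x)
    (hk : ∀ j, j + 1 < i → Commute (k j) x) : Commute (asym q μ s k i) x := by
  have h : asym q μ s k i ∈ Subalgebra.centralizer ℂ {x} := by
    refine asym_mem i ?_ ?_ <;> intro j hj <;> rw [Subalgebra.mem_centralizer_iff] <;>
      rintro y rfl
    · exact (hs j hj).symm
    · exact (hk j hj).symm
  rw [Subalgebra.mem_centralizer_iff] at h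
  exact (h x rfl).symm

theorem map_asym {B' : Type*} [Ring B'] [Algebra ℂ B'] (f : B →ₐ[ℂ] B') (s' k' : ℕ → B') (i : ℕ)
    (hs : ∀ j, j + 1 < i → f (s j) = s' j) (hk : ∀ j, j + 1 < i → f (k j) = k' j) :
    f (asym q μ s k i) = asym q μ s' k' i := by
  induction i with
  | zero => exact map_one f
  | succ i ih =>
    cases i with
    | zero => exact map_one f
    | succ i =>
      have h := ih (fun j hj => hs j (by omega)) (fun j hj => hk j (by omega))
      simp only [asym, map_smul, map_mul, map_add, map_one, h, hs i (by omega), hk i (by omega)]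

namespace BMWGens

variable (H : BMWGens q μ N s t k)
include H

theorem asym_commute_s (i j : ℕ) (hij : i ≤ j) (hj : j < N) : Commute (asym q μ s k i) (s j) :=
  asym_commute i (fun l hl => H.comm l j (by omega) hj)
    (fun l hl => (H.commute_k l (by omega) (H.comm l j (by omega) hj).symm).symm)

theorem asym_commute_k (i j : ℕ) (hij : i ≤ j) (hj : j < N) : Commute (asym q μ s k i) (k j) :=
  H.commute_k j hj (H.asym_commute_s i j hij hj)

/-- Up to a nonzero scalar κ is (q - σ)(q⁻¹ + σ), so it kills the eigenvalue -q⁻¹ of σ. -/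
theorem mul_k_of_mul_s {e : B} (i : ℕ) (hi : i < N) (h : e * s i = -q⁻¹ • e) :
    e * t i = -q • e ∧ e * k i = 0 := by
  have h0 := H.params.q_ne_zero
  have h1 : e * t i = -q • e := by
    have h2 := congrArg (fun x => -q • (x * t i)) h
    simp only [mul_assoc, H.st i hi, mul_one, smul_mul_assoc, smul_smul] at h2
    rw [h2]
    simp [h0]
  refine ⟨h1, ?_⟩
  rw [H.k_eq i hi, mul_add, mul_smul_comm, mul_sub, h1, h, mul_one]
  have : e + (q - q⁻¹)⁻¹ • (-q • e - -q⁻¹ • e) = (1 - (q - q⁻¹)⁻¹ * (q - q⁻¹)) • e := by module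
  rw [this, inv_mul_cancel₀ H.params.sub_inv_ne_zero, sub_self, zero_smul]

/-- This is the consequence of the Yang–Baxter equation for baxterized elements that makes the
recursion work: two consecutive factors acting on an antisymmetric `e` give something antisymmetric
in the next pair of strands. It is checked by reduction to normal form. -/
theorem baxter_mul_eq_zero {n : ℕ} (h : AntisymDefined q μ n) (i : ℕ) (hi : i + 3 ≤ n)
    (hN : i + 1 < N) {e : B} (he : e * s i = -q⁻¹ • e) :
    e * (q ^ (i + 2) • 1 - qNum q (i + 2) • s (i + 1) - kapCoeff q μ (i + 1) • k (i + 1)) *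
      (q ^ (i + 1) • 1 - qNum q (i + 1) • s i - kapCoeff q μ i • k i) *
        (s (i + 1) + q⁻¹ • 1) = 0 := by
  have h0 := H.params.q_ne_zero
  have h1 := H.params.sub_inv_ne_zero
  have d1 := h.ne_zero h0 i (by omega)
  have d2 := h.ne_zero h0 (i + 1) (by omega)
  obtain ⟨he', hek⟩ := H.mul_k_of_mul_s i (by omega) he
  -- The rules `r1`–`r6` rewrite every word that occurs as a combination of e times 1, σ_{i+1},
  -- κ_{i+1}, κ_{i+1}σ_i, κ_{i+1}κ_i and σ_{i+1}σ_i. The last word cancels by `r3`; the other five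
  -- have the coefficients `c0`–`c4`.
  have r1 : e * s (i + 1) * s (i + 1) = e + (q - q⁻¹) • (e * s (i + 1)) -
      ((q - q⁻¹) * μ) • (e * k (i + 1)) := by
    rw [mul_assoc, H.s_sq _ hN, mul_sub, mul_add, mul_one, mul_smul_comm, mul_smul_comm]
  have r2 : e * k (i + 1) * s (i + 1) = μ • (e * k (i + 1)) := by
    rw [mul_assoc, H.ks _ hN, mul_smul_comm]
  have r3 : e * s (i + 1) * s i * s (i + 1) = -q⁻¹ • (e * s (i + 1) * s i) := by
    rw [mul_assoc, mul_assoc, ← mul_assoc (s (i + 1)), ← H.braid i hN, mul_assoc, ← mul_assoc,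
      he, smul_mul_assoc, mul_assoc]
  have r4 : e * s (i + 1) * k i = -q • (e * k (i + 1) * k i) := by
    rw [mul_assoc, H.s_succ_mul_k i hN, ← mul_assoc, he', smul_mul_assoc, mul_assoc]
  have r5 : e * k (i + 1) * k i * s (i + 1) = e * k (i + 1) * s i -
      (q - q⁻¹) • (e * k (i + 1)) + (q - q⁻¹) • (e * k (i + 1) * k i) := by
    rw [mul_assoc, mul_assoc, ← mul_assoc (k (i + 1)), H.k_succ_mul_k_mul_s i hN,
      H.t_eq i (by omega), ← mul_assoc, mul_add, mul_sub, mul_smul_comm, mul_smul_comm, mul_one]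
  have r6 : e * k (i + 1) * s i * s (i + 1) = e * k (i + 1) * k i := by
    rw [mul_assoc, mul_assoc, ← mul_assoc (k (i + 1)), H.k_succ_mul_s_mul_s i hN, mul_assoc]
  have hu : qNum q (i + 2) = (q * q ^ (i + 1) - (q * q ^ (i + 1))⁻¹) / (q - q⁻¹) := by
    rw [qNum]; ring
  have hc : kapCoeff q μ (i + 1) = (q * q ^ (i + 1) - (q * q ^ (i + 1))⁻¹) *
      (μ * (q * q ^ (i + 1)) ^ 2 / (μ * (q * q ^ (i + 1)) ^ 2 + q)) := by
    rw [kapCoeff]; ring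
  have hp' : q ^ (i + 2) = q * q ^ (i + 1) := by ring
  have d2' : μ * (q * q ^ (i + 1)) ^ 2 + q ≠ 0 := by
    rw [← hp']; exact d2
  have hu' : qNum q (i + 1) = (q ^ (i + 1) - (q ^ (i + 1))⁻¹) / (q - q⁻¹) := rfl
  have hc' : kapCoeff q μ i = (q ^ (i + 1) - (q ^ (i + 1))⁻¹) *
    (μ * (q ^ (i + 1)) ^ 2 / (μ * (q ^ (i + 1)) ^ 2 + q)) := rfl
  have hp0 : q ^ (i + 1) ≠ 0 := pow_ne_zero _ h0
  rw [hp']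
  generalize kapCoeff q μ (i + 1) = c at *
  generalize kapCoeff q μ i = c' at *
  generalize qNum q (i + 2) = u at *
  generalize qNum q (i + 1) = u' at *
  generalize q ^ (i + 1) = p at *
  have hq2 : q ^ 2 - 1 ≠ 0 := by
    intro hq
    apply h1
    field_simp
    simpa using hq
  have hq3 : q - q⁻¹ = (q ^ 2 - 1) / q := by
    field_simp
  have d2'' : μ * q * p ^ 2 + 1 ≠ 0 := by
    intro hq
    apply d2'
    linear_combination q * hq
  have gu : u = (q ^ 2 * p ^ 2 - 1) / (p * (q ^ 2 - 1)) := by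
    rw [hu, hq3]
    field_simp
  have gu' : u' = q * (p ^ 2 - 1) / (p * (q ^ 2 - 1)) := by
    rw [hu', hq3]
    field_simp
  have gc : c = (q ^ 2 * p ^ 2 - 1) * μ * p / (μ * q * p ^ 2 + 1) := by
    rw [hc, show μ * (q * p) ^ 2 + q = q * (μ * q * p ^ 2 + 1) by ring]
    generalize μ * q * p ^ 2 + 1 = D at *
    field_simp
  have gc' : c' = (p ^ 2 - 1) * μ * p / (μ * p ^ 2 + q) := by
    rw [hc']
    generalize μ * p ^ 2 + q = D at *
    field_simp
  clear hu hu' hc hc'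
  -- The denominators are kept as atoms while fractions are cleared, and are expanded only in the
  -- final polynomial identity.
  obtain ⟨D, hD⟩ : ∃ D, D = μ * q * p ^ 2 + 1 := ⟨_, rfl⟩
  obtain ⟨E, hE⟩ : ∃ E, E = μ * p ^ 2 + q := ⟨_, rfl⟩
  rw [← hD] at gc d2''
  rw [← hE] at gc' d1
  have c0 : p * (q * p * q⁻¹ - u) + u' * (q * p) * q⁻¹ ^ 2 = 0 := by
    rw [gu, gu']
    field_simp
    ring
  have c1 : p * (q * p - u * (q - q⁻¹) - u * q⁻¹) + u' * (q * p) * q⁻¹ = 0 := by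
    rw [gu, gu', hq3]
    field_simp
    ring
  have c3 : c * u' * q⁻¹ + c' * (c - q * u) = 0 := by
    rw [gu, gu', gc, gc']
    field_simp
    rw [hD, hE]
    ring
  have c2 : p * (u * (q - q⁻¹) * μ - c * (μ + q⁻¹)) - (q - q⁻¹) * (c' * (c - q * u)) = 0 := by
    rw [gu, gc, gc', hq3]
    field_simp
    rw [hD, hE]
    ring
  have expand : e * ((q * p) • 1 - u • s (i + 1) - c • k (i + 1)) *
      (p • 1 - u' • s i - c' • k i) * (s (i + 1) + q⁻¹ • 1) =
      (p * (q * p * q⁻¹ - u) + u' * (q * p) * q⁻¹ ^ 2) • e +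
      (p * (q * p - u * (q - q⁻¹) - u * q⁻¹) + u' * (q * p) * q⁻¹) • (e * s (i + 1)) +
      (p * (u * (q - q⁻¹) * μ - c * (μ + q⁻¹)) - (q - q⁻¹) * (c' * (c - q * u))) •
        (e * k (i + 1)) +
      (c * u' * q⁻¹ + c' * (c - q * u)) • (e * k (i + 1) * s i) +
      (c * u' + (c' * (c - q * u)) * (q - q⁻¹ + q⁻¹)) • (e * k (i + 1) * k i) := by
    simp only [mul_add, mul_sub, sub_mul, mul_smul_comm, smul_mul_assoc, mul_one, he, hek,
      r1, r2, r3, r4, r5, r6, smul_zero, zero_mul]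
    module
  have c4 : c * u' + (c' * (c - q * u)) * (q - q⁻¹ + q⁻¹) = 0 := by
    rw [sub_add_cancel]
    have := congrArg (q * ·) c3
    simp only [mul_add, mul_zero] at this
    rw [← this]
    field_simp
  rw [expand, c0, c1, c2, c3, c4]
  simp

/-- The two statements need each other: absorption of σ_i on the right by a^{(i+2)} uses idempotence
and absorption on fewer strands, and idempotence then follows because the baxterized element acts as
a scalar. -/
theorem asym_properties {n : ℕ} (h : AntisymDefined q μ n) (i : ℕ) (hi : i ≤ n) (hN : i ≤ N + 1) :
    asym q μ s k i * asym q μ s k i = asym q μ s k i ∧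
      ∀ j, j + 1 < i → asym q μ s k i * s j = -q⁻¹ • asym q μ s k i := by
  have h0 := H.params.q_ne_zero
  have h1 := H.params.sub_inv_ne_zero
  induction i using Nat.strong_induction_on with
  | _ i ih =>
    match i, hi, hN, ih with
    | 0, _, _, _ => exact ⟨one_mul 1, fun j hj => by omega⟩
    | 1, _, _, _ => exact ⟨one_mul 1, fun j hj => by omega⟩
    | i + 2, hi, hN, ih =>
      obtain ⟨hA, hAs⟩ := ih (i + 1) (by omega) (by omega) (by omega)
      have h4 := (h (i + 2) (by omega) hi).1
      have hrec := qNum_smul_asym (s := s) (k := k) H.params h i hi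
      have hrec' : asym q μ s k (i + 2) = (qNum q (i + 2))⁻¹ • (asym q μ s k (i + 1) *
          (q ^ (i + 1) • 1 - qNum q (i + 1) • s i - kapCoeff q μ i • k i) *
          asym q μ s k (i + 1)) := by
        rw [← hrec, smul_smul, inv_mul_cancel₀ h4, one_smul]
      have hright : asym q μ s k (i + 2) * asym q μ s k (i + 1) = asym q μ s k (i + 2) := by
        rw [hrec', smul_mul_assoc, mul_assoc, hA]
      have hsi : asym q μ s k (i + 2) * s i = -q⁻¹ • asym q μ s k (i + 2) := by
        suffices hh : asym q μ s k (i + 1) *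
            (q ^ (i + 1) • 1 - qNum q (i + 1) • s i - kapCoeff q μ i • k i) *
            asym q μ s k (i + 1) * (s i + q⁻¹ • 1) = 0 by
          have h5 : asym q μ s k (i + 2) * (s i + q⁻¹ • 1) = 0 := by
            rw [hrec', smul_mul_assoc, hh, smul_zero]
          rw [mul_add, mul_smul_comm, mul_one] at h5
          rw [neg_smul]
          exact eq_neg_of_add_eq_zero_left h5
        cases i with
        -- On two strands a^{(1)} = 1, and the claim is the cubic relation for σ_0; `e1` says that
        -- the coefficient of κ is exactly the one that makes κ_0 drop out.
        | zero =>
          have hA1 : asym q μ s k (0 + 1) = 1 := rfl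
          have d := h.ne_zero h0 0 hi
          have e0 : qNum q (0 + 1) = 1 := by
            rw [qNum, zero_add, pow_one, div_self h1]
          have e1 : kapCoeff q μ 0 * (μ + q⁻¹) = (q - q⁻¹) * μ := by
            rw [zero_add, pow_one] at d
            have d' : q * μ + 1 ≠ 0 := fun h => d (by linear_combination q * h)
            rw [kapCoeff, zero_add, pow_one, show μ * q ^ 2 + q = q * (q * μ + 1) by ring]
            have d'' : μ + q⁻¹ = (q * μ + 1) * q⁻¹ := by
              field_simp
            rw [d'']
            generalize q * μ + 1 = D at *
            field_simp
          have e2 : q * q⁻¹ = 1 := mul_inv_cancel₀ h0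
          rw [hA1, one_mul, mul_one, e0, zero_add, pow_one]
          generalize kapCoeff q μ 0 = c at *
          rw [mul_add, sub_mul, sub_mul, smul_mul_assoc, smul_mul_assoc, smul_mul_assoc, one_mul,
            H.s_sq 0 (by omega), H.ks 0 (by omega), mul_smul_comm, mul_one]
          have : q • s 0 - (1 : ℂ) • (1 + (q - q⁻¹) • s 0 - ((q - q⁻¹) * μ) • k 0) -
              c • μ • k 0 + q⁻¹ • (q • 1 - (1 : ℂ) • s 0 - c • k 0) =
              (q * q⁻¹ - 1) • 1 + ((q - q⁻¹) * μ - c * (μ + q⁻¹)) • k 0 := by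
            module
          rw [this, e1, e2]
          simp
        | succ i =>
          obtain ⟨hA', -⟩ := ih (i + 1) (by omega) (by omega) (by omega)
          have hrecA := qNum_smul_asym (s := s) (k := k) H.params h i (by omega)
          have h5 := (h (i + 2) (by omega) (by omega)).1
          have hc1 : Commute (asym q μ s k (i + 1))
              (q ^ (i + 2) • 1 - qNum q (i + 2) • s (i + 1) - kapCoeff q μ (i + 1) • k (i + 1)) :=
            (((Commute.one_right _).smul_right _).sub_right
              ((H.asym_commute_s _ _ le_rfl (by omega)).smul_right _)).sub_right
              ((H.asym_commute_k _ _ le_rfl (by omega)).smul_right _)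
          have hc2 : Commute (asym q μ s k (i + 1)) (s (i + 1) + q⁻¹ • 1) :=
            (H.asym_commute_s _ _ le_rfl (by omega)).add_right
              ((Commute.one_right _).smul_right _)
          have hAA' : asym q μ s k (i + 2) * asym q μ s k (i + 1) = asym q μ s k (i + 2) := by
            have h6 := congrArg (fun x => (qNum q (i + 2))⁻¹ • (x * asym q μ s k (i + 1))) hrecA
            rw [mul_assoc (_ * _) (asym q μ s k (i + 1)), hA', ← hrecA] at h6
            simpa only [smul_mul_assoc, smul_smul, inv_mul_cancel₀ h5, one_smul] using h6
          have hb := H.baxter_mul_eq_zero h i (by omega) (by omega) (hAs i (by omega))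
          have h7 : qNum q (i + 2) • (asym q μ s k (i + 2) *
              (q ^ (i + 2) • 1 - qNum q (i + 2) • s (i + 1) - kapCoeff q μ (i + 1) • k (i + 1)) *
              asym q μ s k (i + 2) * (s (i + 1) + q⁻¹ • 1)) = 0 := by
            rw [← smul_mul_assoc, ← mul_smul_comm, hrecA]
            generalize q ^ (i + 2) • (1 : B) - qNum q (i + 2) • s (i + 1) -
              kapCoeff q μ (i + 1) • k (i + 1) = x at *
            generalize q ^ (i + 1) • (1 : B) - qNum q (i + 1) • s i - kapCoeff q μ i • k i = y at *
            generalize s (i + 1) + q⁻¹ • 1 = z at *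
            -- The right antisymmetrizer is expanded once more. Its copies of a^{(i+1)} commute with
            -- σ_{i+1} and κ_{i+1}, so one is absorbed on the left, the other leaves on the right,
            -- and the three-strand identity remains in the middle.
            calc asym q μ s k (i + 2) * x * (asym q μ s k (i + 1) * y * asym q μ s k (i + 1)) * z
                = asym q μ s k (i + 2) * (x * asym q μ s k (i + 1)) * y *
                  (asym q μ s k (i + 1) * z) := by simp only [mul_assoc]
              _ = (asym q μ s k (i + 2) * asym q μ s k (i + 1)) * x * y * z *
                  asym q μ s k (i + 1) := by rw [← hc1.eq, hc2.eq]; simp only [mul_assoc]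
              _ = 0 := by rw [hAA', hb, zero_mul]
          exact (smul_eq_zero.mp h7).resolve_left h5
      obtain ⟨-, hki⟩ := H.mul_k_of_mul_s i (by omega) hsi
      refine ⟨?_, ?_⟩
      -- By absorption σ_i acts as -q⁻¹ and κ_i as 0, so the baxterized element becomes the scalar
      -- q^{i+1} + q⁻¹ (i+1)_q = (i+2)_q.
      · conv_lhs => arg 2; rw [hrec']
        rw [mul_smul_comm, ← mul_assoc, ← mul_assoc, hright, mul_sub, mul_sub, mul_smul_comm,
          mul_smul_comm, mul_smul_comm, hsi, hki, mul_one, smul_zero, sub_zero, smul_smul,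
          ← sub_smul, smul_mul_assoc, hright, smul_smul]
        have : (qNum q (i + 2))⁻¹ * (q ^ (i + 1) - qNum q (i + 1) * -q⁻¹) = 1 := by
          rw [inv_mul_eq_one₀ h4]
          have a1 := qNum_mul (q := q) (i := i + 2) h1
          have a2 := qNum_mul (q := q) (i := i + 1) h1
          rw [show q ^ (i + 2) = q * q ^ (i + 1) by ring, mul_inv] at a1
          apply mul_left_cancel₀ h1
          linear_combination a1 - q⁻¹ * a2
        rw [this, one_smul]
      · intro j hj
        by_cases hji : j = i
        · rw [hji, hsi]
        · rw [← hright, mul_assoc, hAs j (by omega), mul_smul_comm]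

end BMWGens

end Antisymmetrizers

end BMWQuantum

namespace BMWQuantum

/-! ### Descending chains of generators. -/

section Descending

variable {B : Type*} [Ring B] [Algebra ℂ B]

/-- The product `s (i + m - 1) ⋯ s (i + 1) s i` of `m` factors with descending indices. -/
def dsc (s : ℕ → B) (i : ℕ) : ℕ → B
  | 0 => 1
  | m + 1 => s (i + m) * dsc s i m

omit [Algebra ℂ B] in
theorem dsc_succ_right (s : ℕ → B) (i m : ℕ) : dsc s i (m + 1) = dsc s (i + 1) m * s i := by
  induction m with
  | zero => simp [dsc]
  | succ m ih => rw [dsc, ih, dsc, mul_assoc, show i + 1 + m = i + (m + 1) by omega]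

theorem dsc_mem {S : Subalgebra ℂ B} {s : ℕ → B} (h : ∀ i, s i ∈ S) (i m : ℕ) : dsc s i m ∈ S := by
  induction m with
  | zero => exact one_mem _
  | succ m ih => exact mul_mem (h _) ih

omit [Algebra ℂ B] in
theorem commute_dsc {s : ℕ → B} {x : B} (i m : ℕ) (h : ∀ j, i ≤ j → j < i + m → Commute x (s j)) :
    Commute x (dsc s i m) := by
  induction m with
  | zero => exact Commute.one_right x
  | succ m ih =>
    exact (h _ (by omega) (by omega)).mul_right (ih fun j h1 h2 => h j h1 (by omega))

theorem map_dsc {B' : Type*} [Ring B'] [Algebra ℂ B'] (f : B →ₐ[ℂ] B') {s : ℕ → B} {s' : ℕ → B'}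
    (i i' m : ℕ) (h : ∀ j, j < m → f (s (i + j)) = s' (i' + j)) :
    f (dsc s i m) = dsc s' i' m := by
  induction m with
  | zero => exact map_one f
  | succ m ih => rw [dsc, dsc, map_mul, h m (by omega), ih fun j hj => h j (by omega)]

variable {q μ : ℂ} {N : ℕ} {s t k : ℕ → B}

/-- Only the factors σ_{j+1}σ_j of the chain interact with σ_j, and there σ_jσ_{j+1}σ_j =
σ_{j+1}σ_jσ_{j+1} raises the index by one. -/
theorem BMWGens.s_mul_dsc (H : BMWGens q μ N s t k) (i m j : ℕ) (hij : i ≤ j) (hj : j + 1 < i + m)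
    (hN : i + m ≤ N) : s j * dsc s i m = dsc s i m * s (j + 1) := by
  induction m with
  | zero => omega
  | succ m ih =>
    by_cases h : j + 1 < i + m
    · rw [dsc, ← mul_assoc, (H.comm j (i + m) h (by omega)).eq, mul_assoc, ih h (by omega),
        mul_assoc]
    · obtain ⟨m, rfl⟩ : ∃ m', m = m' + 1 := ⟨m - 1, by omega⟩
      obtain rfl : j = i + m := by omega
      have hc : Commute (s (i + m + 1)) (dsc s i m) :=
        commute_dsc _ _ fun l h1 h2 => (H.comm l (i + m + 1) (by omega) (by omega)).symm
      rw [dsc, dsc, ← add_assoc i m 1]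
      simp only [mul_assoc]
      rw [← hc.eq]
      simp only [← mul_assoc]
      rw [H.braid _ (by omega)]

theorem BMWGens.k_mul_dsc (H : BMWGens q μ N s t k) (i m j : ℕ) (hij : i ≤ j) (hj : j + 1 < i + m)
    (hN : i + m ≤ N) : k j * dsc s i m = dsc s i m * k (j + 1) :=
  (H.conj_k _ _ _ (by omega) (by omega) (H.s_mul_dsc i m j hij hj hN).symm).symm

theorem BMWGens.k_commute_dsc (H : BMWGens q μ N s t k) (i m j : ℕ) (hN : i + m ≤ N) (hj : j < N)
    (h : i + m < j ∨ j + 1 < i) : Commute (k j) (dsc s i m) :=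
  commute_dsc _ _ fun l h1 h2 => by
    rcases h with h | h
    · exact (H.commute_k j hj (H.comm l j (by omega) hj)).symm
    · exact (H.commute_k j hj (H.comm j l (by omega) (by omega)).symm).symm

end Descending

/-! ### Traces on towers of BMW algebras and the removal of contractions. -/

/-- Linear maps `φ n` from algebras that contain generators of Birman-Murakami-Wenzl algebras on
`n` strands. They are traces on subalgebras `S n`, and they turn the juxtaposition of strands into
the product of commuting elements. -/
structure BMWTrace (q μ : ℂ) {A : Type*} [Ring A] [Algebra ℂ A] {B : ℕ → Type*}
    [∀ n, Ring (B n)] [∀ n, Algebra ℂ (B n)] (s t k : ∀ n, ℕ → B n)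
    (S : ∀ n, Subalgebra ℂ (B n)) (φ : ∀ n, B n →ₗ[ℂ] A) : Prop where
  gens : ∀ n, BMWGens q μ (n - 1) (s n) (t n) (k n)
  s_mem : ∀ n i, s n i ∈ S n
  t_mem : ∀ n i, t n i ∈ S n
  k_mem : ∀ n i, k n i ∈ S n
  tr : ∀ n, ∀ x ∈ S n, ∀ y, φ n (x * y) = φ n (y * x)
  mul : ∀ m l n, m + l = n → ∃ (f : B m →ₐ[ℂ] B n) (f' : B l →ₐ[ℂ] B n),
    (∀ i, i + 1 < m → f (s m i) = s n i ∧ f (k m i) = k n i) ∧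
    (∀ i, i + 1 < l → f' (s l i) = s n (m + i) ∧ f' (k l i) = k n (m + i)) ∧
    ∀ x ∈ S m, ∀ y ∈ S l, φ n (f x * f' y) = φ m x * φ l y
  comm : ∀ m l, 0 < m → ∀ x ∈ S m, ∀ y ∈ S l, Commute (φ m x) (φ l y)
  zero : φ 0 1 = 1

namespace BMWTrace

variable {q μ : ℂ} {A : Type*} [Ring A] [Algebra ℂ A] {B : ℕ → Type*}
    [∀ n, Ring (B n)] [∀ n, Algebra ℂ (B n)] {s t k : ∀ n, ℕ → B n}
    {S : ∀ n, Subalgebra ℂ (B n)} {φ : ∀ n, B n →ₗ[ℂ] A}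
    (H : BMWTrace q μ s t k S φ)

variable (q μ s k φ) in
/-- The elementary element `φ (a^{(i)})`. -/
noncomputable def elem (i : ℕ) : A := φ i (asym q μ (s i) (k i) i)

variable (s φ) in
/-- The power sum `φ (σ_{i-1} ⋯ σ₁)`. -/
noncomputable def pow (i : ℕ) : A := φ i (dsc (s i) 0 (i - 1))

variable (q μ k φ) in
/-- The contraction. -/
noncomputable def con : A := (eta q μ)⁻¹ • φ 2 (k 2 0)

include H

theorem asym_mem (n i : ℕ) : asym q μ (s n) (k n) i ∈ S n :=
  BMWQuantum.asym_mem i (fun j _ => H.s_mem n j) (fun j _ => H.k_mem n j)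

theorem phi_k : φ 2 (k 2 0) = eta q μ • con q μ k φ := by
  rw [con, smul_smul, mul_inv_cancel₀ (H.gens 2).params.eta_ne_zero, one_smul]

/-- A contraction of the last two strands splits off. -/
theorem phi_mul_k_last (n : ℕ) (P : ∀ n, B n) (hP : P n ∈ S n)
    (hf : ∀ f : B n →ₐ[ℂ] B (n + 2), (∀ i, i + 1 < n → f (s n i) = s (n + 2) i ∧
      f (k n i) = k (n + 2) i) → f (P n) = P (n + 2)) :
    φ (n + 2) (P (n + 2) * k (n + 2) n) = eta q μ • (φ n (P n) * con q μ k φ) := by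
  obtain ⟨f, f', h1, h2, h3⟩ := H.mul n 2 (n + 2) rfl
  have h := h3 _ hP _ (H.k_mem 2 0)
  rw [hf f h1, (h2 0 (by omega)).2, H.phi_k, mul_smul_comm] at h
  exact h

/-- A κ travels along a chain under the trace: cyclicity brings κ_c to the front, the chain turns it
into κ_{c+1}, and `Z`, `Y` do not obstruct the passage. -/
theorem phi_slide (n i m b c : ℕ) (Z Y : B n) (hc : c + 1 ≤ i + m) (hn : i + m + 1 ≤ n)
    (hb : i ≤ b) (hbc : b ≤ c) (hZ : ∀ l, b ≤ l → l < c → Commute Z (k n l))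
    (hY : ∀ l, b ≤ l → l < c → Commute Y (k n (l + 1))) :
    φ n (Z * dsc (s n) i m * Y * k n b) = φ n (Z * dsc (s n) i m * Y * k n c) := by
  induction c, hbc using Nat.le_induction with
  | base => rfl
  | succ c hbc ih =>
    rw [ih (by omega) (fun l h1 h2 => hZ l h1 (by omega)) (fun l h1 h2 => hY l h1 (by omega)),
      ← H.tr n _ (H.k_mem n c)]
    have e1 := (hZ c hbc (by omega)).eq
    have e2 := (hY c hbc (by omega)).eq
    have e3 := (H.gens n).k_mul_dsc i m c (by omega) (by omega) (by omega)
    congr 1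
    calc k n c * (Z * dsc (s n) i m * Y) = k n c * Z * dsc (s n) i m * Y := by
          simp only [mul_assoc]
      _ = Z * (k n c * dsc (s n) i m) * Y := by rw [← e1]; simp only [mul_assoc]
      _ = Z * dsc (s n) i m * (k n (c + 1) * Y) := by rw [e3]; simp only [mul_assoc]
      _ = Z * dsc (s n) i m * Y * k n (c + 1) := by rw [← e2]; simp only [mul_assoc]

/-- Since κ = η⁻¹κ², one copy of κ can be moved around the trace to the other side of `X`, where κXκ
is a multiple of κ. -/
theorem phi_k_conj (n b : ℕ) (hb : b + 1 < n) (Z X W : B n) (c : ℂ)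
    (hX : k n b * X * k n b = c • k n b) (hZ : Commute Z (k n b)) (hW : Commute W (k n b)) :
    φ n (Z * X * W * k n b) = ((eta q μ)⁻¹ * c) • φ n (Z * W * k n b) := by
  have hk := (H.gens n).kk b (by omega)
  have h1 : k n b = (eta q μ)⁻¹ • (k n b * k n b) := by
    rw [hk, smul_smul, inv_mul_cancel₀ (H.gens n).params.eta_ne_zero, one_smul]
  conv_lhs => rw [h1]
  rw [mul_smul_comm, map_smul, ← mul_assoc, ← H.tr n _ (H.k_mem n b), mul_smul]
  congr 1
  rw [← map_smul]
  congr 1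
  calc k n b * (Z * X * W * k n b) = k n b * Z * X * (W * k n b) := by simp only [mul_assoc]
    _ = Z * (k n b * X * k n b) * W := by rw [hW.eq, ← hZ.eq]; simp only [mul_assoc]
    _ = c • (Z * W * k n b) := by
      rw [hX, mul_smul_comm, smul_mul_assoc, mul_assoc, ← hW.eq, mul_assoc]

/-- Here `P n i` stands for one fixed word placed on `n` strands with its indices raised by `i`. -/
theorem phi_elem_mul (m l n : ℕ) (hn : m + l = n) (P : ∀ n, ℕ → B n) (hP : P l 0 ∈ S l)
    (hf : ∀ f : B l →ₐ[ℂ] B n, (∀ i, i + 1 < l → f (s l i) = s n (m + i) ∧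
      f (k l i) = k n (m + i)) → f (P l 0) = P n m) :
    φ n (asym q μ (s n) (k n) m * P n m) = elem q μ s k φ m * φ l (P l 0) := by
  obtain ⟨f, f', h1, h2, h3⟩ := H.mul m l n hn
  rw [elem, ← h3 _ (H.asym_mem m m) _ hP, hf f' h2,
    map_asym f (s n) (k n) m (fun j hj => (h1 j hj).1) (fun j hj => (h1 j hj).2)]

theorem phi_asym_mul_dsc (j m n : ℕ) (hn : j + 2 + m = n) :
    φ n (asym q μ (s n) (k n) (j + 1) * dsc (s n) (j + 1) m) =
      elem q μ s k φ (j + 1) * pow s φ (m + 1) := by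
  refine H.phi_elem_mul (j + 1) (m + 1) n (by omega) (fun n i => dsc (s n) i m)
    (dsc_mem (H.s_mem _) _ _) fun f hf => ?_
  refine map_dsc f _ _ _ fun i hi => ?_
  rw [zero_add, (hf i (by omega)).1]

/-- The factor σ_1 at the end of the chain is absorbed through κ_0σ_1κ_0 = μ⁻¹κ_0. What remains is κ
on the first two strands beside a chain on the others. -/
theorem phi_dsc_mul_k (m : ℕ) :
    φ (m + 3) (dsc (s (m + 3)) 1 (m + 1) * k (m + 3) 0) =
      μ⁻¹ • (pow s φ (m + 1) * con q μ k φ) := by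
  have G := H.gens (m + 3)
  have hc : Commute (dsc (s (m + 3)) 2 m) (k (m + 3) 0) :=
    (G.k_commute_dsc 2 m 0 (by omega) (by omega) (by omega)).symm
  have h1 := H.phi_k_conj (m + 3) 0 (by omega) (dsc (s (m + 3)) 2 m) (s (m + 3) 1) 1 μ⁻¹
    (G.ksk 0 (by omega)) hc (Commute.one_left _)
  obtain ⟨f, f', h2, h3, h4⟩ := H.mul 2 (m + 1) (m + 3) (by omega)
  have h5 := h4 _ (H.k_mem 2 0) (dsc (s (m + 1)) 0 m) (dsc_mem (H.s_mem _) _ _)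
  rw [(h2 0 (by omega)).2, map_dsc f' (s' := s (m + 3)) 0 2 m fun i hi => by
    rw [zero_add, (h3 i (by omega)).1]] at h5
  rw [dsc_succ_right, ← mul_one (_ * s (m + 3) 1), h1, mul_one, hc.eq, h5, H.phi_k,
    smul_mul_assoc, smul_smul, mul_right_comm, inv_mul_cancel₀ G.params.eta_ne_zero, one_mul]
  congr 1
  rw [con, pow, smul_mul_assoc, mul_smul_comm]
  congr 1
  exact (H.comm 2 (m + 1) (by omega) _ (H.k_mem 2 0) _ (dsc_mem (H.s_mem _) _ _)).eq

end BMWTrace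

end BMWQuantum

/-! ### Recursions for hooks and contracted hooks. -/

namespace BMWQuantum

/-- The coefficient of `κ` in the recursion for the antisymmetrizers, written with `σ⁻¹`. -/
noncomputable def kapCoeffInv (q μ : ℂ) (i : ℕ) : ℂ :=
  (q ^ (i + 1) - (q ^ (i + 1))⁻¹) * (q / (μ * (q ^ (i + 1)) ^ 2 + q))

/-- The form with σ⁻¹ suits multiplication by κ_{j+1}, because σ_j⁻¹κ_{j+1} = σ_{j+1}κ_jκ_{j+1}
leads back to contracted hooks. -/
theorem BMWGens.bax_eq {q μ : ℂ} {B : Type*} [Ring B] [Algebra ℂ B] {N : ℕ} {s t k : ℕ → B}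
    (H : BMWGens q μ N s t k) (i : ℕ) (hi : i < N) (h : μ * (q ^ (i + 1)) ^ 2 + q ≠ 0) :
    q ^ (i + 1) • 1 - qNum q (i + 1) • s i - kapCoeff q μ i • k i =
      (q ^ (i + 1))⁻¹ • 1 - qNum q (i + 1) • t i + kapCoeffInv q μ i • k i := by
  have h1 := qNum_mul (i := i + 1) H.params.sub_inv_ne_zero
  have h2 : kapCoeff q μ i + kapCoeffInv q μ i = q ^ (i + 1) - (q ^ (i + 1))⁻¹ := by
    rw [kapCoeff, kapCoeffInv, ← mul_add, ← add_div, div_self h, mul_one]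
  rw [H.t_eq i hi, ← sub_eq_zero]
  have h3 : q ^ (i + 1) = (q ^ (i + 1))⁻¹ + (q - q⁻¹) * qNum q (i + 1) := by rw [h1]; ring
  have h4 : kapCoeffInv q μ i = (q - q⁻¹) * qNum q (i + 1) - kapCoeff q μ i := by
    rw [h1, ← h2]; ring
  rw [h4]
  nth_rewrite 1 [h3]
  module

namespace BMWTrace

variable {q μ : ℂ} {A : Type*} [Ring A] [Algebra ℂ A] {B : ℕ → Type*}
    [∀ n, Ring (B n)] [∀ n, Algebra ℂ (B n)] {s t k : ∀ n, ℕ → B n}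
    {S : ∀ n, Subalgebra ℂ (B n)} {φ : ∀ n, B n →ₗ[ℂ] A}
    (H : BMWTrace q μ s t k S φ)

variable (q μ s k φ) in
/-- The trace of the antisymmetrizer on `j + 1` strands continued by a chain of generators. -/
noncomputable def hook (n j m : ℕ) : A :=
  φ n (asym q μ (s n) (k n) (j + 1) * dsc (s n) j m)

variable (q μ s k φ) in
/-- The trace of the antisymmetrizer on `j + 1` strands continued by a chain of generators whose
last element is replaced by `κ`. -/
noncomputable def kook (n j m : ℕ) : A :=
  φ n (asym q μ (s n) (k n) (j + 1) * dsc (s n) (j + 1) m * k n j)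

include H

theorem phi_sandwich {n : ℕ} {a : B n} (ha : a ∈ S n) (haa : a * a = a) (x : B n) {d : B n}
    (hd : Commute a d) : φ n (a * x * a * d) = φ n (a * x * d) := by
  rw [mul_assoc _ a d, hd.eq, ← mul_assoc, ← H.tr n a ha, ← mul_assoc, ← mul_assoc, haa]

theorem phi_asym_succ {n d j : ℕ} (hA : AntisymDefined q μ d) (hj : j + 2 ≤ d) (hn : j + 2 ≤ n)
    {x : B n} (hx : Commute (asym q μ (s n) (k n) (j + 1)) x) :
    qNum q (j + 2) • φ n (asym q μ (s n) (k n) (j + 2) * x) =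
      φ n (asym q μ (s n) (k n) (j + 1) *
        (q ^ (j + 1) • 1 - qNum q (j + 1) • s n j - kapCoeff q μ j • k n j) * x) := by
  rw [← map_smul, ← smul_mul_assoc, qNum_smul_asym (H.gens n).params hA j hj]
  exact H.phi_sandwich (H.asym_mem n _)
    ((H.gens n).asym_properties hA (j + 1) (by omega) (by omega)).1 _ hx

theorem asym_commute_dsc {n i j m : ℕ} (hij : i ≤ j) (hn : j + m + 1 ≤ n) :
    Commute (asym q μ (s n) (k n) i) (dsc (s n) j m) :=
  commute_dsc _ _ fun l h1 h2 => (H.gens n).asym_commute_s i l (by omega) (by omega)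

/-- Of the three terms of the baxterized element, 1 disconnects the chain from the antisymmetrizer,
σ_j lengthens the chain by one, and κ_j gives a contracted hook. -/
theorem hook_succ {n d j m : ℕ} (hA : AntisymDefined q μ d) (hj : j + 2 ≤ d)
    (hn : j + 2 + m = n) :
    qNum q (j + 2) • hook q μ s k φ n (j + 1) m =
      q ^ (j + 1) • (elem q μ s k φ (j + 1) * pow s φ (m + 1)) -
        qNum q (j + 1) • hook q μ s k φ n j (m + 1) - kapCoeff q μ j • kook q μ s k φ n j m := by
  have hc := H.asym_commute_dsc (n := n) (j + 1).le_refl (m := m) (by omega)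
  rw [hook, H.phi_asym_succ hA hj (by omega) hc, ← H.tr n _ (dsc_mem (H.s_mem n) _ _),
    ← mul_assoc, ← hc.eq, mul_sub, mul_sub, mul_smul_comm, mul_smul_comm, mul_smul_comm, mul_one,
    map_sub, map_sub, map_smul, map_smul, map_smul, H.phi_asym_mul_dsc j m n hn, hook, kook,
    dsc_succ_right, mul_assoc _ _ (s n j)]

/-- The κ slides to the far end of the chain and absorbs the two factors there, since
κ_{l+1}σ_{l+1}σ_lκ_{l+1} = κ_{l+1}; it is then a contraction of the last two strands and splits off.
-/
theorem phi_mul_k (n j m : ℕ) (hn : j + 1 + m = n) :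
    φ (n + 2) (asym q μ (s (n + 2)) (k (n + 2)) (j + 1) * dsc (s (n + 2)) j (m + 2) *
      k (n + 2) (j + 1)) = hook q μ s k φ n j m * con q μ k φ := by
  have G := H.gens (n + 2)
  have h1 := H.phi_slide (n + 2) j (m + 2) (j + 1) (j + m + 1)
    (asym q μ (s (n + 2)) (k (n + 2)) (j + 1)) 1 (by omega) (by omega) (by omega) (by omega)
    (fun l h1 h2 => G.asym_commute_k (j + 1) l (by omega) (by omega))
    (fun _ _ _ => Commute.one_left _)
  rw [mul_one] at h1
  have h2 : k (n + 2) (j + m + 1) * (s (n + 2) (j + (m + 1)) * s (n + 2) (j + m)) *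
      k (n + 2) (j + m + 1) = (1 : ℂ) • k (n + 2) (j + m + 1) := by
    rw [one_smul, ← mul_assoc, ← add_assoc, G.ks _ (by omega), smul_mul_assoc, smul_mul_assoc,
      G.ksk' _ (by omega), smul_smul, mul_inv_cancel₀ G.params.μ_ne_zero, one_smul]
  have h3 := H.phi_k_conj (n + 2) (j + m + 1) (by omega)
    (asym q μ (s (n + 2)) (k (n + 2)) (j + 1)) _ (dsc (s (n + 2)) j m) 1 h2
    (G.asym_commute_k (j + 1) _ (by omega) (by omega))
    (G.k_commute_dsc j m _ (by omega) (by omega) (by omega)).symm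
  have h4 := H.phi_mul_k_last n
    (fun n => asym q μ (s n) (k n) (j + 1) * dsc (s n) j m)
    (mul_mem (H.asym_mem _ _) (dsc_mem (H.s_mem _) _ _)) fun f hf => by
      rw [map_mul, map_asym f (s (n + 2)) (k (n + 2)) _ (fun i hi => (hf i (by omega)).1)
        (fun i hi => (hf i (by omega)).2),
        map_dsc f (s' := s (n + 2)) j j m (fun i hi => (hf _ (by omega)).1)]
  rw [h1, dsc, dsc, ← mul_assoc (s _ _) (s _ _), ← mul_assoc (asym _ _ _ _ _), h3]
  obtain rfl : n = j + m + 1 := by omega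
  rw [h4, mul_one, smul_smul, inv_mul_cancel₀ G.params.eta_ne_zero, one_smul, hook]

/-- As in `phi_mul_k`: the extra κ_j is at least two indices below the end of the chain, so it does
not affect the slide. -/
theorem phi_mul_k_mul_k (n j m : ℕ) (hn : j + 2 + m = n) :
    φ (n + 2) (asym q μ (s (n + 2)) (k (n + 2)) (j + 1) * dsc (s (n + 2)) (j + 1) (m + 2) *
      k (n + 2) j * k (n + 2) (j + 1)) = kook q μ s k φ n j m * con q μ k φ := by
  have G := H.gens (n + 2)
  have h1 := H.phi_slide (n + 2) (j + 1) (m + 2) (j + 1) (j + m + 2)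
    (asym q μ (s (n + 2)) (k (n + 2)) (j + 1)) (k (n + 2) j) (by omega) (by omega) (by omega)
    (by omega) (fun l h1 h2 => G.asym_commute_k (j + 1) l (by omega) (by omega))
    (fun l h1 h2 => G.comm_k _ _ (by omega) (by omega))
  have h2 : k (n + 2) (j + m + 2) * (s (n + 2) (j + 1 + (m + 1)) * s (n + 2) (j + 1 + m)) *
      k (n + 2) (j + m + 2) = (1 : ℂ) • k (n + 2) (j + m + 2) := by
    have e : j + 1 + m = j + m + 1 := by omega
    rw [one_smul, ← mul_assoc, ← add_assoc, e, G.ks _ (by omega), smul_mul_assoc, smul_mul_assoc,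
      G.ksk' _ (by omega), smul_smul, mul_inv_cancel₀ G.params.μ_ne_zero, one_smul]
  have h3 := H.phi_k_conj (n + 2) (j + m + 2) (by omega)
    (asym q μ (s (n + 2)) (k (n + 2)) (j + 1)) _ (dsc (s (n + 2)) (j + 1) m * k (n + 2) j) 1 h2
    (G.asym_commute_k (j + 1) _ (by omega) (by omega))
    ((G.k_commute_dsc (j + 1) m _ (by omega) (by omega) (by omega)).symm.mul_left
      (G.comm_k _ _ (by omega) (by omega)))
  have h4 := H.phi_mul_k_last n
    (fun n => asym q μ (s n) (k n) (j + 1) * (dsc (s n) (j + 1) m * k n j))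
    (mul_mem (H.asym_mem _ _) (mul_mem (dsc_mem (H.s_mem _) _ _) (H.k_mem _ _))) fun f hf => by
      rw [map_mul, map_mul, map_asym f (s (n + 2)) (k (n + 2)) _ (fun i hi => (hf i (by omega)).1)
        (fun i hi => (hf i (by omega)).2), (hf j (by omega)).2,
        map_dsc f (s' := s (n + 2)) (j + 1) (j + 1) m (fun i hi => (hf _ (by omega)).1)]
  rw [h1, dsc, dsc, ← mul_assoc (s _ _) (s _ _), ← mul_assoc (asym _ _ _ _ _),
    mul_assoc _ (dsc _ _ _), h3]
  obtain rfl : n = j + m + 2 := by omega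
  rw [h4, mul_one, smul_smul, inv_mul_cancel₀ G.params.eta_ne_zero, one_smul, kook, mul_assoc]

theorem phi_mul_t_mul_k (n j m : ℕ) (hn : j + 2 + m = n) :
    φ (n + 2) (asym q μ (s (n + 2)) (k (n + 2)) (j + 1) * t (n + 2) j *
      (dsc (s (n + 2)) (j + 2) (m + 1) * k (n + 2) (j + 1))) =
        kook q μ s k φ n j m * con q μ k φ := by
  have G := H.gens (n + 2)
  rw [← H.phi_mul_k_mul_k n j m hn, dsc_succ_right _ (j + 1) (m + 1)]
  have hc : Commute (t (n + 2) j) (dsc (s (n + 2)) (j + 2) (m + 1)) :=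
    commute_dsc _ _ fun l h1 h2 =>
      (G.commute_t j (by omega) (G.comm j l (by omega) (by omega)).symm).symm
  rw [mul_assoc _ (t (n + 2) j), ← mul_assoc (t (n + 2) j), hc.eq, mul_assoc _ (t (n + 2) j),
    G.t_mul_k_succ j (by omega)]
  simp only [mul_assoc]

theorem phi_mul_k_mul (n j m : ℕ) (hn : j + 1 + m = n) :
    φ (n + 2) (asym q μ (s (n + 2)) (k (n + 2)) (j + 1) * k (n + 2) j *
      (dsc (s (n + 2)) (j + 2) m * k (n + 2) (j + 1))) =
        hook q μ s k φ n j m * con q μ k φ := by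
  have G := H.gens (n + 2)
  rw [← H.phi_mul_k n j m hn, dsc_succ_right _ j (m + 1), dsc_succ_right _ (j + 1) m]
  have hc : Commute (k (n + 2) j) (dsc (s (n + 2)) (j + 2) m) :=
    G.k_commute_dsc _ _ _ (by omega) (by omega) (by omega)
  rw [mul_assoc _ (k (n + 2) j), ← mul_assoc (k (n + 2) j), hc.eq, mul_assoc _ (k (n + 2) j),
    G.k_mul_k_succ j (by omega)]
  simp only [mul_assoc]

/-- This is the end of the recursion, with no chain left to slide along: κ_{j+1}σ_j⁻¹κ_{j+1} =
μκ_{j+1} contributes the factor μ. -/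
theorem phi_mul_t (j : ℕ) :
    φ (j + 3) (asym q μ (s (j + 3)) (k (j + 3)) (j + 1) * t (j + 3) j * k (j + 3) (j + 1)) =
        μ • (elem q μ s k φ (j + 1) * con q μ k φ) := by
  have G := H.gens (j + 3)
  have h3 := H.phi_k_conj (j + 3) (j + 1) (by omega)
    (asym q μ (s (j + 3)) (k (j + 3)) (j + 1)) (t (j + 3) j) 1 μ (G.ktk' j (by omega))
    (G.asym_commute_k (j + 1) _ (by omega) (by omega)) (Commute.one_left _)
  have h4 := H.phi_mul_k_last (j + 1) (fun n => asym q μ (s n) (k n) (j + 1))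
    (H.asym_mem _ _) fun f hf =>
      map_asym f (s (j + 3)) (k (j + 3)) _ (fun i hi => (hf i (by omega)).1)
        (fun i hi => (hf i (by omega)).2)
  rw [mul_one, mul_one, h4, smul_smul, mul_right_comm, inv_mul_cancel₀ G.params.eta_ne_zero,
    one_mul] at h3
  exact h3

theorem phi_asym_mul_dsc_mul_k (n j m : ℕ) (hn : j + 1 + (m + 2) = n) :
    φ n (asym q μ (s n) (k n) (j + 1) * (dsc (s n) (j + 2) m * k n (j + 1))) =
      elem q μ s k φ (j + 1) * φ (m + 2) (dsc (s (m + 2)) 1 m * k (m + 2) 0) := by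
  refine H.phi_elem_mul (j + 1) (m + 2) n hn (fun n i => dsc (s n) (i + 1) m * k n i)
    (mul_mem (dsc_mem (H.s_mem _) _ _) (H.k_mem _ _)) fun f hf => ?_
  rw [map_mul, (hf 0 (by omega)).2, map_dsc f (s' := s n) _ (j + 2) _ fun i hi => ?_]
  rw [(hf _ (by omega)).1]
  congr 1
  omega

theorem phi_asym_mul_bax {n j : ℕ} (hn : j + 2 ≤ n) (h : μ * (q ^ (j + 1)) ^ 2 + q ≠ 0)
    (x : B n) :
    φ n (asym q μ (s n) (k n) (j + 1) *
        (q ^ (j + 1) • 1 - qNum q (j + 1) • s n j - kapCoeff q μ j • k n j) * x) =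
      (q ^ (j + 1))⁻¹ • φ n (asym q μ (s n) (k n) (j + 1) * x) -
        qNum q (j + 1) • φ n (asym q μ (s n) (k n) (j + 1) * t n j * x) +
        kapCoeffInv q μ j • φ n (asym q μ (s n) (k n) (j + 1) * k n j * x) := by
  rw [(H.gens n).bax_eq j (by omega) h]
  simp only [mul_add, mul_sub, add_mul, sub_mul, mul_smul_comm, smul_mul_assoc, mul_one, map_add,
    map_sub, map_smul]

/-- The same expansion as for hooks, with the baxterized element written through σ⁻¹: 1 disconnects
the chain, σ_j⁻¹ shortens a contracted hook by two strands, and κ_j restores an ordinary hook. -/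
theorem kook_succ_succ {n d j m : ℕ} (hA : AntisymDefined q μ d) (hj : j + 2 ≤ d)
    (hn : j + 2 + m = n) :
    qNum q (j + 2) • kook q μ s k φ (n + 2) (j + 1) (m + 1) =
      ((q ^ (j + 1))⁻¹ • μ⁻¹ • (elem q μ s k φ (j + 1) * pow s φ (m + 1)) -
        qNum q (j + 1) • kook q μ s k φ n j m +
        kapCoeffInv q μ j • hook q μ s k φ n j (m + 1)) * con q μ k φ := by
  have G := H.gens (n + 2)
  have hc : Commute (asym q μ (s (n + 2)) (k (n + 2)) (j + 1))
      (dsc (s (n + 2)) (j + 2) (m + 1) * k (n + 2) (j + 1)) :=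
    (H.asym_commute_dsc (by omega) (by omega)).mul_right
      (G.asym_commute_k _ _ (by omega) (by omega))
  rw [kook, mul_assoc, H.phi_asym_succ hA hj (by omega) hc,
    H.phi_asym_mul_bax (by omega) (hA.ne_zero G.params.q_ne_zero j hj),
    H.phi_mul_t_mul_k n j m hn, H.phi_mul_k_mul n j (m + 1) (by omega),
    H.phi_asym_mul_dsc_mul_k _ j (m + 1) (by omega), H.phi_dsc_mul_k]
  simp only [add_mul, sub_mul, smul_mul_assoc, mul_smul_comm, mul_assoc]

theorem kook_succ_zero {d j : ℕ} (hA : AntisymDefined q μ d) (hj : j + 2 ≤ d) :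
    qNum q (j + 2) • kook q μ s k φ (j + 3) (j + 1) 0 =
      ((q ^ (j + 1))⁻¹ * eta q μ - qNum q (j + 1) * μ + kapCoeffInv q μ j) •
        (elem q μ s k φ (j + 1) * con q μ k φ) := by
  have G := H.gens (j + 3)
  have hc := G.asym_commute_k (j + 1) (j + 1) (by omega) (by omega)
  have h1 := H.phi_mul_k_mul (j + 1) j 0 rfl
  rw [dsc, one_mul, hook, dsc, mul_one] at h1
  have h2 := H.phi_asym_mul_dsc_mul_k (j + 3) j 0 (by omega)
  rw [dsc, one_mul, dsc, one_mul, H.phi_k, mul_smul_comm] at h2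
  rw [kook, dsc, mul_one, H.phi_asym_succ hA hj (by omega) hc,
    H.phi_asym_mul_bax (by omega) (hA.ne_zero G.params.q_ne_zero j hj), H.phi_mul_t, h1, h2]
  rw [← elem]
  module

omit H in
theorem hook_zero (j : ℕ) : hook q μ s k φ (j + 1) j 0 = elem q μ s k φ (j + 1) := by
  rw [hook, dsc, mul_one, elem]

omit H in
theorem hook_zero_left (m : ℕ) : hook q μ s k φ (m + 1) 0 m = pow s φ (m + 1) := by
  rw [hook, asym, one_mul, pow, Nat.add_sub_cancel]

theorem kook_zero_zero : kook q μ s k φ 2 0 0 = eta q μ • con q μ k φ := by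
  rw [kook, asym, dsc, one_mul, one_mul, H.phi_k]

theorem kook_zero_succ (m : ℕ) :
    kook q μ s k φ (m + 3) 0 (m + 1) = μ⁻¹ • (pow s φ (m + 1) * con q μ k φ) := by
  rw [kook, asym, one_mul, H.phi_dsc_mul_k]

end BMWTrace

end BMWQuantum

/-! ### The Newton sum by telescoping. -/

namespace BMWQuantum

section Coefficients

variable (q μ : ℂ)

/-- The coefficient of the contracted hooks in the recursion for the hooks. -/
noncomputable def coefD (i : ℕ) : ℂ := (q - q⁻¹) * (μ * (q ^ i) ^ 2 / (μ * (q ^ i) ^ 2 + q))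

/-- The coefficient of the hooks in the recursion for the contracted hooks. -/
noncomputable def coefE (i : ℕ) : ℂ := (q - q⁻¹) * (q / (μ * (q ^ i) ^ 2 + q))

/-- The coefficient of the telescoping sum in the proof of the Newton relations. -/
noncomputable def coefF (i : ℕ) : ℂ := (q - q⁻¹) * (q ^ 2 / (μ * (q ^ i) ^ 2 + q))

variable {q μ}

theorem kapCoeff_eq (h : q - q⁻¹ ≠ 0) (i : ℕ) :
    kapCoeff q μ i = coefD q μ (i + 1) * qNum q (i + 1) := by
  rw [coefD, mul_right_comm, qNum_mul h, kapCoeff]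

theorem kapCoeffInv_eq (h : q - q⁻¹ ≠ 0) (i : ℕ) :
    kapCoeffInv q μ i = coefE q μ (i + 1) * qNum q (i + 1) := by
  rw [coefE, mul_right_comm, qNum_mul h, kapCoeffInv]

/-- This identity and the next three make the second telescoping work: in the recursion for
`newtonSum` they match the coefficients of the two neighbouring hooks, of the contracted hook, and
of the boundary term. -/
theorem coefD_succ_mul (hq : q ≠ 0) (hμ : μ ≠ 0) (i : ℕ) :
    coefD q μ (i + 1) * ((q ^ i)⁻¹ * μ⁻¹ * (q ^ i)⁻¹) = coefF q μ (i + 1) := by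
  have hp := pow_ne_zero i hq
  rw [coefD, coefF, pow_succ q i]
  generalize μ * (q ^ i * q) ^ 2 + q = D
  generalize q - q⁻¹ = L
  field_simp

theorem coefF_succ_add (hq : q ≠ 0) {i : ℕ} (h : μ * (q ^ i) ^ 2 + q ≠ 0)
    (h' : μ * (q ^ (i + 1)) ^ 2 + q ≠ 0) :
    coefF q μ (i + 1) + coefD q μ (i + 1) * coefE q μ i = coefF q μ i := by
  rw [pow_succ q i] at h'
  rw [coefD, coefF, coefE, coefF, pow_succ q i]
  obtain ⟨D, hD⟩ : ∃ D, D = μ * (q ^ i) ^ 2 + q := ⟨_, rfl⟩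
  obtain ⟨E, hE⟩ : ∃ E, E = μ * (q ^ i * q) ^ 2 + q := ⟨_, rfl⟩
  rw [← hD] at h
  rw [← hE] at h'
  rw [← hD, ← hE]
  generalize q ^ i = p at *
  field_simp
  rw [hD, hE]
  ring

theorem coefF_succ_mul (hq : q ≠ 0) {i : ℕ} (h : μ * (q ^ i) ^ 2 + q ≠ 0)
    (h' : μ * (q ^ (i + 1)) ^ 2 + q ≠ 0) :
    coefF q μ (i + 1) * coefD q μ i - coefD q μ (i + 1) = -coefD q μ i := by
  rw [pow_succ q i] at h'
  rw [coefD, coefF, coefD, pow_succ q i]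
  obtain ⟨D, hD⟩ : ∃ D, D = μ * (q ^ i) ^ 2 + q := ⟨_, rfl⟩
  obtain ⟨E, hE⟩ : ∃ E, E = μ * (q ^ i * q) ^ 2 + q := ⟨_, rfl⟩
  rw [← hD] at h
  rw [← hE] at h'
  rw [← hD, ← hE]
  generalize q ^ i = p at *
  field_simp
  rw [hD, hE]
  ring

theorem coef_top (hp : BMWParams q μ) {i : ℕ} (h' : μ * (q ^ (i + 1)) ^ 2 + q ≠ 0) :
    coefF q μ (i + 1) * qNum q i - coefD q μ (i + 1) * ((q ^ i)⁻¹ * eta q μ - qNum q i * μ) =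
      μ * q ^ i - q * (q ^ i)⁻¹ := by
  have hq := hp.q_ne_zero
  have hμ := hp.μ_ne_zero
  have h1 := qNum_mul (i := i) hp.sub_inv_ne_zero
  have h2 := hp.eta_eq
  have hpi := pow_ne_zero i hq
  rw [pow_succ q i] at h'
  rw [coefD, coefF, pow_succ q i]
  generalize qNum q i = u at *
  generalize eta q μ = η at *
  obtain ⟨E, hE⟩ : ∃ E, E = μ * (q ^ i * q) ^ 2 + q := ⟨_, rfl⟩
  rw [← hE] at h' ⊢
  generalize q ^ i = p at *
  have e : (q - q⁻¹) * (q ^ 2 / E) * u - (q - q⁻¹) * (μ * (p * q) ^ 2 / E) *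
      (p⁻¹ * η - u * μ) = (q ^ 2 * ((q - q⁻¹) * u) - μ * (p * q) ^ 2 *
      (p⁻¹ * ((q - q⁻¹) * η) - (q - q⁻¹) * u * μ)) / E := by ring
  rw [e, h1, h2, div_eq_iff h', hE]
  field_simp
  ring

end Coefficients

namespace BMWTrace

variable {q μ : ℂ} {A : Type*} [Ring A] [Algebra ℂ A] {B : ℕ → Type*}
    [∀ n, Ring (B n)] [∀ n, Algebra ℂ (B n)] {s t k : ∀ n, ℕ → B n}
    {S : ∀ n, Subalgebra ℂ (B n)} {φ : ∀ n, B n →ₗ[ℂ] A}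
    (H : BMWTrace q μ s t k S φ)

variable (q μ s k φ) in
/-- The normalized hook with a column of length `i` and a row of length `m + 1`. -/
noncomputable def nhook : ℕ → ℕ → A
  | 0, _ => 0
  | i + 1, m => qNum q (i + 1) • hook q μ s k φ (i + 1 + m) i m

variable (q μ s k φ) in
/-- The normalized contracted hook. -/
noncomputable def nkook : ℕ → ℕ → A
  | 0, _ => 0
  | i + 1, m => qNum q (i + 1) • kook q μ s k φ (i + 2 + m) i m

variable (q μ s k φ) in
/-- The right hand side of the Newton relation on `m` strands, up to its first term. -/
noncomputable def newtonSum (m : ℕ) : A :=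
  ∑ i ∈ Finset.range m, ((-1) ^ i * coefD q μ i) • nkook q μ s k φ i (m - 1 - i)

theorem qNum_one (h : q - q⁻¹ ≠ 0) : qNum q 1 = 1 := by
  rw [qNum, pow_one, div_self h]

theorem qNum_zero : qNum q 0 = 0 := by simp [qNum]

include H

theorem elem_zero : elem q μ s k φ 0 = 1 := by rw [elem, asym, H.zero]

/-- Normalized hooks with an empty column are zero, so the recursion is uniform in `i`. At `i = 0`
the coefficient `coefD q μ 0`, whose denominator μ + q may vanish, only multiplies zero. -/
theorem nhook_succ {d i m : ℕ} (hA : AntisymDefined q μ d) (hi : i + 1 ≤ d) :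
    nhook q μ s k φ (i + 1) m =
      q ^ i • (elem q μ s k φ i * pow s φ (m + 1)) - nhook q μ s k φ i (m + 1) -
        coefD q μ i • nkook q μ s k φ i m := by
  have h1 := (H.gens 0).params.sub_inv_ne_zero
  cases i with
  | zero =>
    rw [nhook, nhook, nkook, qNum_one h1, one_smul, smul_zero, sub_zero, sub_zero, pow_zero,
      one_smul, H.elem_zero, one_mul, ← hook_zero_left, zero_add, add_comm m 1]
  | succ i =>
    rw [nhook, H.hook_succ hA hi rfl, nhook, nkook, smul_smul, kapCoeff_eq h1,
      show i + 1 + (m + 1) = i + 1 + 1 + m by omega]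

theorem nkook_succ_succ {d i m : ℕ} (hA : AntisymDefined q μ d) (hi : i + 1 ≤ d) :
    nkook q μ s k φ (i + 1) (m + 1) =
      ((q ^ i)⁻¹ • μ⁻¹ • (elem q μ s k φ i * pow s φ (m + 1)) - nkook q μ s k φ i m +
        coefE q μ i • nhook q μ s k φ i (m + 1)) * con q μ k φ := by
  have h1 := (H.gens 0).params.sub_inv_ne_zero
  cases i with
  | zero =>
    rw [nhook, nkook, nkook, qNum_one h1, one_smul, smul_zero, sub_zero, add_zero, pow_zero,
      inv_one, one_smul, H.elem_zero, one_mul, smul_mul_assoc, ← H.kook_zero_succ,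
      show 0 + 2 + (m + 1) = m + 3 by omega]
  | succ i =>
    rw [nkook, show i + 1 + 2 + (m + 1) = i + 2 + m + 2 by omega, H.kook_succ_succ hA hi rfl,
      nhook, nkook, smul_smul (coefE _ _ _), kapCoeffInv_eq h1,
      show i + 1 + (m + 1) = i + 2 + m by omega]

theorem nkook_succ_zero {d i : ℕ} (hA : AntisymDefined q μ d) (hi : i + 1 ≤ d) :
    nkook q μ s k φ (i + 1) 0 =
      ((q ^ i)⁻¹ * eta q μ - qNum q i * μ + coefE q μ i * qNum q i) •
        (elem q μ s k φ i * con q μ k φ) := by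
  have h1 := (H.gens 0).params.sub_inv_ne_zero
  cases i with
  | zero =>
    rw [nkook, qNum_one h1, one_smul, H.kook_zero_zero, H.elem_zero, one_mul, qNum_zero]
    simp
  | succ i =>
    rw [nkook, H.kook_succ_zero hA hi, kapCoeffInv_eq h1]

omit H in
theorem nhook_zero (i : ℕ) : nhook q μ s k φ i 0 = qNum q i • elem q μ s k φ i := by
  cases i with
  | zero => rw [nhook, qNum_zero, zero_smul]
  | succ i => rw [nhook, add_zero, hook_zero]

/-- With alternating signs the two hooks in `nhook_succ` are consecutive terms of one sequence. Its
first term vanishes, its last is m_q a_m, and the contracted hooks make up `newtonSum`. -/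
theorem newton_aux {d m : ℕ} (hA : AntisymDefined q μ d) (hm : m ≤ d) :
    ∑ i ∈ Finset.range m, (-q) ^ i • (elem q μ s k φ i * pow s φ (m - i)) =
      -((-1) ^ m * qNum q m) • elem q μ s k φ m + newtonSum q μ s k φ m := by
  have h : ∀ i ∈ Finset.range m, (-q) ^ i • (elem q μ s k φ i * pow s φ (m - i)) =
      ((-1 : ℂ) ^ i • nhook q μ s k φ i (m - i) -
        (-1 : ℂ) ^ (i + 1) • nhook q μ s k φ (i + 1) (m - (i + 1))) +
      ((-1) ^ i * coefD q μ i) • nkook q μ s k φ i (m - 1 - i) := by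
    intro i hi
    obtain ⟨r, rfl⟩ : ∃ r, m = i + r + 1 :=
      ⟨m - i - 1, by have := Finset.mem_range.mp hi; omega⟩
    rw [show i + r + 1 - i = r + 1 by omega, show i + r + 1 - (i + 1) = r by omega,
      show i + r + 1 - 1 - i = r by omega, H.nhook_succ hA (by omega), neg_pow, pow_succ]
    module
  rw [Finset.sum_congr rfl h, Finset.sum_add_distrib,
    Finset.sum_range_sub' (fun i => (-1 : ℂ) ^ i • nhook q μ s k φ i (m - i)), nhook, newtonSum,
    Nat.sub_self, nhook_zero]
  module

/-- Each contracted hook is expanded by its own recursion, and the products a_i p are replaced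
through the hook recursion. The hooks telescope with weights `coefF`, and the contracted hooks
reassemble into `newtonSum` on two strands fewer. -/
theorem newtonSum_add_two {d m : ℕ} (hA : AntisymDefined q μ d) (hm : m + 2 ≤ d) :
    newtonSum q μ s k φ (m + 2) = (newtonSum q μ s k φ m +
      ((-1) ^ m * (μ * q ^ m - q * (q ^ m)⁻¹)) • elem q μ s k φ m) * con q μ k φ := by
  have hq := (H.gens 0).params.q_ne_zero
  have hμ := (H.gens 0).params.μ_ne_zero
  have hD : ∀ i, i < m + 1 → μ * (q ^ (i + 1)) ^ 2 + q ≠ 0 := fun i hi =>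
    hA.ne_zero hq i (by omega)
  have h : ∀ i ∈ Finset.range m,
      ((-1) ^ (i + 1) * coefD q μ (i + 1)) • nkook q μ s k φ (i + 1) (m + 2 - 1 - (i + 1)) =
      (((-1) ^ i * coefD q μ i) • nkook q μ s k φ i (m - 1 - i) +
      (((-1 : ℂ) ^ (i + 1) * coefF q μ (i + 1)) • nhook q μ s k φ (i + 1) (m - (i + 1)) -
        ((-1 : ℂ) ^ i * coefF q μ i) • nhook q μ s k φ i (m - i))) * con q μ k φ := by
    intro i hi
    obtain ⟨r, rfl⟩ : ∃ r, m = i + r + 1 :=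
      ⟨m - i - 1, by have := Finset.mem_range.mp hi; omega⟩
    rw [show i + r + 1 + 2 - 1 - (i + 1) = r + 1 by omega, show i + r + 1 - i = r + 1 by omega,
      show i + r + 1 - (i + 1) = r by omega, show i + r + 1 - 1 - i = r by omega,
      H.nkook_succ_succ hA (by omega), ← smul_mul_assoc]
    congr 1
    have h1 := H.nhook_succ (i := i) (m := r) hA (by omega)
    have h2 : elem q μ s k φ i * pow s φ (r + 1) = (q ^ i)⁻¹ • (nhook q μ s k φ (i + 1) r +
        nhook q μ s k φ i (r + 1) + coefD q μ i • nkook q μ s k φ i r) := by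
      rw [h1, sub_right_comm, sub_add_cancel, sub_add_cancel, smul_smul,
        inv_mul_cancel₀ (pow_ne_zero i hq), one_smul]
    have c1 := coefD_succ_mul hq hμ i
    rw [h2]
    -- For `i = 0` the empty hooks vanish and `c1` suffices; the identities `c2` and `c3` would
    -- divide by μ + q, which is not known to be nonzero.
    cases i with
    | zero =>
      simp only [nhook, nkook, smul_zero, add_zero, sub_zero, zero_add] at c1 ⊢
      rw [← c1]
      module
    | succ i =>
      have c2 := coefF_succ_add hq (hD i (by omega)) (hD (i + 1) (by omega))
      have c3 := coefF_succ_mul hq (hD i (by omega)) (hD (i + 1) (by omega))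
      match_scalars
      · linear_combination (-1) ^ (i + 1 + 1) * c1
      · linear_combination (-1) ^ (i + 1 + 1) * c1 - (-1) ^ (i + 1) * c2
      · linear_combination (-1) ^ (i + 1 + 1) * coefD q μ (i + 1) * c1 - (-1) ^ (i + 1) * c3
  have hnk : nkook q μ s k φ 0 (m + 2 - 1 - 0) = 0 := rfl
  have hnh : nhook q μ s k φ 0 (m - 0) = 0 := rfl
  rw [newtonSum, Finset.sum_range_succ', hnk, smul_zero, add_zero, Finset.sum_range_succ,
    Finset.sum_congr rfl h, ← Finset.sum_mul, Finset.sum_add_distrib,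
    Finset.sum_range_sub (fun i => ((-1 : ℂ) ^ i * coefF q μ i) • nhook q μ s k φ i (m - i)),
    hnh, smul_zero, sub_zero, ← newtonSum, Nat.sub_self, nhook_zero,
    show m + 2 - 1 - (m + 1) = 0 by omega, H.nkook_succ_zero hA (by omega), smul_smul, smul_smul,
    ← smul_mul_assoc, ← add_mul, add_assoc, ← add_smul]
  congr 3
  -- The coefficient of a_m g collects the upper end of the telescoping sum and the chainless
  -- contracted hook.
  have c1 := coef_top (H.gens 0).params (hD m (by omega))
  cases m with
  | zero =>
    simp only [qNum_zero] at c1 ⊢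
    linear_combination c1
  | succ m =>
    have c2 := coefF_succ_add hq (hD m (by omega)) (hD (m + 1) (by omega))
    linear_combination (-1) ^ (m + 1) * c1 - (-1) ^ (m + 1) * qNum q (m + 1) * c2

end BMWTrace

end BMWQuantum

namespace BMWQuantum

/-! ### Sums over contractions. -/

section ContractSum

variable {A : Type*} [Ring A] [Algebra ℂ A]

/-- The sums `∑ i ≥ 1, c (m - 2 i) • (a (m - 2 i) * g ^ i)`, by recursion on `m`. -/
def contractSum (c : ℕ → ℂ) (a : ℕ → A) (g : A) : ℕ → A
  | 0 => 0
  | 1 => 0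
  | m + 2 => (contractSum c a g m + c m • a m) * g

theorem contractSum_eq (c : ℕ → ℂ) (a : ℕ → A) (g : A) (m : ℕ) :
    contractSum c a g m =
      ∑ i ∈ Finset.Icc 1 (m / 2), c (m - 2 * i) • (a (m - 2 * i) * g ^ i) := by
  induction m using Nat.strong_induction_on with
  | _ m ih =>
    match m, ih with
    | 0, _ => rfl
    | 1, _ => rfl
    | m + 2, ih =>
      have hI : Finset.Icc 1 (m / 2 + 1) =
          insert 1 ((Finset.Icc 1 (m / 2)).map ⟨(· + 1), add_left_injective 1⟩) := by
        ext x
        simp only [Finset.mem_insert, Finset.mem_map, Finset.mem_Icc, Function.Embedding.coeFn_mk]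
        constructor
        · rintro ⟨h1, h2⟩
          by_cases h : x = 1
          · exact .inl h
          · exact .inr ⟨x - 1, by omega, by omega⟩
        · rintro (rfl | ⟨y, h1, rfl⟩) <;> omega
      rw [contractSum, ih m (by omega), show (m + 2) / 2 = m / 2 + 1 by omega, hI,
        Finset.sum_insert (by simp), Finset.sum_map, add_mul, Finset.sum_mul, add_comm]
      congr 1
      · simp
      · refine Finset.sum_congr rfl fun i _ => ?_
        simp only [Function.Embedding.coeFn_mk]
        rw [show m + 2 - 2 * (i + 1) = m - 2 * i by omega, pow_succ, smul_mul_assoc, mul_assoc]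

theorem map_contractSum {A' : Type*} [Ring A'] [Algebra ℂ A'] (f : A →ₐ[ℂ] A') (c : ℕ → ℂ)
    (a : ℕ → A) (g : A) (m : ℕ) :
    f (contractSum c a g m) = contractSum c (fun i => f (a i)) (f g) m := by
  induction m using Nat.strong_induction_on with
  | _ m ih =>
    match m, ih with
    | 0, _ => exact map_zero f
    | 1, _ => exact map_zero f
    | m + 2, ih => rw [contractSum, contractSum, map_mul, map_add, map_smul, ih m (by omega)]

end ContractSum

/-! ### The duality q ↦ -q⁻¹. -/

section Dual

variable {q μ : ℂ}

theorem neg_inv_sub (q : ℂ) : -q⁻¹ - (-q⁻¹)⁻¹ = q - q⁻¹ := by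
  rw [inv_neg, inv_inv]; ring

theorem BMWParams.dual (h : BMWParams q μ) : BMWParams (-q⁻¹) μ where
  q_ne_zero := neg_ne_zero.mpr (inv_ne_zero h.q_ne_zero)
  q_ne_one h1 := h.q_ne_neg_one (by
    rw [neg_eq_iff_eq_neg] at h1
    rw [← inv_inv q, h1, inv_neg, inv_one])
  q_ne_neg_one h1 := h.q_ne_one (by rwa [neg_inj, inv_eq_one] at h1)
  μ_ne_zero := h.μ_ne_zero
  μ_ne_q := h.μ_ne_neg_inv
  μ_ne_neg_inv := by rw [inv_neg, inv_inv, neg_neg]; exact h.μ_ne_q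

theorem inv_neg_one_pow (i : ℕ) : ((-1 : ℂ) ^ i)⁻¹ = (-1) ^ i := by
  rw [← inv_pow, inv_neg, inv_one]

theorem qNum_dual (q : ℂ) (i : ℕ) : qNum (-q⁻¹) i = -(-1) ^ i * qNum q i := by
  rw [qNum, qNum, neg_inv_sub, neg_pow, inv_pow, mul_inv, inv_inv, inv_neg_one_pow]
  ring

theorem eta_dual (q μ : ℂ) : eta (-q⁻¹) μ = eta q μ := by
  rw [eta, eta, neg_inv_sub, inv_neg, inv_inv]
  ring

theorem SymDefined.dual {n : ℕ} (h : SymDefined q μ n) : AntisymDefined (-q⁻¹) μ n := by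
  intro j h2 hj
  obtain ⟨h3, h4⟩ := h j h2 hj
  refine ⟨?_, ?_⟩
  · rw [qNum_dual]
    exact mul_ne_zero (neg_ne_zero.mpr (pow_ne_zero _ (by norm_num))) h3
  · have ho : Odd (-2 * (j : ℤ) + 3) := ⟨-j + 1, by ring⟩
    rw [ho.neg_zpow, neg_neg, inv_zpow, ← zpow_neg, show -(-2 * (j : ℤ) + 3) = 2 * j - 3 by ring]
    exact h4

/-- Apart from the parameter conditions, `q` enters the relations only through q - q⁻¹, which the
duality preserves. -/
theorem BMWGens.dual {B : Type*} [Ring B] [Algebra ℂ B] {N : ℕ} {s t k : ℕ → B}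
    (H : BMWGens q μ N s t k) : BMWGens (-q⁻¹) μ N s t k :=
  { H with
    params := H.params.dual
    t_eq := by rw [neg_inv_sub]; exact H.t_eq }

end Dual

namespace BMWTrace

variable {q μ : ℂ} {A : Type*} [Ring A] [Algebra ℂ A] {B : ℕ → Type*}
    [∀ n, Ring (B n)] [∀ n, Algebra ℂ (B n)] {s t k : ∀ n, ℕ → B n}
    {S : ∀ n, Subalgebra ℂ (B n)} {φ : ∀ n, B n →ₗ[ℂ] A}
    (H : BMWTrace q μ s t k S φ)

theorem con_dual : con (-q⁻¹) μ k φ = con q μ k φ := by rw [con, con, eta_dual]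

include H

theorem dual : BMWTrace (-q⁻¹) μ s t k S φ := { H with gens := fun n => (H.gens n).dual }

theorem newtonSum_eq {d m : ℕ} (hA : AntisymDefined q μ d) (hm : m ≤ d) :
    newtonSum q μ s k φ m = contractSum (fun m => (-1) ^ m * (μ * q ^ m - q * (q ^ m)⁻¹))
      (elem q μ s k φ) (con q μ k φ) m := by
  induction m using Nat.strong_induction_on with
  | _ m ih =>
    match m, hm, ih with
    | 0, _, _ => rfl
    | 1, _, _ =>
      rw [newtonSum, Finset.sum_range_one, contractSum, nkook, smul_zero]
    | m + 2, hm, ih =>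
      rw [H.newtonSum_add_two hA hm, contractSum, ih m (by omega) (by omega)]

/-- The Newton relations for the antisymmetrizers. -/
theorem newton {d m : ℕ} (hA : AntisymDefined q μ d) (hm : m ≤ d) :
    ∑ i ∈ Finset.range m, (-q) ^ i • (elem q μ s k φ i * pow s φ (m - i)) =
      -((-1) ^ m * qNum q m) • elem q μ s k φ m +
        contractSum (fun m => (-1) ^ m * (μ * q ^ m - q * (q ^ m)⁻¹))
          (elem q μ s k φ) (con q μ k φ) m := by
  rw [H.newton_aux hA hm, H.newtonSum_eq hA hm]

/-- The Newton relations for the symmetrizers. -/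
theorem newton_dual {d m : ℕ} (hA : SymDefined q μ d) (hm : m ≤ d) :
    ∑ i ∈ Finset.range m, (q ^ i)⁻¹ • (elem (-q⁻¹) μ s k φ i * pow s φ (m - i)) =
      qNum q m • elem (-q⁻¹) μ s k φ m +
        contractSum (fun m => μ * (q ^ m)⁻¹ + q⁻¹ * q ^ m)
          (elem (-q⁻¹) μ s k φ) (con q μ k φ) m := by
  have h := H.dual.newton hA.dual hm
  rw [con_dual, qNum_dual] at h
  have h2 : ∀ i : ℕ, ((-1 : ℂ) ^ i) * (-1) ^ i = 1 := fun i => by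
    rw [← mul_pow]; norm_num
  have h3 : -((-1) ^ m * (-(-1) ^ m * qNum q m)) = qNum q m := by
    linear_combination qNum q m * h2 m
  have h4 : (fun m : ℕ => (-1) ^ m * (μ * (-q⁻¹) ^ m - -q⁻¹ * ((-q⁻¹) ^ m)⁻¹)) =
      fun m => μ * (q ^ m)⁻¹ + q⁻¹ * q ^ m := by
    funext m
    rw [neg_pow q⁻¹, inv_pow, mul_inv, inv_inv, inv_neg_one_pow]
    linear_combination (μ * (q ^ m)⁻¹ + q⁻¹ * q ^ m) * h2 m
  rw [h3, h4] at h
  simpa only [neg_neg, inv_pow] using h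

end BMWTrace

/-! ### Wronski relations by generating functions. -/

section Wronski

open PowerSeries

theorem coeff_mul_C_mul_X_sq {C : Type*} [CommRing C] (f : C⟦X⟧) (g : C) (m : ℕ) :
    coeff (m + 2) (f * (PowerSeries.C g * X ^ 2)) = coeff m f * g := by
  rw [← mul_assoc, coeff_mul_X_pow, coeff_mul_C]

theorem coeff_mul_C_mul_X_sq_of_lt {C : Type*} [CommRing C] (f : C⟦X⟧) (g : C) {m : ℕ}
    (hm : m < 2) : coeff m (f * (PowerSeries.C g * X ^ 2)) = 0 := by
  rw [← mul_assoc, coeff_mul_X_pow', if_neg (by omega)]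

variable {C : Type*} [CommRing C] [Algebra ℂ C]

/-- For the generating series Γ the recursion of `contractSum` reads Γ = gX²(Γ + Σ c_m a_m X^m). -/
theorem contractSum_series (c c' : ℂ) (x y : ℂ) (a : ℕ → C) (g : C) :
    (1 - PowerSeries.C g * X ^ 2) *
      mk (contractSum (fun m => c * x ^ m + c' * y ^ m) a g) =
      PowerSeries.C g * X ^ 2 *
        (c • mk (fun m => x ^ m • a m) + c' • mk (fun m => y ^ m • a m)) := by
  rw [sub_mul, one_mul, mul_comm _ (mk _), mul_comm _ (_ + _)]
  ext m
  match m with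
  | 0 =>
    rw [map_sub, coeff_mul_C_mul_X_sq_of_lt _ _ (by omega),
      coeff_mul_C_mul_X_sq_of_lt _ _ (by omega), coeff_mk, contractSum, sub_zero]
  | 1 =>
    rw [map_sub, coeff_mul_C_mul_X_sq_of_lt _ _ (by omega),
      coeff_mul_C_mul_X_sq_of_lt _ _ (by omega), coeff_mk, contractSum, sub_zero]
  | m + 2 =>
    rw [map_sub, coeff_mul_C_mul_X_sq, coeff_mul_C_mul_X_sq, coeff_mk, coeff_mk, contractSum,
      add_mul, add_sub_cancel_left, map_add, coeff_smul, coeff_smul, coeff_mk, coeff_mk, add_smul,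
      mul_smul, mul_smul]

/-- The factor q - q⁻¹ turns m_q into a difference of powers, so both sides involve only rescalings
of the series of the a's. The constant term of the power sum series is set to zero because p_0 does
not enter the Newton relations. -/
theorem newton_series {l : ℂ} {n : ℕ} {c c' x y : ℂ} {a p : ℕ → C} {g : C}
    (h : ∀ m ≤ n, l • ∑ i ∈ Finset.range m, x ^ i • (a i * p (m - i)) =
      (y ^ m - x ^ m) • a m + l • contractSum (fun m => c * x ^ m + c' * y ^ m) a g m) :
    X ^ (n + 1) ∣ mk (fun m => x ^ m • a m) *
        ((l • mk (fun m => if m = 0 then 0 else p m) + 1) * (1 - PowerSeries.C g * X ^ 2) -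
          (l * c) • (PowerSeries.C g * X ^ 2)) -
      mk (fun m => y ^ m • a m) *
        (1 - PowerSeries.C g * X ^ 2 + (l * c') • (PowerSeries.C g * X ^ 2)) := by
  have h1 := contractSum_series c c' x y a g
  have h2 : X ^ (n + 1) ∣ l • (mk (fun m => x ^ m • a m) * mk (fun m => if m = 0 then 0 else p m)) +
      mk (fun m => x ^ m • a m) - mk (fun m => y ^ m • a m) -
      l • mk (contractSum (fun m => c * x ^ m + c' * y ^ m) a g) := by
    rw [X_pow_dvd_iff]
    intro m hm
    rw [map_sub, map_sub, map_add, coeff_smul, coeff_smul, coeff_mk, coeff_mk, coeff_mk, coeff_mul,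
      Finset.Nat.sum_antidiagonal_eq_sum_range_succ_mk, Finset.sum_range_succ]
    simp only [coeff_mk, Nat.sub_self, if_true, mul_zero, add_zero]
    rw [Finset.sum_congr rfl (g := fun i => x ^ i • (a i * p (m - i))), h m (by omega)]
    · module
    · intro i hi
      have := Finset.mem_range.mp hi
      rw [if_neg (by omega), smul_mul_assoc]
  refine (h2.mul_left (1 - PowerSeries.C g * X ^ 2)).trans (dvd_of_eq ?_)
  generalize mk (contractSum (fun m => c * x ^ m + c' * y ^ m) a g) = Γ at *
  generalize mk (fun m => if m = 0 then 0 else p m) = P at *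
  generalize mk (fun m => x ^ m • a m) = α at *
  generalize mk (fun m => y ^ m • a m) = β at *
  generalize PowerSeries.C g * X ^ 2 = G at *
  simp only [Algebra.smul_def, map_mul] at h1 ⊢
  linear_combination -(algebraMap ℂ C⟦X⟧ l) * h1

/-- If W(X) = A(-X)S(X), this is the coefficient of W(zX); the scalars appear separately so that the
lemma applies to z = q and z = q⁻¹ without rewriting signs. -/
theorem coeff_mk_mul_mk (x y z : ℂ) (a s : ℕ → C) (hx : x = z * (-1)) (hy : y = z) (m : ℕ) :
    coeff m (mk (fun m => x ^ m • a m) * mk (fun m => y ^ m • s m)) =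
      z ^ m • ∑ i ∈ Finset.range (m + 1), (-1 : ℂ) ^ i • (a i * s (m - i)) := by
  rw [coeff_mul, Finset.Nat.sum_antidiagonal_eq_sum_range_succ_mk, Finset.smul_sum]
  refine Finset.sum_congr rfl fun i hi => ?_
  have : m = i + (m - i) := by have := Finset.mem_range.mp hi; omega
  simp only [coeff_mk]
  rw [smul_mul_smul_comm, smul_smul, hx, hy]
  congr 1
  have e : z ^ m = z ^ i * z ^ (m - i) := by rw [← pow_add, ← this]
  rw [e, mul_pow]
  ring

/-- The Wronski relations follow from the two families of Newton relations. -/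
theorem wronski_of_newton {q μ : ℂ} (hp : BMWParams q μ) {n : ℕ}
    (hq : ∀ m, 2 ≤ m → m ≤ n → qNum q m ≠ 0)
    {a s p : ℕ → C} {g : C} (ha0 : a 0 = 1) (hs0 : s 0 = 1)
    (ha : ∀ m ≤ n, ∑ i ∈ Finset.range m, (-q) ^ i • (a i * p (m - i)) =
      -((-1) ^ m * qNum q m) • a m +
        contractSum (fun m => (-1) ^ m * (μ * q ^ m - q * (q ^ m)⁻¹)) a g m)
    (hs : ∀ m ≤ n, ∑ i ∈ Finset.range m, (q ^ i)⁻¹ • (s i * p (m - i)) =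
      qNum q m • s m + contractSum (fun m => μ * (q ^ m)⁻¹ + q⁻¹ * q ^ m) s g m)
    (m : ℕ) (hm : m ≤ n) :
    ∑ i ∈ Finset.range (m + 1), (-1 : ℂ) ^ i • (a i * s (m - i)) =
      (if m = 0 then 1 else 0) - (if m = 2 then g else 0) := by
  have h0 := hp.q_ne_zero
  have h1 := hp.sub_inv_ne_zero
  have e1 : (fun m : ℕ => (-1) ^ m * (μ * q ^ m - q * (q ^ m)⁻¹)) =
      fun m => μ * (-q) ^ m + (-q) * (-q⁻¹) ^ m := by
    funext m
    rw [neg_pow q, neg_pow q⁻¹, inv_pow]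
    ring
  have e2 : (fun m : ℕ => μ * (q ^ m)⁻¹ + q⁻¹ * q ^ m) = fun m => μ * q⁻¹ ^ m + q⁻¹ * q ^ m := by
    funext m
    rw [inv_pow]
  rw [e1] at ha
  rw [e2] at hs
  have E1 := newton_series (l := q - q⁻¹) (x := -q) (y := -q⁻¹) (n := n) (a := a) (p := p) (g := g)
    (fun m hm => by
      rw [ha m hm, smul_add, smul_smul, mul_neg, mul_left_comm, qNum_mul h1]
      congr 2
      rw [neg_pow q⁻¹, neg_pow q, inv_pow]
      ring)
  have E2 := newton_series (l := q - q⁻¹) (x := q⁻¹) (y := q) (n := n) (a := s) (p := p) (g := g)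
    (fun m hm => by
      simp only [inv_pow] at hs ⊢
      rw [hs m hm, smul_add, smul_smul, qNum_mul h1])
  -- Both relations have c = μ, so the factor containing the power sums is the same in `E1` and
  -- `E2`; cross-multiplication eliminates it.
  have E3 := (E2.mul_left (mk (fun m => (-q) ^ m • a m))).sub
    (E1.mul_left (mk (fun m => q⁻¹ ^ m • s m)))
  have c1 : (q - q⁻¹) * q⁻¹ = 1 - q⁻¹ ^ 2 := by
    rw [sub_mul, mul_inv_cancel₀ h0]; ring
  have c2 : (q - q⁻¹) * (-q) = 1 - q ^ 2 := by
    rw [mul_neg, sub_mul, inv_mul_cancel₀ h0]; ring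
  rw [c1, c2] at E3
  have E4 : X ^ (n + 1) ∣
      mk (fun m => (-q⁻¹) ^ m • a m) * mk (fun m => q⁻¹ ^ m • s m) -
      q ^ 2 • (mk (fun m => (-q⁻¹) ^ m • a m) * mk (fun m => q⁻¹ ^ m • s m) *
        (PowerSeries.C g * X ^ 2)) -
      (mk (fun m => (-q) ^ m • a m) * mk (fun m => q ^ m • s m) -
      q⁻¹ ^ 2 • (mk (fun m => (-q) ^ m • a m) * mk (fun m => q ^ m • s m) *
        (PowerSeries.C g * X ^ 2))) := by
    refine E3.trans (dvd_of_eq ?_)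
    generalize mk (fun m => (-q) ^ m • a m) = α
    generalize mk (fun m => (-q⁻¹) ^ m • a m) = β
    generalize mk (fun m => q ^ m • s m) = γ
    generalize mk (fun m => q⁻¹ ^ m • s m) = δ
    simp only [Algebra.smul_def, map_sub, map_one]
    ring
  rw [X_pow_dvd_iff] at E4
  have key := fun m (hm : m ≤ n) => E4 m (by omega)
  clear E1 E2 E3 E4 ha hs
  simp only [map_sub, coeff_smul] at key
  have w1 := coeff_mk_mul_mk (-q) q q a s (by ring) rfl
  have w2 := coeff_mk_mul_mk (-q⁻¹) q⁻¹ q⁻¹ a s (by ring) rfl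
  generalize mk (fun m => (-q⁻¹) ^ m • a m) * mk (fun m => q⁻¹ ^ m • s m) = U at *
  generalize mk (fun m => (-q) ^ m • a m) * mk (fun m => q ^ m • s m) = V at *
  obtain ⟨W, hW⟩ : ∃ W : ℕ → C, W = fun m =>
      ∑ i ∈ Finset.range (m + 1), (-1 : ℂ) ^ i • (a i * s (m - i)) :=
    ⟨_, rfl⟩
  have hW0 : W 0 = 1 := by simp [hW, ha0, hs0]
  have w1' : ∀ m, coeff m V = q ^ m • W m := fun m => by rw [w1, hW]
  have w2' : ∀ m, coeff m U = q⁻¹ ^ m • W m := fun m => by rw [w2, hW]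
  have goal : W m = (if m = 0 then 1 else 0) - (if m = 2 then g else 0) := by
    clear hW w1 w2
    have rec1 : 1 ≤ n → W 1 = 0 := by
      intro hn
      have := key 1 hn
      rw [coeff_mul_C_mul_X_sq_of_lt _ _ (by omega), coeff_mul_C_mul_X_sq_of_lt _ _ (by omega),
        w1', w2', smul_zero, smul_zero, sub_zero, sub_zero, ← sub_smul] at this
      refine (smul_eq_zero.mp this).resolve_left ?_
      rw [pow_one, pow_one, ← neg_sub]
      exact neg_ne_zero.mpr h1
    -- Coefficient comparison in W(q⁻¹X)(1 - q²gX²) ≡ W(qX)(1 - q⁻²gX²) determines W_{m+2} from W_m,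
    -- because (m+2)_q ≠ 0.
    have rec2 : ∀ m, m + 2 ≤ n → (q ^ (m + 2) - q⁻¹ ^ (m + 2)) • W (m + 2) =
        (q⁻¹ ^ 2 * q ^ m - q ^ 2 * q⁻¹ ^ m) • (W m * g) := by
      intro m hn
      have := key (m + 2) hn
      rw [coeff_mul_C_mul_X_sq, coeff_mul_C_mul_X_sq, w1', w1', w2', w2', smul_mul_assoc,
        smul_mul_assoc, smul_smul, smul_smul] at this
      rw [sub_smul, sub_smul, ← sub_eq_zero, ← neg_eq_zero, ← this]
      abel
    have hne : ∀ m, m + 2 ≤ n → q ^ (m + 2) - q⁻¹ ^ (m + 2) ≠ 0 := fun m hn => by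
      rw [inv_pow, ← qNum_mul h1]
      exact mul_ne_zero h1 (hq _ (by omega) hn)
    induction m using Nat.strong_induction_on with
    | _ m ih =>
      match m, hm, ih with
      | 0, _, _ => simp [hW0]
      | 1, hm, _ => simp [rec1 hm]
      | 2, hm, _ =>
        have r := rec2 0 hm
        have : q⁻¹ ^ 2 * q ^ 0 - q ^ 2 * q⁻¹ ^ 0 = -(q ^ (0 + 2) - q⁻¹ ^ (0 + 2)) := by ring
        rw [this, neg_smul, ← smul_neg, hW0, one_mul] at r
        simpa using smul_right_injective C (hne 0 hm) r
      | 3, hm, _ =>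
        have r := rec2 1 hm
        rw [rec1 (by omega), zero_mul, smul_zero] at r
        simpa using (smul_eq_zero.mp r).resolve_left (hne 1 hm)
      -- The coefficient in front of W_2 g vanishes here, so the value W_2 = -g does not propagate
      -- to degree four.
      | 4, hm, _ =>
        have r := rec2 2 hm
        rw [mul_comm, sub_self, zero_smul] at r
        simpa using (smul_eq_zero.mp r).resolve_left (hne 2 hm)
      | m + 5, hm, ih =>
        have r := rec2 (m + 3) hm
        rw [ih (m + 3) (by omega) (by omega), if_neg (by omega), if_neg (by omega), sub_zero,
          zero_mul, smul_zero] at r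
        rw [if_neg (by omega), if_neg (by omega), sub_zero]
        exact (smul_eq_zero.mp r).resolve_left (hne (m + 3) hm)
  rw [← goal, hW]

end Wronski

namespace BMWTrace

variable {q μ : ℂ} {A : Type*} [Ring A] [Algebra ℂ A] {B : ℕ → Type*}
    [∀ n, Ring (B n)] [∀ n, Algebra ℂ (B n)] {s t k : ∀ n, ℕ → B n}
    {S : ∀ n, Subalgebra ℂ (B n)} {φ : ∀ n, B n →ₗ[ℂ] A}
    (H : BMWTrace q μ s t k S φ)

include H

open scoped IsMulCommutative in
/-- The Wronski relations between the symmetrizers and the antisymmetrizers. -/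
theorem wronski {n : ℕ} (hA : AntisymDefined q μ n) (hS : SymDefined q μ n) :
    ∑ i ∈ Finset.range (n + 1),
      (-1 : ℂ) ^ i • (elem q μ s k φ i * elem (-q⁻¹) μ s k φ (n - i)) =
      (if n = 0 then 1 else 0) - (if n = 2 then con q μ k φ else 0) := by
  -- The power series argument needs commutative coefficients; all elements involved lie in the
  -- subalgebra generated by the commuting values of the traces.
  let T : Set A := {x | ∃ m, 0 < m ∧ ∃ X ∈ S m, x = φ m X}
  have hT : ∀ x ∈ T, ∀ y ∈ T, x * y = y * x := by
    rintro _ ⟨m, hm, X, hX, rfl⟩ _ ⟨l, hl, Y, hY, rfl⟩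
    exact H.comm m l hm X hX Y hY
  have := Algebra.isMulCommutative_adjoin ℂ hT
  have hmem : ∀ m, 0 < m → ∀ X ∈ S m, φ m X ∈ Algebra.adjoin ℂ T := fun m hm X hX =>
    Algebra.subset_adjoin ⟨m, hm, X, hX, rfl⟩
  have ha : ∀ i, elem q μ s k φ i ∈ Algebra.adjoin ℂ T := fun i => by
    cases i with
    | zero => rw [H.elem_zero]; exact one_mem _
    | succ i => exact hmem _ (Nat.succ_pos i) _ (H.asym_mem _ _)
  have hs : ∀ i, elem (-q⁻¹) μ s k φ i ∈ Algebra.adjoin ℂ T := fun i => by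
    cases i with
    | zero => rw [H.dual.elem_zero]; exact one_mem _
    | succ i => exact hmem _ (Nat.succ_pos i) _ (H.dual.asym_mem _ _)
  have hp : ∀ i, pow s φ i ∈ Algebra.adjoin ℂ T := fun i => by
    cases i with
    | zero => rw [pow, dsc, H.zero]; exact one_mem _
    | succ i => exact hmem _ (Nat.succ_pos i) _ (dsc_mem (H.s_mem _) _ _)
  have hg : con q μ k φ ∈ Algebra.adjoin ℂ T :=
    Subalgebra.smul_mem _ (hmem 2 (by omega) _ (H.k_mem 2 0)) _
  have h := wronski_of_newton (H.gens 0).params (fun m h2 hm => (hA m h2 hm).1)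
    (a := fun i => (⟨_, ha i⟩ : Algebra.adjoin ℂ T)) (s := fun i => ⟨_, hs i⟩)
    (p := fun i => ⟨_, hp i⟩) (g := ⟨_, hg⟩) (Subtype.ext H.elem_zero)
    (Subtype.ext H.dual.elem_zero)
    (fun m hm => by
      apply Subtype.val_injective
      have h := H.newton hA hm
      rw [← Subalgebra.coe_val, map_add, map_contractSum, map_sum]
      exact h)
    (fun m hm => by
      apply Subtype.val_injective
      have h := H.newton_dual hS hm
      rw [← Subalgebra.coe_val, map_add, map_contractSum, map_sum]
      exact h)
    n le_rfl
  have h' := congrArg (Algebra.adjoin ℂ T).val h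
  rw [map_sum, map_sub, apply_ite (Algebra.adjoin ℂ T).val, apply_ite (Algebra.adjoin ℂ T).val,
    map_one, map_zero] at h'
  exact h'

end BMWTrace

end BMWQuantum

namespace BMWQuantum

/-! ### The skew inverse and invariance of the R-trace. -/

section SkewInverse

variable {ι : Type*} [Fintype ι] [DecidableEq ι]

/-- Invariance of the quantum trace under conjugation by a quantum group-like matrix. -/
theorem sum_smul_mul_eq_of_rll {A : Type*} [Ring A] [Algebra ℂ A]
    {X Y : ι → ι → ι → ι → ℂ}
    (h1 : ∀ a e c f, ∑ b, ∑ d, X a b c d * Y d e b f = if a = f ∧ e = c then 1 else 0)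
    (h2 : ∀ g e h f, ∑ a, ∑ c, Y g a h c * X c e a f = if g = f ∧ e = h then 1 else 0)
    (L S : Matrix ι ι A) (hLS : L * S = 1) (hSL : S * L = 1)
    (hL : ∀ a b c d, ∑ x, ∑ y, X a b x y • (L x c * L y d) =
      ∑ x, ∑ y, X x y c d • (L a x * L b y)) (g h : ι) :
    ∑ b, ∑ d, (∑ e, Y d e b e) • (L b h * S g d) = algebraMap ℂ A (∑ e, Y g e h e) := by
  have hLS' : ∀ a c, ∑ b, L a b * S b c = if a = c then 1 else 0 := fun a c => by
    rw [← Matrix.mul_apply, hLS, Matrix.one_apply]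
  have hSL' : ∀ a c, ∑ b, S a b * L b c = if a = c then 1 else 0 := fun a c => by
    rw [← Matrix.mul_apply, hSL, Matrix.one_apply]
  -- Multiplying the exchange relation by the inverse `S` on both sides leaves one `L` and one `S`
  -- on each side; `Q` is the common value.
  set Q : ι → ι → ι → ι → A := fun b d a c => ∑ x, ∑ y, X x b y d • (S a x * L y c) with hQ
  have key : ∀ a b c d, Q b d a c = ∑ x, ∑ y, X a x c y • (L b x * S y d) := by
    intro a b c d
    have e1 : ∑ w, ∑ z, S a w * (∑ x, ∑ y, X w b x y • (L x c * L y z)) * S z d = Q b d a c := by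
      simp only [hQ, Finset.mul_sum, Finset.sum_mul, mul_smul_comm, smul_mul_assoc]
      refine Finset.sum_congr rfl fun w _ => ?_
      rw [Finset.sum_comm]
      refine Finset.sum_congr rfl fun x _ => ?_
      rw [Finset.sum_comm]
      have : ∀ y, ∑ z, X w b x y • (S a w * (L x c * L y z) * S z d) =
          if y = d then X w b x y • (S a w * L x c) else 0 := by
        intro y
        rw [← Finset.smul_sum]
        simp only [mul_assoc]
        rw [← Finset.mul_sum, ← Finset.mul_sum, hLS']
        split_ifs <;> simp
      simp [this]
    have e2 : ∑ w, ∑ z, S a w * (∑ x, ∑ y, X x y c z • (L w x * L b y)) * S z d =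
        ∑ x, ∑ y, X a x c y • (L b x * S y d) := by
      simp only [Finset.mul_sum, Finset.sum_mul, mul_smul_comm, smul_mul_assoc]
      rw [Finset.sum_comm]
      have : ∀ z, ∑ w, ∑ x, ∑ y, X x y c z • (S a w * (L w x * L b y) * S z d) =
          ∑ y, X a y c z • (L b y * S z d) := by
        intro z
        rw [Finset.sum_comm]
        have : ∀ x, ∑ w, ∑ y, X x y c z • (S a w * (L w x * L b y) * S z d) =
          if a = x then ∑ y, X x y c z • (L b y * S z d) else 0 := by
          intro x
          rw [Finset.sum_comm]
          simp only [← Finset.smul_sum, ← mul_assoc, ← Finset.sum_mul, hSL']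
          split_ifs <;> simp
        simp [this]
      simp only [this]
      rw [Finset.sum_comm]
    rw [← e1, ← e2]
    simp only [hL]
  -- The skew inverse solves the second expression of `Q` for the product of `L` and `S`; contracted
  -- with the first expression (`i2`) it closes up to `S L`, and summation over the closed index
  -- uses S L = 1.
  have i1 : ∀ b d, L b h * S g d = ∑ a, ∑ c, Y g c h a • Q b d a c := by
    intro b d
    simp only [key, Finset.smul_sum, smul_smul]
    have : ∀ a, ∑ c, ∑ x, ∑ y, (Y g c h a * X a x c y) • (L b x * S y d) =
        ∑ x, ∑ y, ∑ c, (Y g c h a * X a x c y) • (L b x * S y d) := by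
      intro a
      rw [Finset.sum_comm]
      refine Finset.sum_congr rfl fun x _ => ?_
      rw [Finset.sum_comm]
    simp only [this]
    rw [Finset.sum_comm]
    have : ∀ x, ∑ a, ∑ y, ∑ c, (Y g c h a * X a x c y) • (L b x * S y d) =
        ∑ y, (if g = y ∧ x = h then (1 : ℂ) else 0) • (L b x * S y d) := by
      intro x
      rw [Finset.sum_comm]
      refine Finset.sum_congr rfl fun y _ => ?_
      rw [← h2, Finset.sum_comm]
      simp only [Finset.sum_smul]
    simp only [this, ite_and, ite_smul, one_smul, zero_smul, Finset.sum_ite_eq,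
      Finset.mem_univ, if_true, Finset.sum_ite_eq']
  have i2 : ∀ e a c, ∑ b, ∑ d, Y d e b e • Q b d a c = S a e * L e c := by
    intro e a c
    simp only [hQ, Finset.smul_sum, smul_smul]
    have : ∀ b, ∑ d, ∑ x, ∑ y, (Y d e b e * X x b y d) • (S a x * L y c) =
        ∑ x, ∑ y, ∑ d, (Y d e b e * X x b y d) • (S a x * L y c) := by
      intro b
      rw [Finset.sum_comm]
      refine Finset.sum_congr rfl fun x _ => ?_
      rw [Finset.sum_comm]
    simp only [this]
    rw [Finset.sum_comm]
    have : ∀ x, ∑ b, ∑ y, ∑ d, (Y d e b e * X x b y d) • (S a x * L y c) =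
        ∑ y, (if x = e ∧ e = y then (1 : ℂ) else 0) • (S a x * L y c) := by
      intro x
      rw [Finset.sum_comm]
      refine Finset.sum_congr rfl fun y _ => ?_
      rw [← h1]
      simp only [Finset.sum_smul, mul_comm]
    simp only [this, ite_and, ite_smul, one_smul, zero_smul, Finset.sum_ite_eq,
      Finset.mem_univ, if_true, Finset.sum_ite_eq', Finset.sum_ite_irrel, Finset.sum_const_zero]
  calc ∑ b, ∑ d, (∑ e, Y d e b e) • (L b h * S g d)
      = ∑ a, ∑ c, Y g c h a • ∑ e, ∑ b, ∑ d, Y d e b e • Q b d a c := by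
        simp only [i1, Finset.sum_smul, Finset.smul_sum]
        have : ∀ b d e a c, Y d e b e • Y g c h a • Q b d a c =
          Y g c h a • Y d e b e • Q b d a c := fun _ _ _ _ _ => smul_comm _ _ _
        simp only [this]
        simp only [← Fintype.sum_prod_type']
        refine Fintype.sum_equiv
          ⟨fun p => (p.2.2.1, p.2.2.2.1, p.2.2.2.2, p.1, p.2.1),
           fun p => (p.2.2.2.1, p.2.2.2.2, p.1, p.2.1, p.2.2.1), fun _ => rfl, fun _ => rfl⟩
          _ _ fun p => ?_
        rfl
    _ = algebraMap ℂ A (∑ e, Y g e h e) := by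
        simp only [i2, hSL', Algebra.algebraMap_eq_smul_one, smul_ite, smul_zero,
          Finset.sum_ite_eq, Finset.mem_univ, if_true, Finset.sum_smul]

omit [DecidableEq ι] in
theorem sum_fin_two {S : Type*} [AddCommMonoid S] (f : (Fin 2 → ι) → S) :
    ∑ i, f i = ∑ a, ∑ b, f ![a, b] := by
  rw [← (finTwoArrowEquiv ι).symm.sum_comp, Fintype.sum_prod_type]
  rfl

omit [DecidableEq ι] in
theorem sum_fin_three {S : Type*} [AddCommMonoid S] (f : (Fin 3 → ι) → S) :
    ∑ i, f i = ∑ a, ∑ b, ∑ c, f ![a, b, c] := by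
  rw [← (Fin.consEquiv fun _ : Fin 3 => ι).sum_comp, Fintype.sum_prod_type]
  refine Finset.sum_congr rfl fun a _ => ?_
  rw [sum_fin_two]
  rfl

omit [Fintype ι] in
theorem place_left_apply {S : Type*} [Zero S] (X : TMat ι 2 S) (a b c d e f : ι) :
    (place ![0, 1] X : TMat ι 3 S) ![a, b, c] ![d, e, f] =
      if c = f then X ![a, b] ![d, e] else 0 := by
  simp only [place, Matrix.of_apply]
  have h1 : (fun l => (![a, b, c] : Fin 3 → ι) ((![0, 1] : Fin 2 → Fin 3) l)) = ![a, b] := by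
    funext l; fin_cases l <;> rfl
  have h2 : (fun l => (![d, e, f] : Fin 3 → ι) ((![0, 1] : Fin 2 → Fin 3) l)) = ![d, e] := by
    funext l; fin_cases l <;> rfl
  rw [h1, h2]
  congr 1
  simp [Fin.forall_fin_succ]

omit [Fintype ι] in
theorem place_right_apply {S : Type*} [Zero S] (X : TMat ι 2 S) (a b c d e f : ι) :
    (place ![1, 2] X : TMat ι 3 S) ![a, b, c] ![d, e, f] =
      if a = d then X ![b, c] ![e, f] else 0 := by
  simp only [place, Matrix.of_apply]
  have h1 : (fun l => (![a, b, c] : Fin 3 → ι) ((![1, 2] : Fin 2 → Fin 3) l)) = ![b, c] := by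
    funext l; fin_cases l <;> rfl
  have h2 : (fun l => (![d, e, f] : Fin 3 → ι) ((![1, 2] : Fin 2 → Fin 3) l)) = ![e, f] := by
    funext l; fin_cases l <;> rfl
  rw [h1, h2]
  congr 1
  simp [Fin.forall_fin_succ]

theorem IsSkewInverse.sum_right {X Y : TMat ι 2 ℂ} (h : IsSkewInverse X Y) (a e c f : ι) :
    ∑ b, ∑ d, X ![a, b] ![c, d] * Y ![d, e] ![b, f] = if a = f ∧ e = c then 1 else 0 := by
  have h1 := congrFun (congrFun h.1 ![a, e]) ![c, f]
  simpa [trMid, permOp, Matrix.mul_apply, sum_fin_three, place_left_apply, place_right_apply]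
    using h1

theorem IsSkewInverse.sum_left {X Y : TMat ι 2 ℂ} (h : IsSkewInverse X Y) (g e k f : ι) :
    ∑ a, ∑ c, Y ![g, a] ![k, c] * X ![c, e] ![a, f] = if g = f ∧ e = k then 1 else 0 := by
  have h1 := congrFun (congrFun h.2 ![g, e]) ![k, f]
  simpa [trMid, permOp, Matrix.mul_apply, sum_fin_three, place_left_apply, place_right_apply]
    using h1

theorem SkewInvertible.isSkewInverse {X : TMat ι 2 ℂ} (h : SkewInvertible X) :
    IsSkewInverse X (skewInv X) := by
  rw [skewInv, dif_pos h]
  exact h.choose_spec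

/-- The matrix on the first tensor factor whose entries are the blocks of an operator
`u ⊗ v ↦ v' ⊗ u'`. -/
def passRight (F : TMat ι 2 ℂ) : Matrix ι ι (Matrix ι ι ℂ) :=
  Matrix.of fun b h => Matrix.of fun w u => F ![w, b] ![h, u]

/-- The blocks are read from the other pair of indices, so that `passLeft F⁻¹` is the inverse of
`passRight F`. -/
def passLeft (F : TMat ι 2 ℂ) : Matrix ι ι (Matrix ι ι ℂ) :=
  Matrix.of fun g d => Matrix.of fun u v => F ![g, u] ![v, d]

/-- The second twist relation is an exchange relation for the matrix `passRight F` with coefficients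
in `End V`. -/
theorem sum_matD_conj {R F : TMat ι 2 ℂ} (hR : SkewInvertible R) (hF : IsUnit F)
    (hRF : (place ![1, 2] R * place ![0, 1] F * place ![1, 2] F : TMat ι 3 ℂ) =
      place ![0, 1] F * place ![1, 2] F * place ![0, 1] R) (g h w v : ι) :
    ∑ b, ∑ d, ∑ u, matD R d b * (F ![w, b] ![h, u] * F⁻¹ ![g, u] ![v, d]) =
      if w = v then matD R g h else 0 := by
  have hdet : IsUnit F.det := (Matrix.isUnit_iff_isUnit_det F).mp hF
  have e := sum_smul_mul_eq_of_rll (X := fun a b c d => R ![a, b] ![c, d])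
    (Y := fun a b c d => skewInv R ![a, b] ![c, d])
    (fun a e c f => hR.isSkewInverse.sum_right a e c f)
    (fun g e h f => hR.isSkewInverse.sum_left g e h f)
    (passRight F) (passLeft F⁻¹) ?_ ?_ ?_ g h
  · have e1 := congrFun (congrFun e w) v
    simp only [Matrix.sum_apply, Matrix.smul_apply, Matrix.mul_apply, passRight, passLeft,
      Matrix.of_apply, smul_eq_mul, Finset.mul_sum, Matrix.algebraMap_matrix_apply,
      Algebra.algebraMap_self, RingHom.id_apply] at e1
    simpa [matD, Finset.mul_sum] using e1
  · ext b d w v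
    have e1 := congrFun (congrFun (Matrix.mul_nonsing_inv F hdet) ![w, b]) ![v, d]
    rw [Matrix.mul_apply, sum_fin_two] at e1
    simp only [Matrix.mul_apply, passRight, passLeft, Matrix.of_apply, Matrix.sum_apply]
    rw [e1]
    by_cases h1 : b = d <;> by_cases h2 : w = v <;> simp [Matrix.one_apply, h1, h2]
  · ext b d w v
    have e1 := congrFun (congrFun (Matrix.nonsing_inv_mul F hdet) ![b, w]) ![d, v]
    rw [Matrix.mul_apply, sum_fin_two, Finset.sum_comm] at e1
    simp only [Matrix.mul_apply, passRight, passLeft, Matrix.of_apply, Matrix.sum_apply]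
    rw [e1]
    by_cases h1 : b = d <;> by_cases h2 : w = v <;> simp [Matrix.one_apply, h1, h2]
  · intro a b c d
    ext w v
    have e1 := congrFun (congrFun hRF ![w, a, b]) ![c, d, v]
    rw [mul_assoc, mul_assoc] at e1
    simp only [Matrix.mul_apply, sum_fin_three, place_left_apply, place_right_apply,
      ite_mul, mul_ite, zero_mul, mul_zero, Finset.sum_ite_eq, Finset.sum_ite_eq',
      Finset.mem_univ, if_true, Finset.sum_ite_irrel, Finset.sum_const_zero] at e1
    simp only [Matrix.mul_apply, passRight, Matrix.of_apply, Matrix.sum_apply,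
      Matrix.smul_apply, smul_eq_mul]
    rw [e1]
    refine Finset.sum_congr rfl fun x _ => ?_
    simp only [Finset.mul_sum]
    rw [Finset.sum_comm]
    refine Finset.sum_congr rfl fun y _ => Finset.sum_congr rfl fun j _ => ?_
    ring

/-- The Yang–Baxter equation is an exchange relation for `passLeft R` once the entries are
multiplied in the opposite order. In that opposite algebra the defining equations of the skew
inverse say that `passLeft (skewInv R)` is the inverse matrix. -/
theorem sum_matD_skewInv {R : TMat ι 2 ℂ} (hR : SkewInvertible R) (hR' : IsRMatrix R)
    (g h w v : ι) :
    ∑ b, ∑ d, ∑ u, matD R d b * (R ![b, u] ![v, h] * skewInv R ![g, w] ![u, d]) =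
      if w = v then matD R g h else 0 := by
  have e := sum_smul_mul_eq_of_rll (A := (Matrix ι ι ℂ)ᵐᵒᵖ)
    (X := fun a b c d => R ![a, b] ![c, d])
    (Y := fun a b c d => skewInv R ![a, b] ![c, d])
    (fun a e c f => hR.isSkewInverse.sum_right a e c f)
    (fun g e h f => hR.isSkewInverse.sum_left g e h f)
    ((passLeft R).map MulOpposite.op) ((passLeft (skewInv R)).map MulOpposite.op) ?_ ?_ ?_ g h
  · simp only [Matrix.map_apply, ← MulOpposite.op_mul, ← MulOpposite.op_smul,
      ← Finset.op_sum, MulOpposite.algebraMap_apply] at e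
    have e1 := congrFun (congrFun (MulOpposite.op_injective e) w) v
    simp only [Matrix.sum_apply, Matrix.smul_apply, Matrix.mul_apply, passLeft,
      Matrix.of_apply, smul_eq_mul, Finset.mul_sum, Matrix.algebraMap_matrix_apply,
      Algebra.algebraMap_self, RingHom.id_apply] at e1
    simpa [matD, Finset.mul_sum, mul_comm, mul_left_comm, mul_assoc] using e1
  · ext b d
    apply MulOpposite.unop_injective
    ext w v
    have e1 := hR.isSkewInverse.sum_right b w v d
    rw [Finset.sum_comm] at e1
    simp only [Matrix.mul_apply, Matrix.map_apply, ← MulOpposite.op_mul, ← Finset.op_sum,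
      MulOpposite.unop_op, passLeft, Matrix.of_apply, Matrix.sum_apply, mul_comm] at e1 ⊢
    rw [e1]
    by_cases h1 : b = d <;> by_cases h2 : w = v <;> simp [Matrix.one_apply, h1, h2]
  · ext b d
    apply MulOpposite.unop_injective
    ext w v
    have e1 := hR.isSkewInverse.sum_left b w v d
    rw [Finset.sum_comm] at e1
    simp only [Matrix.mul_apply, Matrix.map_apply, ← MulOpposite.op_mul, ← Finset.op_sum,
      MulOpposite.unop_op, passLeft, Matrix.of_apply, Matrix.sum_apply, mul_comm] at e1 ⊢
    rw [e1]
    by_cases h1 : b = d <;> by_cases h2 : w = v <;> simp [Matrix.one_apply, h1, h2]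
  · intro a b c d
    apply MulOpposite.unop_injective
    ext w v
    have e1 := congrFun (congrFun hR'.yangBaxter ![a, b, w]) ![v, c, d]
    rw [mul_assoc, mul_assoc] at e1
    simp only [Matrix.mul_apply, sum_fin_three, place_left_apply, place_right_apply,
      ite_mul, mul_ite, zero_mul, mul_zero, Finset.sum_ite_eq, Finset.sum_ite_eq',
      Finset.mem_univ, if_true, Finset.sum_ite_irrel, Finset.sum_const_zero] at e1
    simp only [Matrix.mul_apply, Matrix.map_apply, ← MulOpposite.op_mul, ← Finset.op_sum,
      ← MulOpposite.op_smul,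
      MulOpposite.unop_op, passLeft, Matrix.of_apply, Matrix.sum_apply,
      Matrix.smul_apply, smul_eq_mul]
    rw [e1]
    simp only [Finset.mul_sum, ← Fintype.sum_prod_type']
    refine Fintype.sum_equiv ⟨fun p => (p.2.2, p.2.1, p.1), fun p => (p.2.2, p.2.1, p.1),
      fun _ => rfl, fun _ => rfl⟩ _ _ fun p => ?_
    simp only [Equiv.coe_fn_mk]
    ring

omit [DecidableEq ι] in
theorem sum_comm_two_three {S : Type*} [AddCommMonoid S] (f : ι → ι → ι → ι → ι → S) :
    ∑ w, ∑ h, ∑ b, ∑ d, ∑ u, f w h b d u = ∑ b, ∑ d, ∑ u, ∑ w, ∑ h, f w h b d u := by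
  simp only [← Fintype.sum_prod_type']
  exact Fintype.sum_equiv
    ⟨fun p => (p.2.2.1, p.2.2.2.1, p.2.2.2.2, p.1, p.2.1),
      fun p => (p.2.2.2.1, p.2.2.2.2, p.1, p.2.1, p.2.2.1), fun _ => rfl, fun _ => rfl⟩
    _ _ fun p => rfl

/-- The tensor square of `D_R` commutes with `R`. -/
theorem sum_matD_matD_comm {R : TMat ι 2 ℂ} (hR : SkewInvertible R) (hR' : IsRMatrix R)
    (p g x y : ι) :
    ∑ a, ∑ b, matD R p a * matD R g b * R⁻¹ ![a, b] ![x, y] =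
      ∑ a, ∑ b, R⁻¹ ![p, g] ![a, b] * (matD R a x * matD R b y) := by
  have hdet : IsUnit R.det := (Matrix.isUnit_iff_isUnit_det R).mp hR'.isUnit
  have hinv : ∀ a b c d, ∑ u, ∑ v, R ![a, b] ![u, v] * R⁻¹ ![u, v] ![c, d] =
      if a = c ∧ b = d then 1 else 0 := by
    intro a b c d
    have e1 := congrFun (congrFun (Matrix.mul_nonsing_inv R hdet) ![a, b]) ![c, d]
    rw [Matrix.mul_apply, sum_fin_two] at e1
    rw [e1, Matrix.one_apply]
    congr 1
    simp
  -- `e1` and `e2` express contractions of D_R with the skew inverse through D_R and R⁻¹, by the two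
  -- invariance lemmas, the first of them with F = R. Using `e1` on one factor and `e2` on the other
  -- moves D_R ⊗ D_R through R⁻¹.
  have e1 : ∀ g w x y, ∑ d, matD R d x * skewInv R ![g, w] ![y, d] =
      ∑ h, matD R g h * R⁻¹ ![w, h] ![x, y] := by
    intro g w x y
    have := congrArg (fun f : ι → ι → ℂ => ∑ v, ∑ h, f v h * R⁻¹ ![v, h] ![x, y])
      (funext fun v => funext fun h => sum_matD_skewInv hR hR' g h w v)
    simp only [ite_mul, zero_mul, Finset.sum_ite_irrel, Finset.sum_const_zero,
      Finset.sum_ite_eq, Finset.mem_univ, if_true] at this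
    rw [← this]
    have : ∀ b d u, ∑ v, ∑ h, matD R d b * (R ![b, u] ![v, h] * skewInv R ![g, w] ![u, d]) *
        R⁻¹ ![v, h] ![x, y] = if b = x ∧ u = y then
          matD R d b * skewInv R ![g, w] ![u, d] else 0 := by
      intro b d u
      rw [← mul_one (matD R d b * _), ← mul_ite_zero, ← hinv]
      simp only [Finset.mul_sum]
      refine Finset.sum_congr rfl fun v _ => Finset.sum_congr rfl fun h _ => ?_
      ring
    have h2 : ∑ v, ∑ h, (∑ b, ∑ d, ∑ u, matD R d b *
        (R ![b, u] ![v, h] * skewInv R ![g, w] ![u, d])) * R⁻¹ ![v, h] ![x, y] =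
        ∑ b, ∑ d, ∑ u, ∑ v, ∑ h, matD R d b *
        (R ![b, u] ![v, h] * skewInv R ![g, w] ![u, d]) * R⁻¹ ![v, h] ![x, y] := by
      simp only [Finset.sum_mul]
      exact sum_comm_two_three _
    rw [h2]
    simp [this, ite_and, Finset.sum_ite_irrel]
  have e2 : ∀ G H g v, ∑ h, matD R g h * skewInv R ![G, h] ![H, v] =
      ∑ d, matD R d H * R⁻¹ ![g, G] ![v, d] := by
    intro G H g v
    have := congrArg (fun f : ι → ι → ℂ => ∑ w, ∑ h, f w h * skewInv R ![G, h] ![H, w])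
      (funext fun w => funext fun h => sum_matD_conj hR hR'.isUnit hR'.yangBaxter.symm g h w v)
    simp only [ite_mul, zero_mul, Finset.sum_ite_irrel, Finset.sum_const_zero,
      Finset.sum_ite_eq', Finset.mem_univ, if_true] at this
    rw [← this]
    have : ∀ b d u, ∑ w, ∑ h, matD R d b * (R ![w, b] ![h, u] * R⁻¹ ![g, u] ![v, d]) *
        skewInv R ![G, h] ![H, w] = if G = u ∧ b = H then
          matD R d b * R⁻¹ ![g, u] ![v, d] else 0 := by
      intro b d u
      rw [← mul_one (matD R d b * _), ← mul_ite_zero, ← hR.isSkewInverse.sum_left, Finset.sum_comm]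
      simp only [Finset.mul_sum]
      refine Finset.sum_congr rfl fun v _ => Finset.sum_congr rfl fun h _ => ?_
      ring
    have h2 : ∑ w, ∑ h, (∑ b, ∑ d, ∑ u, matD R d b *
        (R ![w, b] ![h, u] * R⁻¹ ![g, u] ![v, d])) * skewInv R ![G, h] ![H, w] =
        ∑ b, ∑ d, ∑ u, ∑ w, ∑ h, matD R d b *
        (R ![w, b] ![h, u] * R⁻¹ ![g, u] ![v, d]) * skewInv R ![G, h] ![H, w] := by
      simp only [Finset.sum_mul]
      exact sum_comm_two_three _
    rw [h2]
    simp [this, ite_and, Finset.sum_ite_irrel]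
  calc ∑ a, ∑ b, matD R p a * matD R g b * R⁻¹ ![a, b] ![x, y]
      = ∑ a, matD R p a * ∑ d, matD R d x * skewInv R ![g, a] ![y, d] := by
        simp only [e1, Finset.mul_sum, mul_assoc]
    _ = ∑ d, matD R d x * ∑ a, matD R p a * skewInv R ![g, a] ![y, d] := by
        simp only [Finset.mul_sum]
        rw [Finset.sum_comm]
        simp only [mul_left_comm]
    _ = _ := by
        simp only [e2, Finset.mul_sum]
        refine Finset.sum_congr rfl fun v _ => Finset.sum_congr rfl fun h _ => ?_
        ring

end SkewInverse
end BMWQuantum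

namespace BMWQuantum

/-! ### Adding a strand, and partial R-traces. -/

section Strands

variable {ι : Type*}

/-- The multi-index `i` followed by `a`. -/
abbrev sn {n : ℕ} (i : Fin n → ι) (a : ι) : Fin (n + 1) → ι := Fin.snoc (α := fun _ => ι) i a

theorem sn_surjective {n : ℕ} (i : Fin (n + 1) → ι) : ∃ j a, i = sn j a :=
  ⟨Fin.init i, i (Fin.last n), (Fin.snoc_init_self i).symm⟩

theorem sn_inj {n : ℕ} {i j : Fin n → ι} {a b : ι} : sn i a = sn j b ↔ i = j ∧ a = b := by
  constructor
  · intro h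
    refine ⟨?_, ?_⟩
    · have := congrArg Fin.init h
      simpa [sn, Fin.init_snoc] using this
    · have := congrFun h (Fin.last n)
      simpa [sn] using this
  · rintro ⟨rfl, rfl⟩; rfl

theorem matrix_ext_sn {S : Type*} {n : ℕ} {X Y : TMat ι (n + 1) S}
    (h : ∀ i a j b, X (sn i a) (sn j b) = Y (sn i a) (sn j b)) : X = Y := by
  ext i j
  obtain ⟨i, a, rfl⟩ := sn_surjective i
  obtain ⟨j, b, rfl⟩ := sn_surjective j
  exact h i a j b

theorem sum_sn [Fintype ι] {S : Type*} [AddCommMonoid S] {n : ℕ} (f : (Fin (n + 1) → ι) → S) :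
    ∑ i, f i = ∑ i, ∑ a, f (sn i a) := by
  rw [← (Fin.snocEquiv fun _ : Fin (n + 1) => ι).sum_comp, Fintype.sum_prod_type_right]
  rfl

variable [Fintype ι] [DecidableEq ι] {A : Type*} [Ring A] [Algebra ℂ A]

/-- Operators on the first `n` tensor factors among `n + 1`. -/
def emb {n : ℕ} (X : TMat ι n A) : TMat ι (n + 1) A := place Fin.castSucc X

omit [Fintype ι] [Algebra ℂ A] in
theorem emb_apply {n : ℕ} (X : TMat ι n A) (i j : Fin n → ι) (a b : ι) :
    emb X (sn i a) (sn j b) = if a = b then X i j else 0 := by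
  simp only [emb, place, Matrix.of_apply, Fin.snoc_castSucc]
  congr 1
  rw [eq_iff_iff]
  constructor
  · intro h
    simpa using h (Fin.last n) fun l => (Fin.castSucc_lt_last l).ne
  · rintro rfl k hk
    induction k using Fin.lastCases with
    | last => simp
    | cast k => exact absurd rfl (hk k)

theorem emb_mul {n : ℕ} (X Y : TMat ι n A) : emb (X * Y) = emb X * emb Y := by
  apply matrix_ext_sn
  intro i a j b
  rw [Matrix.mul_apply, sum_sn]
  simp only [emb_apply, Matrix.mul_apply, ite_mul, mul_ite, zero_mul, mul_zero,
    Finset.sum_ite_eq', Finset.mem_univ, if_true, Finset.sum_ite_irrel, Finset.sum_const_zero]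

omit [Algebra ℂ A] in
omit [Fintype ι] in
theorem emb_add {n : ℕ} (X Y : TMat ι n A) : emb (X + Y) = emb X + emb Y := by
  ext i j
  simp only [emb, place, Matrix.of_apply, Matrix.add_apply]
  split_ifs <;> simp

omit [Fintype ι] in
theorem emb_one {n : ℕ} : emb (1 : TMat ι n A) = 1 := by
  apply matrix_ext_sn
  intro i a j b
  simp only [emb_apply, Matrix.one_apply, sn_inj, ite_and]
  split_ifs <;> rfl

/-- The extension of scalars from `ℂ` to `A`. -/
def up (A : Type*) [Ring A] [Algebra ℂ A] {n : ℕ} : TMat ι n ℂ →ₐ[ℂ] TMat ι n A :=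
  (Algebra.ofId ℂ A).mapMatrix

theorem up_apply {n : ℕ} (X : TMat ι n ℂ) (i j : Fin n → ι) :
    up A X i j = algebraMap ℂ A (X i j) := rfl

theorem up_eq_map {n : ℕ} (X : TMat ι n ℂ) : X.map (algebraMap ℂ A) = up A X := rfl

theorem up_emb {n : ℕ} (X : TMat ι n ℂ) : up A (emb X) = emb (up A X) := by
  apply matrix_ext_sn
  intro i a j b
  simp only [emb_apply, up_apply]
  split_ifs <;> simp

omit [Fintype ι] in
theorem leg_succ {n : ℕ} (X : TMat ι 2 ℂ) (k : ℕ) (h : k + 1 < n) :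
    (leg X k (by omega) : TMat ι (n + 1) ℂ) = emb (leg X k h) := by
  rw [leg, leg, emb, place_place _ (Fin.castSucc_injective n)]
  congr 1
  funext a
  fin_cases a <;> rfl

omit [Fintype ι] in
theorem leg_last_apply {n : ℕ} (X : TMat ι 2 ℂ) (i j : Fin n → ι) (a b c d : ι) :
    (leg X n (by omega) : TMat ι (n + 2) ℂ) (sn (sn i a) b) (sn (sn j c) d) =
      if i = j then X ![a, b] ![c, d] else 0 := by
  have e1 : ∀ (i : Fin n → ι) (a b : ι),
      (fun l => sn (sn i a) b (adj n (by omega : n + 1 < n + 2) l)) = ![a, b] := by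
    intro i a b
    have h0 : (⟨n, by omega⟩ : Fin (n + 2)) = Fin.castSucc (Fin.last n) := rfl
    have h1 : (⟨n + 1, by omega⟩ : Fin (n + 2)) = Fin.last (n + 1) := rfl
    funext l
    fin_cases l
    · simp [adj, h0, sn]
    · simp [adj, h1, sn]
  simp only [leg, place, Matrix.of_apply, e1]
  congr 1
  rw [eq_iff_iff]
  constructor
  · intro h
    funext k
    have := h k.castSucc.castSucc (fun l => by
      have := k.isLt
      fin_cases l <;> simp [adj, Fin.ext_iff] <;> omega)
    simpa [sn] using this
  · rintro rfl k hk
    induction k using Fin.lastCases with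
    | last => exact absurd rfl (hk 1)
    | cast k =>
      induction k using Fin.lastCases with
      | last => exact absurd rfl (hk 0)
      | cast k => simp [sn]

theorem up_leg_last_apply {n : ℕ} (X : TMat ι 2 ℂ) (i j : Fin n → ι) (a b c d : ι) :
    up A (leg X n (by omega) : TMat ι (n + 2) ℂ) (sn (sn i a) b) (sn (sn j c) d) =
      if i = j then algebraMap ℂ A (X ![a, b] ![c, d]) else 0 := by
  rw [up_apply, leg_last_apply]
  split_ifs <;> simp

theorem leg_mul {n : ℕ} (X Y : TMat ι 2 ℂ) (k : ℕ) (h : k + 1 < n) :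
    (leg X k h : TMat ι n ℂ) * leg Y k h = leg (X * Y) k h :=
  (place_mul _ (adj_injective _ _) _ _).symm

omit [Fintype ι] in
theorem leg_one {n : ℕ} (k : ℕ) (h : k + 1 < n) :
    (leg (1 : TMat ι 2 ℂ) k h : TMat ι n ℂ) = 1 := place_one _

theorem leg_mul_inv {F : TMat ι 2 ℂ} (hF : IsUnit F) {n : ℕ} (k : ℕ) (h : k + 1 < n) :
    (leg F k h : TMat ι n ℂ) * leg F⁻¹ k h = 1 := by
  rw [leg_mul, Matrix.mul_nonsing_inv F ((Matrix.isUnit_iff_isUnit_det F).mp hF), leg_one]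

theorem leg_inv_mul {F : TMat ι 2 ℂ} (hF : IsUnit F) {n : ℕ} (k : ℕ) (h : k + 1 < n) :
    (leg F⁻¹ k h : TMat ι n ℂ) * leg F k h = 1 := by
  rw [leg_mul, Matrix.nonsing_inv_mul F ((Matrix.isUnit_iff_isUnit_det F).mp hF), leg_one]

theorem up_leg_last_commute {n : ℕ} (X : TMat ι 2 ℂ) (Z : TMat ι n A) :
    Commute (up A (leg X n (by omega) : TMat ι (n + 2) ℂ)) (emb (emb Z)) := by
  apply matrix_ext_sn
  intro i b j d
  obtain ⟨i, a, rfl⟩ := sn_surjective i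
  obtain ⟨j, c, rfl⟩ := sn_surjective j
  rw [Matrix.mul_apply, Matrix.mul_apply, sum_sn, sum_sn, sum_sn, sum_sn]
  simp only [emb_apply, up_leg_last_apply, ite_mul, mul_ite, zero_mul, mul_zero,
    Finset.sum_ite_eq, Finset.sum_ite_eq', Finset.mem_univ, if_true, Finset.sum_ite_irrel,
    Finset.sum_const_zero]
  exact Algebra.commutes _ _

/-- The partial trace over the last tensor factor, weighted by `D`. -/
def ptr (D : Matrix ι ι ℂ) {n : ℕ} (Z : TMat ι (n + 1) A) : TMat ι n A :=
  Matrix.of fun i j => ∑ a, ∑ b, D a b • Z (sn i b) (sn j a)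

theorem rTrace_ptr (R : TMat ι 2 ℂ) {n : ℕ} (Z : TMat ι (n + 1) A) :
    rTrace R (ptr (matD R) Z) = rTrace R Z := by
  simp only [rTrace, ptr, Matrix.of_apply, sum_sn (n := n), Finset.smul_sum]
  refine Finset.sum_congr rfl fun i _ => ?_
  rw [Finset.sum_comm]
  refine Finset.sum_congr rfl fun a _ => Finset.sum_congr rfl fun j _ =>
    Finset.sum_congr rfl fun b _ => ?_
  rw [Fin.prod_univ_castSucc, smul_smul]
  simp [sn]

theorem ptr_emb_mul (D : Matrix ι ι ℂ) {n : ℕ} (X : TMat ι n A) (Z : TMat ι (n + 1) A) :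
    ptr D (emb X * Z) = X * ptr D Z := by
  ext i j
  simp only [ptr, Matrix.of_apply, Matrix.mul_apply, sum_sn (n := n), emb_apply, ite_mul,
    zero_mul, Finset.sum_ite_eq, Finset.mem_univ, if_true, Finset.smul_sum, Finset.mul_sum,
    mul_smul_comm]
  simp only [← Fintype.sum_prod_type']
  exact Fintype.sum_equiv ⟨fun p => (p.2.2, p.1, p.2.1), fun p => (p.2.1, p.2.2, p.1),
    fun _ => rfl, fun _ => rfl⟩ _ _ fun p => rfl

theorem ptr_mul_emb (D : Matrix ι ι ℂ) {n : ℕ} (X : TMat ι n A) (Z : TMat ι (n + 1) A) :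
    ptr D (Z * emb X) = ptr D Z * X := by
  ext i j
  simp only [ptr, Matrix.of_apply, Matrix.mul_apply, sum_sn (n := n), emb_apply, mul_ite,
    mul_zero, Finset.sum_ite_eq', Finset.mem_univ, if_true, Finset.smul_sum, Finset.sum_mul,
    smul_mul_assoc]
  simp only [← Fintype.sum_prod_type']
  exact Fintype.sum_equiv ⟨fun p => (p.2.2, p.1, p.2.1), fun p => (p.2.1, p.2.2, p.1),
    fun _ => rfl, fun _ => rfl⟩ _ _ fun p => rfl

omit [DecidableEq ι] in
theorem sum_reorder_five {S : Type*} [AddCommMonoid S] (f : ι → ι → ι → ι → ι → S) :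
    ∑ a, ∑ b, ∑ c, ∑ d, ∑ e, f a b c d e = ∑ d, ∑ c, ∑ b, ∑ a, ∑ e, f a b c d e := by
  simp only [← Fintype.sum_prod_type']
  exact Fintype.sum_equiv
    ⟨fun p => (p.2.2.2.1, p.2.2.1, p.2.1, p.1, p.2.2.2.2),
      fun p => (p.2.2.2.1, p.2.2.1, p.2.1, p.1, p.2.2.2.2), fun _ => rfl, fun _ => rfl⟩
    _ _ fun p => rfl

omit [DecidableEq ι] in
theorem sum_reorder_six {S : Type*} [AddCommMonoid S] (f : ι → ι → ι → ι → ι → ι → S) :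
    ∑ a, ∑ b, ∑ a', ∑ b', ∑ x, ∑ y, f a b a' b' x y =
      ∑ x, ∑ y, ∑ b, ∑ b', ∑ a, ∑ a', f a b a' b' x y := by
  simp only [← Fintype.sum_prod_type']
  exact Fintype.sum_equiv
    ⟨fun p => (p.2.2.2.2.1, p.2.2.2.2.2, p.2.1, p.2.2.2.1, p.1, p.2.2.1),
      fun p => (p.2.2.2.2.1, p.2.2.1, p.2.2.2.2.2, p.2.2.2.1, p.1, p.2.1),
      fun _ => rfl, fun _ => rfl⟩ _ _ fun p => rfl

omit [DecidableEq ι] in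
theorem sum_reorder_six' {S : Type*} [AddCommMonoid S] (f : ι → ι → ι → ι → ι → ι → S) :
    ∑ a, ∑ b, ∑ a', ∑ b', ∑ x, ∑ y, f a b a' b' x y =
      ∑ a, ∑ a', ∑ x, ∑ y, ∑ b, ∑ b', f a b a' b' x y := by
  simp only [← Fintype.sum_prod_type']
  exact Fintype.sum_equiv
    ⟨fun p => (p.1, p.2.2.1, p.2.2.2.2.1, p.2.2.2.2.2, p.2.1, p.2.2.2.1),
      fun p => (p.1, p.2.2.2.2.1, p.2.1, p.2.2.2.2.2, p.2.2.1, p.2.2.2.1),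
      fun _ => rfl, fun _ => rfl⟩ _ _ fun p => rfl

/-- After the conjugation the last factor carries what the previous one carried, so tracing it out
leaves the earlier partial trace, now acting trivially on the remaining new strand. -/
theorem ptr_conj {R F : TMat ι 2 ℂ} (hR : SkewInvertible R) (hF : IsUnit F)
    (hRF : Compatible R F) {n : ℕ} (Z : TMat ι (n + 1) A) :
    ptr (matD R) (up A (leg F n (by omega)) * emb Z * up A (leg F⁻¹ n (by omega))) =
      emb (ptr (matD R) Z) := by
  apply matrix_ext_sn
  intro i w j v
  have e1 : ∀ b d : ι, (up A (leg F n (by omega)) * emb Z * up A (leg F⁻¹ n (by omega)) :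
      TMat ι (n + 2) A) (sn (sn i w) b) (sn (sn j v) d) = ∑ h, ∑ g, ∑ u,
        (F ![w, b] ![h, u] * F⁻¹ ![g, u] ![v, d]) • Z (sn i h) (sn j g) := by
    intro b d
    simp only [Matrix.mul_apply, sum_sn, emb_apply, up_leg_last_apply, ite_mul, mul_ite,
      zero_mul, mul_zero, Finset.sum_ite_eq, Finset.sum_ite_eq', Finset.mem_univ, if_true,
      Finset.sum_ite_irrel, Finset.sum_const_zero, Finset.sum_mul]
    simp only [← Fintype.sum_prod_type']
    refine Fintype.sum_equiv ⟨fun p => (p.2.2, p.1, p.2.1), fun p => (p.2.1, p.2.2, p.1),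
      fun _ => rfl, fun _ => rfl⟩ _ _ fun p => ?_
    simp only [Equiv.coe_fn_mk]
    rw [Algebra.smul_def, map_mul, mul_assoc, mul_assoc, Algebra.commutes (R := ℂ) (F⁻¹ _ _)]
  have e2 : (if w = v then ∑ a, ∑ b, matD R a b • Z (sn i b) (sn j a) else 0) =
      ∑ a, ∑ b, (if w = v then matD R a b else 0) • Z (sn i b) (sn j a) := by
    split_ifs <;> simp
  simp only [emb_apply, ptr, Matrix.of_apply, e1]
  rw [e2]
  simp only [← sum_matD_conj hR hF hRF.twist₂, Finset.sum_smul, Finset.smul_sum, smul_smul]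
  exact sum_reorder_five _

/-- Strands to the right of the operator are removed by partial traces; when it sits on the last
two, D_R ⊗ D_R commutes with it. -/
theorem rTrace_mul_up_leg_inv_comm {R : TMat ι 2 ℂ} (hR : SkewInvertible R) (hR' : IsRMatrix R)
    {n : ℕ} (Z : TMat ι n A) (k : ℕ) (h : k + 1 < n) :
    rTrace R (Z * up A (leg R⁻¹ k h)) = rTrace R (up A (leg R⁻¹ k h) * Z) := by
  induction n with
  | zero => omega
  | succ n ih =>
    rw [← rTrace_ptr, ← rTrace_ptr]
    by_cases hk : k + 1 < n
    · rw [leg_succ _ _ hk, up_emb, ptr_mul_emb, ptr_emb_mul, ih]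
    · obtain rfl : n = k + 1 := by omega
      rw [← rTrace_ptr, ← rTrace_ptr]
      congr 1
      ext i j
      have e1 : ∀ b d b' d', (Z * up A (leg R⁻¹ k h) : TMat ι (k + 2) A)
          (sn (sn i b) b') (sn (sn j d) d') =
          ∑ x, ∑ y, R⁻¹ ![x, y] ![d, d'] • Z (sn (sn i b) b') (sn (sn j x) y) := by
        intro b d b' d'
        simp only [Matrix.mul_apply, sum_sn, up_leg_last_apply, mul_ite, mul_zero]
        rw [Finset.sum_eq_single j (by simp +contextual) (by simp)]
        simp only [if_true, Algebra.smul_def, Algebra.commutes]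
      have e2 : ∀ b d b' d', (up A (leg R⁻¹ k h) * Z : TMat ι (k + 2) A)
          (sn (sn i b) b') (sn (sn j d) d') =
          ∑ x, ∑ y, R⁻¹ ![b, b'] ![x, y] • Z (sn (sn i x) y) (sn (sn j d) d') := by
        intro b d b' d'
        simp only [Matrix.mul_apply, sum_sn, up_leg_last_apply, ite_mul, zero_mul]
        rw [Finset.sum_eq_single i (by simp +contextual [eq_comm]) (by simp)]
        simp only [if_true, Algebra.smul_def]
      simp only [ptr, Matrix.of_apply, e1, e2]
      have e3 : ∑ a, ∑ b, matD R a b • ∑ a', ∑ b', matD R a' b' •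
          ∑ x, ∑ y, R⁻¹ ![x, y] ![a, a'] • Z (sn (sn i b) b') (sn (sn j x) y) =
          ∑ x, ∑ y, ∑ b, ∑ b', (∑ a, ∑ a', R⁻¹ ![x, y] ![a, a'] * (matD R a b * matD R a' b')) •
            Z (sn (sn i b) b') (sn (sn j x) y) := by
        simp only [Finset.sum_smul, Finset.smul_sum, smul_smul]
        rw [sum_reorder_six]
        simp only [mul_assoc, mul_comm]
      have e4 : ∑ a, ∑ b, matD R a b • ∑ a', ∑ b', matD R a' b' •
          ∑ x, ∑ y, R⁻¹ ![b, b'] ![x, y] • Z (sn (sn i x) y) (sn (sn j a) a') =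
          ∑ a, ∑ a', ∑ x, ∑ y, (∑ b, ∑ b', matD R a b * matD R a' b' * R⁻¹ ![b, b'] ![x, y]) •
            Z (sn (sn i x) y) (sn (sn j a) a') := by
        simp only [Finset.sum_smul, Finset.smul_sum, smul_smul]
        rw [sum_reorder_six']
        simp only [mul_assoc]
      rw [e3, e4]
      simp only [sum_matD_matD_comm hR hR']

theorem rTrace_mul_up_leg_comm {R : TMat ι 2 ℂ} (hR : SkewInvertible R) (hR' : IsRMatrix R)
    {n : ℕ} (Z : TMat ι n A) (k : ℕ) (h : k + 1 < n) :
    rTrace R (Z * up A (leg R k h)) = rTrace R (up A (leg R k h) * Z) := by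
  -- Cyclicity for R⁻¹, applied to R Z R, is cyclicity for R.
  have e := rTrace_mul_up_leg_inv_comm hR hR' (up A (leg R k h) * Z * up A (leg R k h)) k h
  rw [mul_assoc, ← map_mul, leg_mul_inv hR'.isUnit, map_one, mul_one, ← mul_assoc, ← mul_assoc,
    ← map_mul, leg_inv_mul hR'.isUnit, map_one, one_mul] at e
  exact e.symm

end Strands
end BMWQuantum

namespace BMWQuantum

/-! ### The shift of operators along `F`. -/

section Shift

variable {ι : Type*} [Fintype ι] [DecidableEq ι] {A : Type*} [Ring A] [Algebra ℂ A]

/-- The braid `F₁ F₂ ⋯ F_n` that moves the last of `n + 1` factors to the front. -/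
noncomputable def coxeter (F : TMat ι 2 ℂ) : (n : ℕ) → TMat ι (n + 1) ℂ
  | 0 => 1
  | n + 1 => emb (coxeter F n) * leg F n (by omega)

noncomputable def coxeterInv (F : TMat ι 2 ℂ) : (n : ℕ) → TMat ι (n + 1) ℂ
  | 0 => 1
  | n + 1 => leg F⁻¹ n (by omega) * emb (coxeterInv F n)

theorem coxeter_mul_coxeterInv {F : TMat ι 2 ℂ} (hF : IsUnit F) (n : ℕ) :
    coxeter F n * coxeterInv F n = 1 := by
  induction n with
  | zero => exact one_mul 1
  | succ n ih =>
    rw [coxeter, coxeterInv, mul_assoc, ← mul_assoc (leg F n _), leg_mul_inv hF, one_mul,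
      ← emb_mul, ih, emb_one]

theorem coxeterInv_mul_coxeter {F : TMat ι 2 ℂ} (hF : IsUnit F) (n : ℕ) :
    coxeterInv F n * coxeter F n = 1 := by
  induction n with
  | zero => exact one_mul 1
  | succ n ih =>
    rw [coxeter, coxeterInv, mul_assoc, ← mul_assoc (emb _), ← emb_mul, ih, emb_one, one_mul,
      leg_inv_mul hF]

/-- Operators on the first `n` tensor factors, as a homomorphism. -/
def embHom (n : ℕ) : TMat ι n ℂ →ₐ[ℂ] TMat ι (n + 1) ℂ :=
  placeHom Fin.castSucc (Fin.castSucc_injective n)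

theorem embHom_apply {n : ℕ} (X : TMat ι n ℂ) : embHom n X = emb X := rfl

/-- The algebra generated by the operators `R_k`. -/
def legAlg (R : TMat ι 2 ℂ) (n : ℕ) : Subalgebra ℂ (TMat ι n ℂ) :=
  Algebra.adjoin ℂ {X | ∃ (k : ℕ) (h : k + 1 < n), X = leg R k h}

theorem leg_mem_legAlg (R : TMat ι 2 ℂ) {n : ℕ} (k : ℕ) (h : k + 1 < n) :
    leg R k h ∈ legAlg R n := Algebra.subset_adjoin ⟨k, h, rfl⟩

theorem legAlg_induction (R : TMat ι 2 ℂ) {n : ℕ} (p : TMat ι n ℂ → Prop)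
    (hleg : ∀ k h, p (leg R k h)) (hsmul : ∀ c, p (algebraMap ℂ _ c))
    (hadd : ∀ X Y, p X → p Y → p (X + Y)) (hmul : ∀ X Y, p X → p Y → p (X * Y))
    (X : TMat ι n ℂ) (hX : X ∈ legAlg R n) : p X := by
  induction hX using Algebra.adjoin_induction with
  | mem X h =>
    obtain ⟨k, h, rfl⟩ := h
    exact hleg k h
  | algebraMap c => exact hsmul c
  | add X Y _ _ hX hY => exact hadd X Y hX hY
  | mul X Y _ _ hX hY => exact hmul X Y hX hY

theorem place_mem_legAlg (R : TMat ι 2 ℂ) {m n : ℕ} (f : Fin m → Fin n)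
    (hf : Function.Injective f) (hfR : ∀ k h, place f (leg R k h) ∈ legAlg R n)
    (X : TMat ι m ℂ) (hX : X ∈ legAlg R m) : place f X ∈ legAlg R n := by
  refine legAlg_induction R (fun X => place f X ∈ legAlg R n) hfR ?_ ?_ ?_ X hX
  · intro c
    rw [← placeHom_apply _ hf, AlgHom.commutes]
    exact Subalgebra.algebraMap_mem _ c
  · intro X Y hX hY
    rw [place_add]
    exact add_mem hX hY
  · intro X Y hX hY
    rw [place_mul _ hf]
    exact mul_mem hX hY

theorem emb_mem_legAlg (R : TMat ι 2 ℂ) {n : ℕ} (X : TMat ι n ℂ) (hX : X ∈ legAlg R n) :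
    emb X ∈ legAlg R (n + 1) := by
  refine place_mem_legAlg R _ (Fin.castSucc_injective n) (fun k h => ?_) X hX
  rw [← emb, ← leg_succ _ _ h]
  exact leg_mem_legAlg _ _ _

theorem coxeter_mem_legAlg (F : TMat ι 2 ℂ) (n : ℕ) : coxeter F n ∈ legAlg F (n + 1) := by
  induction n with
  | zero => exact one_mem _
  | succ n ih => exact mul_mem (emb_mem_legAlg F _ ih) (leg_mem_legAlg _ _ _)

/-- The shift of operators by one tensor factor along the braiding `F`. -/
noncomputable def shift (F : TMat ι 2 ℂ) {n : ℕ} (Z : TMat ι n A) : TMat ι (n + 1) A :=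
  up A (coxeter F n) * emb Z * up A (coxeterInv F n)

theorem shift_mul {F : TMat ι 2 ℂ} (hF : IsUnit F) {n : ℕ} (Y Z : TMat ι n A) :
    shift F (Y * Z) = shift F Y * shift F Z := by
  have h : up A (coxeterInv F n) * up A (coxeter F n) = 1 := by
    rw [← map_mul, coxeterInv_mul_coxeter hF, map_one]
  simp only [shift, emb_mul, mul_assoc]
  rw [← mul_assoc (up A (coxeterInv F n)), h, one_mul]

theorem shift_one {F : TMat ι 2 ℂ} (hF : IsUnit F) {n : ℕ} :
    shift F (1 : TMat ι n A) = 1 := by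
  rw [shift, emb_one, mul_one, ← map_mul, coxeter_mul_coxeterInv hF, map_one]

theorem shift_emb {F : TMat ι 2 ℂ} (hF : IsUnit F) {n : ℕ} (Z : TMat ι n A) :
    shift F (emb Z) = emb (shift F Z) := by
  have h := (up_leg_last_commute F Z).eq
  have h' : up A (leg F n (by omega) : TMat ι (n + 2) ℂ) * up A (leg F⁻¹ n (by omega)) = 1 := by
    rw [← map_mul, leg_mul_inv hF, map_one]
  simp only [shift, coxeter, coxeterInv, map_mul, up_emb, emb_mul, mul_assoc]
  congr 1
  rw [← mul_assoc (up A (leg F n _)), h, mul_assoc, ← mul_assoc (up A (leg F n _)), h', one_mul]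

theorem up_smul_comm {n : ℕ} (X : TMat ι n ℂ) (c : A) :
    up A X * Matrix.diagonal (fun _ => c) = Matrix.diagonal (fun _ => c) * up A X := by
  ext i j
  simp [up_apply, Algebra.commutes]

omit [Fintype ι] in
theorem emb_diagonal {n : ℕ} (c : A) :
    emb (Matrix.diagonal fun _ => c : TMat ι n A) = Matrix.diagonal fun _ => c := by
  apply matrix_ext_sn
  intro i a j b
  simp only [emb_apply, Matrix.diagonal_apply, sn_inj, ite_and]
  split_ifs <;> rfl

theorem shift_diagonal {F : TMat ι 2 ℂ} (hF : IsUnit F) {n : ℕ} (c : A) :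
    shift F (Matrix.diagonal fun _ => c : TMat ι n A) = Matrix.diagonal fun _ => c := by
  rw [shift, emb_diagonal, up_smul_comm, mul_assoc, ← map_mul, coxeter_mul_coxeterInv hF,
    map_one, mul_one]

/-- All braidings except the last pair avoid the traced strand and leave the trace; the last pair is
handled by `ptr_conj`. -/
theorem ptr_shift {R F : TMat ι 2 ℂ} (hR : SkewInvertible R) (hF : IsUnit F)
    (hRF : Compatible R F) {n : ℕ} (Z : TMat ι (n + 1) A) :
    ptr (matD R) (shift F Z) = shift F (ptr (matD R) Z) := by
  simp only [shift, coxeter, coxeterInv, map_mul, up_emb]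
  rw [← mul_assoc (_ * emb Z), ptr_mul_emb, mul_assoc (emb _), mul_assoc (emb _), ptr_emb_mul,
    ptr_conj hR hF hRF]

/-- The braid relation moving `X` through two copies of `F`. -/
theorem leg_twist₁ {X F : TMat ι 2 ℂ} (h : Compatible X F) (n k : ℕ) (hk : k + 2 < n) :
    (leg X k (by omega) * leg F (k + 1) hk * leg F k (by omega) : TMat ι n ℂ) =
      leg F (k + 1) hk * leg F k (by omega) * leg X (k + 1) hk := by
  rw [leg_eq_place_left X k hk, leg_eq_place_right F k hk, leg_eq_place_left F k hk,
    leg_eq_place_right X k hk]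
  simp only [← place_mul _ (triple_injective k hk)]
  rw [h.twist₁]

theorem leg_twist₂ {X F : TMat ι 2 ℂ} (h : Compatible X F) (n k : ℕ) (hk : k + 2 < n) :
    (leg X (k + 1) hk * leg F k (by omega) * leg F (k + 1) hk : TMat ι n ℂ) =
      leg F k (by omega) * leg F (k + 1) hk * leg X k (by omega) := by
  rw [leg_eq_place_left X k hk, leg_eq_place_right F k hk, leg_eq_place_left F k hk,
    leg_eq_place_right X k hk]
  simp only [← place_mul _ (triple_injective k hk)]
  rw [h.twist₂]

theorem IsRMatrix.compatible_self {F : TMat ι 2 ℂ} (hF : IsRMatrix F) : Compatible F F :=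
  ⟨hF.yangBaxter, hF.yangBaxter.symm⟩

/-- Unless `X` sits on the last two old strands, the shift can be computed with one strand fewer. In
the last position the twist relation moves `X` through two copies of `F`, and the remaining ones act
on disjoint strands. -/
theorem shift_up_leg {X F : TMat ι 2 ℂ} (hF : IsUnit F) (hXF : Compatible X F) {n : ℕ} (k : ℕ)
    (h : k + 1 < n) :
    shift F (up A (leg X k h : TMat ι n ℂ)) = up A (leg X (k + 1) (by omega)) := by
  induction n with
  | zero => omega
  | succ n ih =>
    by_cases hk : k + 1 < n
    · rw [leg_succ _ _ hk, up_emb, shift_emb hF, ih hk, ← up_emb]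
      exact congrArg (up A) (leg_succ X (k + 1) (by omega)).symm
    · obtain rfl : n = k + 1 := by omega
      have e1 : (leg F k (by omega) : TMat ι (k + 3) ℂ) = emb (leg F k (by omega)) :=
        leg_succ _ _ (by omega)
      have e2 : (leg X k (by omega) : TMat ι (k + 3) ℂ) = emb (leg X k (by omega)) :=
        leg_succ _ _ (by omega)
      have h1 := leg_twist₂ hXF (k + 3) k (by omega)
      have h2 : (emb (emb (coxeter F k)) : TMat ι (k + 3) ℂ) * leg X (k + 1) (by omega) =
          leg X (k + 1) (by omega) * emb (emb (coxeter F k)) :=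
        (up_leg_last_commute (A := ℂ) X (coxeter F k)).symm.eq
      have h3 : coxeter F (k + 2) * emb (leg X k (by omega)) =
          leg X (k + 1) (by omega) * coxeter F (k + 2) := by
        rw [coxeter, coxeter, emb_mul, ← e1, ← e2, mul_assoc, mul_assoc, ← mul_assoc (leg F k _),
          ← h1, ← mul_assoc, ← mul_assoc, h2]
        simp only [mul_assoc]
      rw [shift, ← up_emb, ← map_mul, ← map_mul, h3, mul_assoc, coxeter_mul_coxeterInv hF, mul_one]

end Shift

/-! ### Commutation of `R_k` with the matrix copies. -/

section Copies

variable {ι : Type*} [Fintype ι] [DecidableEq ι] {A : Type*} [Ring A] [Algebra ℂ A]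
  (F : TMat ι 2 ℂ) (M : Matrix ι ι A)

omit [Fintype ι] in
theorem place_comp {S : Type*} [Zero S] {p m n : ℕ} (f : Fin m → Fin n)
    (hf : Function.Injective f) (g : Fin p → Fin m) (X : TMat ι p S) :
    place f (place g X) = place (f ∘ g) X := by
  ext i j
  simp only [place, Matrix.of_apply, Function.comp]
  rw [← ite_and]
  congr 1
  rw [eq_iff_iff]
  constructor
  · rintro ⟨h1, h2⟩ k hk
    by_cases hk' : ∀ l, f l ≠ k
    · exact h1 k hk'
    · push Not at hk'
      obtain ⟨l, rfl⟩ := hk'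
      exact h2 l fun a ha => hk a (by rw [ha])
  · intro h
    refine ⟨fun k hk => h k fun l => hk _, fun k hk => h _ fun l hl => hk l (hf hl)⟩

theorem matCopy_zero (n : ℕ) (h : 0 < n) :
    matCopy F M (n + 1) 0 (by omega) = emb (matCopy F M n 0 h) := by
  rw [matCopy, matCopy, emb, place_comp _ (Fin.castSucc_injective n)]
  congr 1
  funext a
  fin_cases a
  rfl

theorem matCopy_succ (n k : ℕ) (h : k + 1 < n) :
    matCopy F M n (k + 1) h = up A (leg F k h) * matCopy F M n k (by omega) *
      up A (leg F⁻¹ k h) := by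
  rw [matCopy]; rfl

theorem matCopy_emb (n k : ℕ) (h : k < n) :
    matCopy F M (n + 1) k (by omega) = emb (matCopy F M n k h) := by
  induction k with
  | zero => exact matCopy_zero F M n h
  | succ k ih =>
    rw [matCopy_succ, matCopy_succ, ih (by omega), leg_succ _ _ h, leg_succ _ _ h, up_emb, up_emb,
      emb_mul, emb_mul]

theorem matCopies_succ (n : ℕ) :
    matCopies F M (n + 1) = emb (matCopies F M n) * matCopy F M (n + 1) n (by omega) := by
  have h : ∀ l : List (TMat ι n A), emb l.prod = (l.map emb).prod := by
    intro l
    induction l with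
    | nil => exact emb_one
    | cons a l ih => rw [List.prod_cons, emb_mul, ih, List.map_cons, List.prod_cons]
  rw [matCopies, List.ofFn_succ', List.concat_eq_append, List.prod_append, List.prod_singleton,
    matCopies, h, List.map_ofFn]
  congr 3
  funext k
  exact matCopy_emb F M n k k.isLt

variable {F}

theorem up_leg_commute_matCopy_of_lt (X : TMat ι 2 ℂ) (n k j : ℕ) (h : j + 1 < n) (hk : k < j) :
    Commute (up A (leg X j h)) (matCopy F M n k (by omega)) := by
  induction n with
  | zero => omega
  | succ n ih =>
    by_cases hj : j + 1 < n
    · rw [leg_succ _ _ hj, matCopy_emb _ _ _ _ (by omega), up_emb, commute_iff_eq, ← emb_mul,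
        ← emb_mul, (ih hj).eq]
    · obtain rfl : n = j + 1 := by omega
      rw [matCopy_emb _ _ _ _ (by omega), matCopy_emb _ _ _ _ hk]
      exact up_leg_last_commute _ _

/-- In the critical case the copy is F_{j+1}F_j M_{\overline j} F_j⁻¹F_{j+1}⁻¹. The twist relation
carries X_j through the two braidings as X_{j+1}, which acts away from M_{\overline j}. -/
theorem up_leg_commute_matCopy_of_gt {X : TMat ι 2 ℂ} (hF : IsUnit F) (hXF : Compatible X F)
    (n k j : ℕ) (h : k < n) (hk : j + 1 < k) :
    Commute (up A (leg X j (by omega))) (matCopy F M n k h) := by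
  induction k with
  | zero => omega
  | succ k ih =>
    rw [matCopy_succ]
    have hu : Commute (up A (leg F k h)) (up A (leg F⁻¹ k h)) := by
      rw [commute_iff_eq, ← map_mul, ← map_mul, leg_mul_inv hF, leg_inv_mul hF]
    by_cases hk' : j + 1 < k
    · refine ((Commute.map (f := up A) ?_).mul_right (ih (by omega) hk')).mul_right
        (Commute.map (f := up A) ?_)
      · exact leg_comm _ _ _ _ _ _ _ hk'
      · exact leg_comm _ _ _ _ _ _ _ hk'
    · obtain rfl : k = j + 1 := by omega
      rw [matCopy_succ]
      have h1 := congrArg (up A) (leg_twist₁ hXF n j h)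
      simp only [map_mul] at h1
      have i1 : up A (leg F (j + 1) h) * up A (leg F⁻¹ (j + 1) h) = 1 := by
        rw [← map_mul, leg_mul_inv hF, map_one]
      have i2 : up A (leg F j (by omega) : TMat ι n ℂ) * up A (leg F⁻¹ j (by omega)) = 1 := by
        rw [← map_mul, leg_mul_inv hF, map_one]
      have i3 : up A (leg F⁻¹ (j + 1) h) * up A (leg F (j + 1) h) = 1 := by
        rw [← map_mul, leg_inv_mul hF, map_one]
      have i4 : up A (leg F⁻¹ j (by omega) : TMat ι n ℂ) * up A (leg F j (by omega)) = 1 := by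
        rw [← map_mul, leg_inv_mul hF, map_one]
      have h2 := (up_leg_commute_matCopy_of_lt (F := F) M X n j (j + 1) h (by omega)).eq
      rw [commute_iff_eq]
      generalize up A (leg F (j + 1) h) = f1 at *
      generalize up A (leg F⁻¹ (j + 1) h) = g1 at *
      generalize (up A (leg F j (by omega) : TMat ι n ℂ)) = f0 at *
      generalize (up A (leg F⁻¹ j (by omega) : TMat ι n ℂ)) = g0 at *
      generalize (up A (leg X j (by omega) : TMat ι n ℂ)) = x0 at *
      generalize (up A (leg X (j + 1) h : TMat ι n ℂ)) = x1 at *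
      generalize matCopy F M n j (by omega) = m at *
      have h3 : g0 * g1 * x0 = x1 * (g0 * g1) :=
        calc g0 * g1 * x0 = g0 * g1 * x0 * (f1 * (f0 * g0) * g1) := by
              rw [i2, mul_one, i1, mul_one]
          _ = g0 * g1 * (x0 * f1 * f0) * (g0 * g1) := by simp only [mul_assoc]
          _ = g0 * (g1 * f1) * f0 * x1 * (g0 * g1) := by rw [h1]; simp only [mul_assoc]
          _ = _ := by rw [i3, mul_one, i4, one_mul]
      calc x0 * (f1 * (f0 * m * g0) * g1) = x0 * f1 * f0 * m * (g0 * g1) := by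
            simp only [mul_assoc]
        _ = f1 * f0 * (x1 * m) * (g0 * g1) := by rw [h1]; simp only [mul_assoc]
        _ = f1 * f0 * m * (x1 * (g0 * g1)) := by rw [h2]; simp only [mul_assoc]
        _ = _ := by rw [← h3]; simp only [mul_assoc]

/-- For the last copy, the innermost braiding produces the next copy by definition, and the earlier
braidings commute with it and cancel. -/
theorem shift_matCopy (hF : IsRMatrix F) (n k : ℕ) (h : k < n) :
    shift F (matCopy F M n k h) = matCopy F M (n + 1) (k + 1) (by omega) := by
  induction n with
  | zero => omega
  | succ n ih =>
    by_cases hk : k < n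
    · rw [matCopy_emb _ _ _ _ hk, shift_emb hF.isUnit, ih hk, ← matCopy_emb]
    · obtain rfl : k = n := by omega
      have h1 : Commute (up A (emb (coxeter F k))) (matCopy F M (k + 2) (k + 1) (by omega)) := by
        refine legAlg_induction F (fun X => Commute (up A (emb X)) _) ?_ ?_ ?_ ?_ _
          (coxeter_mem_legAlg F k)
        · intro i hi
          rw [← leg_succ _ _ hi]
          exact up_leg_commute_matCopy_of_gt M hF.isUnit hF.compatible_self _ _ _ _ hi
        · intro c
          rw [← embHom_apply, AlgHom.commutes, AlgHom.commutes]
          exact Algebra.commute_algebraMap_left c _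
        · intro X Y hX hY
          rw [← embHom_apply, map_add, map_add]
          exact hX.add_left hY
        · intro X Y hX hY
          rw [emb_mul, map_mul]
          exact hX.mul_left hY
      rw [shift, coxeter, coxeterInv, map_mul, map_mul, ← matCopy_emb]
      rw [mul_assoc, mul_assoc, ← mul_assoc (matCopy _ _ _ _ _), ← mul_assoc (up A (leg F k _)),
        ← mul_assoc (up A (leg F k _)), ← matCopy_succ, ← mul_assoc, h1.eq, mul_assoc, ← map_mul,
        ← emb_mul, coxeter_mul_coxeterInv hF.isUnit, emb_one, map_one, mul_one]

/-- The first two copies satisfy the defining relation; every later neighbouring pair is a shift of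
an earlier one. -/
theorem up_leg_commute_matCopies_two {R : TMat ι 2 ℂ} (hF : IsRMatrix F) (hRF : Compatible R F)
    (hM : Commute (up A R) (matCopies F M 2)) (n k : ℕ) (h : k + 1 < n) :
    Commute (up A (leg R k h)) (matCopy F M n k (by omega) * matCopy F M n (k + 1) h) := by
  induction n generalizing k with
  | zero => omega
  | succ n ih =>
    by_cases hk : k + 1 < n
    · rw [leg_succ _ _ hk, matCopy_emb _ _ _ _ hk, matCopy_emb _ _ _ _ (by omega), up_emb,
        commute_iff_eq, ← emb_mul, ← emb_mul, ← emb_mul, (ih k hk).eq]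
    · obtain rfl : n = k + 1 := by omega
      cases k with
      | zero =>
        have h1 : (leg R 0 h : TMat ι 2 ℂ) = R := by
          ext i j
          simp only [leg, place, Matrix.of_apply]
          rw [if_pos]
          · congr 1 <;> funext l <;> fin_cases l <;> rfl
          · intro k hk
            fin_cases k
            · exact absurd rfl (hk 0)
            · exact absurd rfl (hk 1)
        rw [h1]
        convert hM using 1
        have h2 : matCopies F M 1 = matCopy F M 1 0 (by omega) := by
          simp [matCopies]
        rw [matCopies_succ, h2, ← matCopy_emb]
      | succ k =>
        rw [← shift_matCopy M hF _ _ (by omega), ← shift_matCopy M hF _ _ (by omega),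
          ← shift_up_leg hF.isUnit hRF _ (by omega), commute_iff_eq, ← shift_mul hF.isUnit,
          ← shift_mul hF.isUnit, ← shift_mul hF.isUnit, (ih k (by omega)).eq]

theorem up_leg_commute_matCopies {R : TMat ι 2 ℂ} (hF : IsRMatrix F) (hRF : Compatible R F)
    (hM : Commute (up A R) (matCopies F M 2)) (n k : ℕ) (h : k + 1 < n) :
    Commute (up A (leg R k h)) (matCopies F M n) := by
  induction n with
  | zero => omega
  | succ n ih =>
    rw [matCopies_succ]
    by_cases hk : k + 1 < n
    · refine Commute.mul_right ?_ (up_leg_commute_matCopy_of_gt M hF.isUnit hRF _ _ _ _ hk)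
      rw [leg_succ _ _ hk, up_emb, commute_iff_eq, ← emb_mul, (ih hk).eq, emb_mul]
    · obtain rfl : n = k + 1 := by omega
      rw [matCopies_succ, emb_mul, mul_assoc]
      refine Commute.mul_right (up_leg_last_commute _ _) ?_
      rw [← matCopy_emb]
      exact up_leg_commute_matCopies_two M hF hRF hM _ _ _

end Copies

end BMWQuantum

namespace BMWQuantum

/-! ### Multiplicativity and cyclicity of the characteristic map. -/

section Character

variable {ι : Type*} [Fintype ι] [DecidableEq ι] {A : Type*} [Ring A] [Algebra ℂ A]

/-- The quantum trace of `M_{\overline 1} ⋯ M_{\overline n} X`. -/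
noncomputable def chOp (R F : TMat ι 2 ℂ) (M : Matrix ι ι A) {n : ℕ} (X : TMat ι n ℂ) : A :=
  rTrace R (matCopies F M n * up A X)

/-- `W` is obtained from `Z` by iterated partial traces over the last factors. -/
inductive IterPtr (D : Matrix ι ι ℂ) : (n m : ℕ) → TMat ι n A → TMat ι m A → Prop
  | refl {n : ℕ} (Z : TMat ι n A) : IterPtr D n n Z Z
  | step {n m : ℕ} {Z : TMat ι (n + 1) A} {W : TMat ι m A} :
      IterPtr D n m (ptr D Z) W → IterPtr D (n + 1) m Z W

theorem IterPtr.le {D : Matrix ι ι ℂ} {n m : ℕ} {Z : TMat ι n A} {W : TMat ι m A}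
    (h : IterPtr D n m Z W) : m ≤ n := by
  induction h with
  | refl => exact le_rfl
  | step _ ih => omega

theorem IterPtr.shift {R F : TMat ι 2 ℂ} (hR : SkewInvertible R) (hF : IsUnit F)
    (hRF : Compatible R F) {n m : ℕ} {Z : TMat ι n A} {W : TMat ι m A}
    (h : IterPtr (matD R) n m Z W) :
    IterPtr (matD R) (n + 1) (m + 1) (shift F Z) (shift F W) := by
  induction h with
  | refl Z => exact .refl _
  | step _ ih =>
    rw [← ptr_shift hR hF hRF] at ih
    exact .step ih

theorem iterPtr_zero (R : TMat ι 2 ℂ) {n : ℕ} (Z : TMat ι n A) :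
    IterPtr (matD R) n 0 Z (Matrix.diagonal fun _ => rTrace R Z) := by
  induction n with
  | zero =>
    have : Z = Matrix.diagonal fun _ => rTrace R Z := by
      ext i j
      obtain rfl := Subsingleton.elim i default
      obtain rfl := Subsingleton.elim j default
      simp [rTrace]
    rw [← this]
    exact .refl Z
  | succ n ih =>
    rw [← rTrace_ptr]
    exact .step (ih _)

omit [Fintype ι] in
theorem place_id {S : Type*} [Zero S] {n : ℕ} (f : Fin n → Fin n) (hf : ∀ i, f i = i)
    (X : TMat ι n S) : place f X = X := by
  obtain rfl : f = id := funext hf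
  ext i j
  simp only [place, Matrix.of_apply, id]
  rw [if_pos]
  intro k hk
  exact absurd rfl (hk k)

omit [Fintype ι] in
theorem place_castLE_self {S : Type*} [Zero S] {n : ℕ} (h : n ≤ n) (X : TMat ι n S) :
    place (Fin.castLE h) X = X := place_id _ (fun _ => rfl) X

omit [Fintype ι] [Algebra ℂ A] in
theorem emb_place {m n : ℕ} (f : Fin m → Fin n) (X : TMat ι m A) :
    emb (place f X) = place (Fin.castSucc ∘ f) X :=
  place_comp _ (Fin.castSucc_injective n) _ _

omit [Fintype ι] in
theorem place_castLE_succ {m n : ℕ} (h : m ≤ n) (X : TMat ι m A) :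
    place (Fin.castLE (h.trans n.le_succ)) X = emb (place (Fin.castLE h) X) := by
  rw [emb_place]; rfl

theorem place_castLE_mul {m n : ℕ} (h : m ≤ n) (X Y : TMat ι m A) :
    place (Fin.castLE h) (X * Y) = place (Fin.castLE h) X * place (Fin.castLE h) Y := by
  induction n, h using Nat.le_induction with
  | base => simp only [place_castLE_self]
  | succ n h ih =>
    rw [place_castLE_succ h, place_castLE_succ h, place_castLE_succ h, ← emb_mul, ih]

theorem up_place {m n : ℕ} (f : Fin m → Fin n) (X : TMat ι m ℂ) :
    up A (place f X) = place f (up A X) := by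
  ext i j
  simp only [up_apply, place, Matrix.of_apply]
  split_ifs <;> simp

theorem IterPtr.rTrace_mul {R : TMat ι 2 ℂ} {n m : ℕ} {Z : TMat ι n A} {W : TMat ι m A}
    (h : IterPtr (matD R) n m Z W) (X : TMat ι m A) :
    rTrace R (place (Fin.castLE h.le) X * Z) = rTrace R (X * W) := by
  induction h with
  | refl Z => rw [place_castLE_self]
  | step h ih => rw [place_castLE_succ h.le, ← rTrace_ptr, ptr_emb_mul, ih]

omit [Fintype ι] in
theorem place_succ_leg (X : TMat ι 2 ℂ) {n : ℕ} (k : ℕ) (h : k + 1 < n) :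
    place Fin.succ (leg X k h : TMat ι n ℂ) = leg X (k + 1) (by omega) := by
  rw [leg, place_comp _ (Fin.succ_injective n), leg]
  congr 1
  funext a
  fin_cases a <;> rfl

theorem shift_up {R F : TMat ι 2 ℂ} (hF : IsUnit F) (hRF : Compatible R F) {n : ℕ}
    (X : TMat ι n ℂ) (hX : X ∈ legAlg R n) :
    shift F (up A X) = up A (place Fin.succ X) := by
  refine legAlg_induction R (fun X => shift F (up A X) = up A (place Fin.succ X)) ?_ ?_ ?_ ?_ X hX
  · intro k h
    rw [shift_up_leg hF hRF, place_succ_leg]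
  · intro c
    rw [← placeHom_apply _ (Fin.succ_injective n), AlgHom.commutes, AlgHom.commutes,
      AlgHom.commutes]
    have : ∀ n, algebraMap ℂ (TMat ι n A) c = Matrix.diagonal fun _ => algebraMap ℂ A c := by
      intro n; rw [Matrix.algebraMap_eq_diagonal]; rfl
    rw [this, shift_diagonal hF, this]
  · intro X Y hX hY
    rw [place_add, map_add, map_add, ← hX, ← hY, shift, emb_add, mul_add, add_mul]; rfl
  · intro X Y hX hY
    rw [place_mul _ (Fin.succ_injective n), map_mul, map_mul, ← hX, ← hY, shift_mul hF]

/-- The product `M_{\overline{m+1}} ⋯ M_{\overline{m+k}}`. -/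
noncomputable def tailCopies (F : TMat ι 2 ℂ) (M : Matrix ι ι A) (n m k : ℕ) (h : m + k ≤ n) :
    TMat ι n A :=
  (List.ofFn fun j : Fin k => matCopy F M n (m + j) (by omega)).prod

theorem shift_list_prod {F : TMat ι 2 ℂ} (hF : IsUnit F) {n : ℕ} (l : List (TMat ι n A)) :
    shift F l.prod = (l.map (shift F)).prod := by
  induction l with
  | nil => exact shift_one hF
  | cons a l ih => rw [List.prod_cons, shift_mul hF, ih, List.map_cons, List.prod_cons]

theorem emb_list_prod {n : ℕ} (l : List (TMat ι n A)) : emb l.prod = (l.map emb).prod := by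
  induction l with
  | nil => exact emb_one
  | cons a l ih => rw [List.prod_cons, emb_mul, ih, List.map_cons, List.prod_cons]

theorem shift_tailCopies {F : TMat ι 2 ℂ} (hF : IsRMatrix F) (M : Matrix ι ι A) (n m k : ℕ)
    (h : m + k ≤ n) :
    shift F (tailCopies F M n m k h) = tailCopies F M (n + 1) (m + 1) k (by omega) := by
  rw [tailCopies, shift_list_prod hF.isUnit, List.map_ofFn, tailCopies]
  congr 2
  funext j
  simp only [Function.comp]
  rw [shift_matCopy M hF]
  congr 1
  omega

theorem matCopies_eq_mul_tailCopies (F : TMat ι 2 ℂ) (M : Matrix ι ι A) (m k : ℕ) :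
    matCopies F M (m + k) = place (Fin.castLE (Nat.le_add_right m k)) (matCopies F M m) *
      tailCopies F M (m + k) m k le_rfl := by
  induction k with
  | zero =>
    refine Eq.trans ?_ (congrArg (· * _) (place_castLE_self le_rfl (matCopies F M m)).symm)
    simp [tailCopies]
  | succ k ih =>
    change matCopies F M (m + k + 1) = _
    rw [matCopies_succ, ih, emb_mul, ← place_castLE_succ, mul_assoc]
    congr 1
    rw [tailCopies, tailCopies, List.ofFn_succ', List.concat_eq_append, List.prod_append,
      List.prod_singleton, emb_list_prod, List.map_ofFn]
    congr 3
    funext j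
    exact (matCopy_emb F M (m + k) (m + j) (by omega)).symm

/-- For m = 0 this is the full trace. The shift commutes with partial traces and fixes scalar
matrices, so raising m preserves the result. -/
theorem iterPtr_tailCopies {R F : TMat ι 2 ℂ} (hR : SkewInvertible R) (hF : IsRMatrix F)
    (hRF : Compatible R F) (M : Matrix ι ι A) {k : ℕ} (Y : TMat ι k ℂ) (hY : Y ∈ legAlg R k)
    (m n : ℕ) (h : m + k = n) :
    IterPtr (matD R) n m
      (tailCopies F M n m k h.le *
        up A (place (fun i : Fin k => (⟨m + i, by omega⟩ : Fin n)) Y))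
      (Matrix.diagonal fun _ => chOp R F M Y) := by
  -- Membership in `legAlg` is carried through the induction because `shift_up` needs it at every
  -- step.
  suffices hh : place (fun i : Fin k => (⟨m + i, by omega⟩ : Fin n)) Y ∈ legAlg R n ∧
      IterPtr (matD R) n m
      (tailCopies F M n m k h.le *
        up A (place (fun i : Fin k => (⟨m + i, by omega⟩ : Fin n)) Y))
      (Matrix.diagonal fun _ => chOp R F M Y) from hh.2
  induction m generalizing n with
  | zero =>
    obtain rfl : k = n := by omega
    rw [place_id _ (fun i => Fin.ext (Nat.zero_add _))]
    refine ⟨hY, ?_⟩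
    have : tailCopies F M k 0 k h.le = matCopies F M k := by
      simp only [tailCopies, matCopies]
      congr 2
      funext j
      congr 1
      omega
    rw [this]
    exact iterPtr_zero R _
  | succ m ih =>
    obtain ⟨n, rfl⟩ : ∃ n', n = n' + 1 := ⟨n - 1, by omega⟩
    obtain ⟨h1, h2⟩ := ih n (by omega)
    have h3 := h2.shift hR hF.isUnit hRF
    have h4 : place (fun i : Fin k => (⟨m + 1 + i, by omega⟩ : Fin (n + 1))) Y =
        place Fin.succ (place (fun i : Fin k => (⟨m + i, by omega⟩ : Fin n)) Y) := by
      rw [place_comp _ (Fin.succ_injective n)]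
      congr 1
      funext i
      ext
      simp only [Function.comp, Fin.val_succ]
      omega
    rw [shift_mul hF.isUnit, shift_up hF.isUnit hRF _ h1, shift_tailCopies hF,
      shift_diagonal hF.isUnit, ← h4] at h3
    refine ⟨?_, h3⟩
    rw [h4]
    refine place_mem_legAlg R _ (Fin.succ_injective n) (fun k h => ?_) _ h1
    rw [place_succ_leg]
    exact leg_mem_legAlg _ _ _

/-- The operator `X` commutes with the later copies, so the copies and operators of the two blocks
separate; tracing out the second block leaves a scalar matrix. -/
theorem chOp_mul {R F : TMat ι 2 ℂ} (hR : SkewInvertible R) (hF : IsRMatrix F)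
    (hRF : Compatible R F) (M : Matrix ι ι A) {m k n : ℕ} (h : m + k = n) (X : TMat ι m ℂ)
    (hX : X ∈ legAlg R m) (Y : TMat ι k ℂ) (hY : Y ∈ legAlg R k) :
    chOp R F M (place (Fin.castLE (by omega : m ≤ n)) X *
      place (fun i : Fin k => (⟨m + i, by omega⟩ : Fin n)) Y) =
      chOp R F M X * chOp R F M Y := by
  subst h
  have h1 := (iterPtr_tailCopies hR hF hRF M Y hY m _ rfl).rTrace_mul (matCopies F M m * up A X)
  have h2 : Commute (up A (place (Fin.castLE (Nat.le_add_right m k)) X))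
      (tailCopies F M (m + k) m k le_rfl) := by
    refine legAlg_induction R (fun X => Commute (up A (place (Fin.castLE (by omega)) X))
      (tailCopies F M (m + k) m k le_rfl)) ?_ ?_ ?_ ?_ X hX
    · intro j hj
      have h3 : (place (Fin.castLE (Nat.le_add_right m k)) (leg R j hj) : TMat ι (m + k) ℂ) =
          leg R j (by omega) := by
        rw [leg, place_comp _ (Fin.castLE_injective _), leg]
        congr 1
        funext a
        fin_cases a <;> rfl
      rw [h3, tailCopies]
      refine Commute.list_prod_right _ _ fun Z hZ => ?_
      obtain ⟨i, rfl⟩ := List.mem_ofFn.mp hZ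
      exact up_leg_commute_matCopy_of_gt M hF.isUnit hRF _ _ _ _ (by omega)
    · intro c
      rw [← placeHom_apply _ (Fin.castLE_injective _), AlgHom.commutes, AlgHom.commutes]
      exact Algebra.commute_algebraMap_left c _
    · intro X Y hX hY
      rw [place_add, map_add]
      exact hX.add_left hY
    · intro X Y hX hY
      rw [place_mul _ (Fin.castLE_injective _), map_mul]
      exact hX.mul_left hY
  rw [chOp, matCopies_eq_mul_tailCopies, map_mul, mul_assoc, ← mul_assoc (tailCopies _ _ _ _ _ _),
    ← h2.eq, mul_assoc, ← mul_assoc, up_place, ← place_castLE_mul, h1]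
  simp only [chOp, rTrace, Matrix.mul_diagonal, ← smul_mul_assoc, ← Finset.sum_mul]

/-- On generators: R_k commutes with the product of the copies and is cyclic under the R-trace. -/
theorem chOp_mul_comm {R F : TMat ι 2 ℂ} (hR : SkewInvertible R) (hR' : IsRMatrix R)
    (hF : IsRMatrix F) (hRF : Compatible R F) (M : Matrix ι ι A)
    (hM : Commute (up A R) (matCopies F M 2)) {n : ℕ} (X : TMat ι n ℂ) (hX : X ∈ legAlg R n)
    (Y : TMat ι n ℂ) : chOp R F M (X * Y) = chOp R F M (Y * X) := by
  refine legAlg_induction R (fun X => ∀ Y, chOp R F M (X * Y) = chOp R F M (Y * X))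
    ?_ ?_ ?_ ?_ X hX Y
  · intro k h Y
    rw [chOp, map_mul, ← mul_assoc, ← (up_leg_commute_matCopies M hF hRF hM n k h).eq, mul_assoc,
      ← rTrace_mul_up_leg_comm hR hR', mul_assoc, ← map_mul, ← chOp]
  · intro c Y
    rw [Algebra.commutes]
  · intro X X' h h' Y
    have hadd : ∀ X Y : TMat ι n ℂ, chOp R F M (X + Y) = chOp R F M X + chOp R F M Y := by
      intro X Y
      simp only [chOp, rTrace, map_add, mul_add, Matrix.add_apply, smul_add,
        Finset.sum_add_distrib]
    rw [add_mul, mul_add, hadd, hadd, h, h']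
  · intro X X' h h' Y
    rw [mul_assoc, h, mul_assoc, h', mul_assoc]

end Character

/-! ### The full twist and commutativity of characteristic elements. -/

section FullTwist

variable {ι : Type*} [Fintype ι] [DecidableEq ι]

theorem up_self {n : ℕ} (X : TMat ι n ℂ) : up ℂ X = X := rfl

theorem coxeter_mul_emb {R : TMat ι 2 ℂ} (hR : IsRMatrix R) {n : ℕ}
    (X : TMat ι n ℂ) (hX : X ∈ legAlg R n) :
    coxeter R n * emb X = place Fin.succ X * coxeter R n := by
  have h := shift_up (A := ℂ) hR.isUnit hR.compatible_self X hX
  rw [shift] at h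
  simp only [up_self] at h
  rw [← h, mul_assoc, coxeterInv_mul_coxeter hR.isUnit, mul_one]

theorem coxeter_succ' (R : TMat ι 2 ℂ) (n : ℕ) :
    coxeter R (n + 1) = leg R 0 (by omega) * place Fin.succ (coxeter R n) := by
  induction n with
  | zero =>
    simp only [coxeter, emb_one, one_mul, place_one, mul_one]
  | succ n ih =>
    conv_lhs => rw [coxeter, ih]
    rw [coxeter, place_mul _ (Fin.succ_injective _), place_succ_leg, emb_mul, ← leg_succ,
      mul_assoc]
    congr 2
    rw [emb_place, emb, place_comp _ (Fin.succ_injective _)]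
    rfl

theorem coxeter_mul_leg {R : TMat ι 2 ℂ} (hR : IsRMatrix R) {n : ℕ} (k : ℕ) (h : k + 1 < n) :
    coxeter R n * leg R k (by omega) = leg R (k + 1) (by omega) * coxeter R n := by
  rw [leg_succ _ _ h, coxeter_mul_emb hR _ (leg_mem_legAlg _ _ _), place_succ_leg]

/-- Conjugation by the Coxeter braid raises the index of a generator by one. At the last generator
this would leave the range, and the square of the braid leads back to the first. -/
theorem coxeter_sq_mul_leg {R : TMat ι 2 ℂ} (hR : IsRMatrix R) (n : ℕ) :
    coxeter R (n + 1) ^ 2 * leg R n (by omega) = leg R 0 (by omega) * coxeter R (n + 1) ^ 2 := by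
  have h1 : coxeter R (n + 1) ^ 2 =
      place Fin.succ (coxeter R n) * coxeter R (n + 1) * leg R n (by omega) := by
    rw [← coxeter_mul_emb hR _ (coxeter_mem_legAlg R n), sq, mul_assoc]
    rfl
  conv_rhs => rw [h1]
  rw [← mul_assoc, ← mul_assoc, ← coxeter_succ', sq]

theorem coxeter_pow_mul_leg {R : TMat ι 2 ℂ} (hR : IsRMatrix R) {n : ℕ} (a k l : ℕ)
    (hl : k + a = l) (h : l < n) :
    coxeter R n ^ a * leg R k (by omega) = leg R l (by omega) * coxeter R n ^ a := by
  subst hl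
  induction a with
  | zero => simp
  | succ a ih =>
    rw [pow_succ', mul_assoc, ih (by omega), ← mul_assoc, coxeter_mul_leg hR _ (by omega),
      mul_assoc]
    rfl

/-- The full twist is central. -/
theorem coxeter_pow_commute_leg {R : TMat ι 2 ℂ} (hR : IsRMatrix R) {n : ℕ} (k : ℕ)
    (h : k < n) :
    coxeter R n ^ (n + 1) * leg R k (by omega) = leg R k (by omega) * coxeter R n ^ (n + 1) := by
  -- The n+1 turns are split as k + 2 + a: a turns move R_k to the last position, two wrap it round
  -- to the first, and k bring it back.
  obtain ⟨a, rfl⟩ : ∃ a, n = k + a + 1 := ⟨n - k - 1, by omega⟩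
  have h1 := coxeter_pow_mul_leg hR a k _ rfl (n := k + a + 1) (by omega)
  have h2 := coxeter_sq_mul_leg hR (k + a)
  have h3 := coxeter_pow_mul_leg hR k 0 k (Nat.zero_add k) (n := k + a + 1) (by omega)
  have e : coxeter R (k + a + 1) ^ (k + a + 1 + 1) = coxeter R (k + a + 1) ^ (k + 2 + a) :=
    congrArg _ (by omega)
  rw [e, pow_add, mul_assoc, h1, pow_add, mul_assoc, ← mul_assoc (_ ^ 2), h2, ← mul_assoc,
    ← mul_assoc, h3]
  simp only [mul_assoc]

theorem coxeter_pow_commute {R : TMat ι 2 ℂ} (hR : IsRMatrix R) {n : ℕ}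
    (X : TMat ι (n + 1) ℂ) (hX : X ∈ legAlg R (n + 1)) : Commute (coxeter R n ^ (n + 1)) X :=
  legAlg_induction R _ (fun k h => coxeter_pow_commute_leg hR k (by omega))
    (fun c => Algebra.commute_algebraMap_right c _) (fun _ _ h h' => h.add_right h')
    (fun _ _ h h' => h.mul_right h') X hX

theorem coxeter_pow_mul_place {R : TMat ι 2 ℂ} (hR : IsRMatrix R) {a k n : ℕ} (h : a + k ≤ n + 1)
    (X : TMat ι k ℂ) (hX : X ∈ legAlg R k) :
    coxeter R n ^ a * place (Fin.castLE (by omega)) X =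
      place (fun i : Fin k => (⟨a + i, by omega⟩ : Fin (n + 1))) X * coxeter R n ^ a := by
  have i1 : Function.Injective (Fin.castLE (by omega : k ≤ n + 1)) := Fin.castLE_injective _
  have i2 : Function.Injective (fun i : Fin k => (⟨a + i, by omega⟩ : Fin (n + 1))) := by
    intro i j hij
    simp only [Fin.mk.injEq] at hij
    omega
  refine legAlg_induction R (fun X => coxeter R n ^ a * place (Fin.castLE (by omega)) X =
      place (fun i : Fin k => (⟨a + i, by omega⟩ : Fin (n + 1))) X * coxeter R n ^ a)
      ?_ ?_ ?_ ?_ X hX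
  · intro j hj
    rw [leg, place_comp _ i1, place_comp _ i2]
    have e1 : Fin.castLE (by omega : k ≤ n + 1) ∘ adj j hj = adj j (by omega) := by
      funext b
      fin_cases b <;> rfl
    have e2 : (fun i : Fin k => (⟨a + i, by omega⟩ : Fin (n + 1))) ∘ adj j hj =
        adj (a + j) (by omega) := by
      funext b
      ext
      fin_cases b <;> simp [adj] <;> omega
    rw [e1, e2]
    exact coxeter_pow_mul_leg hR a j (a + j) (by omega) (by omega)
  · intro c
    rw [← placeHom_apply _ i1, ← placeHom_apply _ i2, AlgHom.commutes, AlgHom.commutes,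
      Algebra.commutes]
  · intro X Y hX hY
    rw [place_add, place_add, mul_add, add_mul, hX, hY]
  · intro X Y hX hY
    rw [place_mul _ i1, place_mul _ i2, ← mul_assoc, hX, mul_assoc, hY, mul_assoc]

variable {A : Type*} [Ring A] [Algebra ℂ A]

/-- The characteristic elements commute. -/
theorem chOp_commute {R F : TMat ι 2 ℂ} (hR : SkewInvertible R) (hR' : IsRMatrix R)
    (hF : IsRMatrix F) (hRF : Compatible R F) (M : Matrix ι ι A)
    (hM : Commute (up A R) (matCopies F M 2)) {m k : ℕ} (hm : 0 < m) (X : TMat ι m ℂ)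
    (hX : X ∈ legAlg R m) (Y : TMat ι k ℂ) (hY : Y ∈ legAlg R k) :
    Commute (chOp R F M X) (chOp R F M Y) := by
  obtain ⟨n, hn⟩ : ∃ n, m + k = n + 1 := ⟨m + k - 1, by omega⟩
  have h1 := chOp_mul hR hF hRF M hn X hX Y hY
  have h2 := chOp_mul hR hF hRF M (by omega : k + m = n + 1) Y hY X hX
  rw [commute_iff_eq, ← h1, ← h2]
  have e1 := coxeter_pow_mul_place hR' (a := k) (n := n) (by omega) X hX
  have e2 := coxeter_pow_mul_place hR' (a := m) (n := n) (by omega) Y hY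
  have hY' : place (Fin.castLE (by omega)) Y ∈ legAlg R (n + 1) := by
    refine place_mem_legAlg R _ (Fin.castLE_injective _) (fun j hj => ?_) Y hY
    have : place (Fin.castLE (by omega)) (leg R j hj) =
        (leg R j (by omega) : TMat ι (n + 1) ℂ) := by
      rw [leg, place_comp _ (Fin.castLE_injective _), leg]
      congr 1
      funext b
      fin_cases b <;> rfl
    rw [this]
    exact leg_mem_legAlg _ _ _
  have e3 : coxeter R n ^ k * coxeter R n ^ m * place (Fin.castLE (by omega)) Y =
      place (Fin.castLE (by omega)) Y * (coxeter R n ^ k * coxeter R n ^ m) := by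
    rw [← pow_add, show k + m = n + 1 by omega]
    exact (coxeter_pow_commute hR' _ hY').eq
  have hC : coxeterInv R n ^ k * coxeter R n ^ k = 1 := by
    rw [← (show Commute (coxeterInv R n) (coxeter R n) from ?_).mul_pow,
      coxeterInv_mul_coxeter hR'.isUnit, one_pow]
    rw [commute_iff_eq, coxeterInv_mul_coxeter hR'.isUnit, coxeter_mul_coxeterInv hR'.isUnit]
  have hC' : coxeter R n ^ m * coxeterInv R n ^ m = 1 := by
    rw [← (show Commute (coxeter R n) (coxeterInv R n) from ?_).mul_pow,
      coxeter_mul_coxeterInv hR'.isUnit, one_pow]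
    rw [commute_iff_eq, coxeterInv_mul_coxeter hR'.isUnit, coxeter_mul_coxeterInv hR'.isUnit]
  have hC'' : coxeter R n ^ k * coxeterInv R n ^ k = 1 := by
    rw [← (show Commute (coxeter R n) (coxeterInv R n) from ?_).mul_pow,
      coxeter_mul_coxeterInv hR'.isUnit, one_pow]
    rw [commute_iff_eq, coxeterInv_mul_coxeter hR'.isUnit, coxeter_mul_coxeterInv hR'.isUnit]
  have hcomm := place_commute (Fin.castLE (by omega : k ≤ n + 1))
    (fun i : Fin m => (⟨k + i, by omega⟩ : Fin (n + 1)))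
    (fun a b => by simp only [ne_eq, Fin.ext_iff, Fin.val_castLE]; omega) Y X
  have hmem : coxeter R n ^ k ∈ legAlg R (n + 1) := pow_mem (coxeter_mem_legAlg R n) k
  generalize coxeter R n ^ k = c at *
  generalize coxeter R n ^ m = d at *
  generalize coxeterInv R n ^ k = c' at *
  generalize coxeterInv R n ^ m = d' at *
  generalize (place (Fin.castLE _) X : TMat ι (n + 1) ℂ) = x at *
  generalize (place (Fin.castLE _) Y : TMat ι (n + 1) ℂ) = y at *
  generalize (place (fun i : Fin m => (⟨k + i, by omega⟩ : Fin (n + 1))) X) = x' at *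
  generalize (place (fun i : Fin k => (⟨m + i, by omega⟩ : Fin (n + 1))) Y) = y' at *
  -- Since c d is the central full twist and d carries Y from the front to offset m, conjugation by
  -- c carries it back to the front.
  have e4 : c * y' = y * c := by
    calc c * y' = c * (y' * d) * d' := by rw [mul_assoc, mul_assoc, hC', mul_one]
      _ = c * d * y * d' := by rw [← e2]; simp only [mul_assoc]
      _ = _ := by rw [e3, mul_assoc, mul_assoc, hC', mul_one]
  -- Cyclicity allows conjugation by c, which exchanges the two blocks; blocks on disjoint strands
  -- commute.
  calc chOp R F M (x * y') = chOp R F M (x * y' * c' * c) := by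
        rw [mul_assoc _ c', hC, mul_one]
    _ = chOp R F M (c * (x * y' * c')) := (chOp_mul_comm hR hR' hF hRF M hM _ hmem _).symm
    _ = chOp R F M (x' * (c * y') * c') := by
        congr 1
        simp only [← mul_assoc]
        rw [e1]
    _ = chOp R F M (y * x') := by
        rw [e4, mul_assoc, mul_assoc, hC'', mul_one, hcomm]

end FullTwist

end BMWQuantum

namespace BMWQuantum

/-! ### The full set of relations from the defining ones. -/

section Kappa

variable {q μ : ℂ} {B : Type*} [Ring B] [Algebra ℂ B]

theorem mul_kappaOf {x a b : B} (h : x * a = b * x) :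
    x * kappaOf q μ a = kappaOf q μ b * x := by
  have hc : ∀ c : ℂ, x * algebraMap ℂ B c = algebraMap ℂ B c * x := fun c =>
    (Algebra.commutes c x).symm
  have e1 : x * (algebraMap ℂ B q - a) = (algebraMap ℂ B q - b) * x := by
    rw [mul_sub, sub_mul, hc, h]
  have e2 : x * (algebraMap ℂ B q⁻¹ + a) = (algebraMap ℂ B q⁻¹ + b) * x := by
    rw [mul_add, add_mul, hc, h]
  rw [kappaOf, kappaOf, mul_smul_comm, smul_mul_assoc, ← mul_assoc, e1, mul_assoc, e2, mul_assoc]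

theorem inv_eq_of_kappaOf (hp : BMWParams q μ) {s t : B} (hst : s * t = 1)
    (hk : kappaOf q μ s * s = μ • kappaOf q μ s) :
    t = s - (q - q⁻¹) • 1 + (q - q⁻¹) • kappaOf q μ s := by
  have h1 := hp.sub_inv_ne_zero
  have hμ := hp.μ_ne_zero
  have e1 : (μ * (q - q⁻¹)) • kappaOf q μ s = 1 + (q - q⁻¹) • s - s * s := by
    rw [kappaOf, smul_smul, mul_inv_cancel₀ (mul_ne_zero hμ h1), one_smul]
    simp only [Algebra.algebraMap_eq_smul_one, sub_mul, mul_add, smul_mul_assoc, mul_smul_comm,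
      one_mul, mul_one]
    rw [sub_smul, smul_sub, smul_smul, inv_mul_cancel₀ hp.q_ne_zero, one_smul]
    module
  have e2 : kappaOf q μ s = μ • (kappaOf q μ s * t) := by
    rw [← smul_mul_assoc, ← hk, mul_assoc, hst, mul_one]
  have e3 := congrArg (· * t) e1
  simp only [sub_mul, add_mul, smul_mul_assoc, one_mul, mul_assoc, hst, mul_one] at e3
  rw [mul_comm μ, mul_smul, ← e2] at e3
  rw [e3]
  module

/-- Only one orientation of each mixed relation is assumed; the mirror relations follow by
conjugation with the half twist. -/
theorem BMWGens.of_kappaOf (hp : BMWParams q μ) {N : ℕ} {s t k : ℕ → B}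
    (st : ∀ i, i < N → s i * t i = 1) (ts : ∀ i, i < N → t i * s i = 1)
    (hk : ∀ i, i < N → k i = kappaOf q μ (s i))
    (sk : ∀ i, i < N → s i * k i = μ • k i) (ks : ∀ i, i < N → k i * s i = μ • k i)
    (braid : ∀ i, i + 1 < N → s i * s (i + 1) * s i = s (i + 1) * s i * s (i + 1))
    (comm : ∀ i j, i + 1 < j → j < N → Commute (s i) (s j))
    (kk : ∀ i, i + 1 < N → k (i + 1) * k i = s i * s (i + 1) * k i)
    (kkk : ∀ i, i + 1 < N → k i * k (i + 1) * k i = k i) : BMWGens q μ N s t k := by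
  -- The half twist σ_iσ_{i+1}σ_i is invertible and exchanges the indices i and i+1 of both σ and κ.
  have hΔ : ∀ i, i + 1 < N → ∃ x y : B, x * y = 1 ∧ x * s i = s (i + 1) * x ∧
      x * s (i + 1) = s i * x ∧ x * k i = k (i + 1) * x ∧ x * k (i + 1) = k i * x := by
    intro i hi
    have h1 : s i * s (i + 1) * s i * s i = s (i + 1) * (s i * s (i + 1) * s i) := by
      calc s i * s (i + 1) * s i * s i = s (i + 1) * s i * s (i + 1) * s i := by rw [braid i hi]
        _ = s (i + 1) * (s i * s (i + 1) * s i) := by simp only [mul_assoc]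
    have h2 : s i * s (i + 1) * s i * s (i + 1) = s i * (s i * s (i + 1) * s i) := by
      calc s i * s (i + 1) * s i * s (i + 1) = s i * (s (i + 1) * s i * s (i + 1)) := by
            simp only [mul_assoc]
        _ = s i * (s i * s (i + 1) * s i) := by rw [braid i hi]
    refine ⟨s i * s (i + 1) * s i, t i * (t (i + 1) * t i), ?_, h1, h2, ?_, ?_⟩
    · calc s i * s (i + 1) * s i * (t i * (t (i + 1) * t i))
          = s i * s (i + 1) * (s i * t i) * (t (i + 1) * t i) := by simp only [mul_assoc]
        _ = s i * (s (i + 1) * t (i + 1)) * t i := by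
          rw [st i (by omega), mul_one]; simp only [mul_assoc]
        _ = 1 := by rw [st _ hi, mul_one, st i (by omega)]
    · rw [hk i (by omega), hk _ hi, mul_kappaOf h1]
    · rw [hk i (by omega), hk _ hi, mul_kappaOf h2]
  have cancel : ∀ {x y a b : B}, x * y = 1 → a * x = b * x → a = b := fun {x y a b} h h' => by
    rw [← mul_one a, ← h, ← mul_assoc, h', mul_assoc, h, mul_one]
  refine ⟨hp, st, ts, fun i hi => ?_, sk, ks, braid, comm, kk, fun i hi => ?_, kkk,
    fun i hi => ?_⟩
  · have h := ks i hi
    rw [hk i hi] at h ⊢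
    exact inv_eq_of_kappaOf hp (st i hi) h
  · obtain ⟨x, y, h0, h1, h2, h3, h4⟩ := hΔ i hi
    refine cancel h0 ?_
    calc k i * k (i + 1) * x = x * (k (i + 1) * k i) := by
          rw [mul_assoc, ← h3, ← mul_assoc, ← h4, mul_assoc]
      _ = x * (s i * s (i + 1) * k i) := by rw [kk i hi]
      _ = s (i + 1) * s i * k (i + 1) * x := by
        rw [mul_assoc _ _ x, ← h3, ← mul_assoc x, ← mul_assoc x, h1, mul_assoc _ x, h2]
        simp only [mul_assoc]
  · obtain ⟨x, y, h0, h1, h2, h3, h4⟩ := hΔ i hi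
    refine cancel h0 ?_
    calc k (i + 1) * k i * k (i + 1) * x = x * (k i * k (i + 1) * k i) := by
          rw [mul_assoc _ _ x, ← h3, ← mul_assoc, mul_assoc (k (i + 1)), ← h4, ← mul_assoc, ← h3]
          simp only [mul_assoc]
      _ = k (i + 1) * x := by rw [kkk i hi, h3]

end Kappa

/-! ### The operators on tensor powers form a BMW trace. -/

section Legs

variable {ι : Type*} [Fintype ι] [DecidableEq ι]

/-- The operator `X` on the legs `i`, `i + 1`, and `1` if these do not exist. -/
noncomputable def legs (X : TMat ι 2 ℂ) (n i : ℕ) : TMat ι n ℂ :=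
  if h : i + 1 < n then leg X i h else 1

omit [Fintype ι] in
theorem legs_eq (X : TMat ι 2 ℂ) {n i : ℕ} (h : i + 1 < n) : legs X n i = leg X i h := dif_pos h

variable {q μ : ℂ} {R : TMat ι 2 ℂ}

theorem IsBMWType.bmwGens (hR : IsBMWType q μ R) (n : ℕ) :
    BMWGens q μ (n - 1) (legs R n) (legs R⁻¹ n) (legs (kappaOf q μ R) n) := by
  refine BMWGens.of_kappaOf hR.params (fun i hi => ?_) (fun i hi => ?_) (fun i hi => ?_)
    (fun i hi => ?_) (fun i hi => ?_) (fun i hi => ?_) (fun i j hij hj => ?_) (fun i hi => ?_)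
    (fun i hi => ?_)
  · rw [legs_eq _ (by omega), legs_eq _ (by omega), leg_mul_inv hR.isUnit]
  · rw [legs_eq _ (by omega), legs_eq _ (by omega), leg_inv_mul hR.isUnit]
  · rw [legs_eq _ (by omega), legs_eq _ (by omega), leg_kappa]
  · rw [legs_eq _ (by omega), legs_eq _ (by omega), leg_mul, hR.mul_kappa, leg, place_smul, leg]
  · rw [legs_eq _ (by omega), legs_eq _ (by omega), leg_mul, hR.kappa_mul, leg, place_smul, leg]
  · rw [legs_eq _ (by omega), legs_eq _ (by omega), leg_braid hR.toIsRMatrix n i (by omega)]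
  · rw [legs_eq _ (by omega), legs_eq _ (by omega)]
    exact leg_comm R R n i j _ _ hij
  · rw [legs_eq _ (by omega), legs_eq _ (by omega), legs_eq _ (by omega), legs_eq _ (by omega),
      leg_eq_place_left _ i (by omega), leg_eq_place_right _ i (by omega),
      leg_eq_place_left _ i (by omega), leg_eq_place_right _ i (by omega)]
    simp only [← place_mul _ (triple_injective i _)]
    rw [hR.kk]
  · rw [legs_eq _ (by omega), legs_eq _ (by omega),
      leg_eq_place_left _ i (by omega), leg_eq_place_right _ i (by omega)]
    simp only [← place_mul _ (triple_injective i _)]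
    rw [hR.kkk]

theorem legs_mem_legAlg (R : TMat ι 2 ℂ) (n i : ℕ) : legs R n i ∈ legAlg R n := by
  rw [legs]
  split_ifs with h
  · exact leg_mem_legAlg R i h
  · exact one_mem _

theorem legs_kappa_mem (q μ : ℂ) (R : TMat ι 2 ℂ) (n i : ℕ) :
    legs (kappaOf q μ R) n i ∈ legAlg R n := by
  rw [legs]
  split_ifs with h
  · rw [← leg_kappa, kappaOf]
    exact Subalgebra.smul_mem _ (mul_mem (sub_mem (Subalgebra.algebraMap_mem _ _)
      (leg_mem_legAlg R i h)) (add_mem (Subalgebra.algebraMap_mem _ _) (leg_mem_legAlg R i h))) _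
  · exact one_mem _

/-- The inverses need not be adjoined separately, since the cubic relation makes R⁻¹ a polynomial in
R. -/
theorem IsBMWType.legs_inv_mem (hR : IsBMWType q μ R) (n i : ℕ) :
    legs R⁻¹ n i ∈ legAlg R n := by
  by_cases h : i + 1 < n
  · rw [(hR.bmwGens n).t_eq i (by omega)]
    exact add_mem (sub_mem (legs_mem_legAlg R n i) (Subalgebra.smul_mem _ (one_mem _) _))
      (Subalgebra.smul_mem _ (legs_kappa_mem q μ R n i) _)
  · rw [legs, dif_neg h]
    exact one_mem _

omit [Fintype ι] in
theorem place_castLE_leg (X : TMat ι 2 ℂ) {m n : ℕ} (h : m ≤ n) (i : ℕ) (hi : i + 1 < m) :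
    place (Fin.castLE h) (leg X i hi) = leg X i (by omega) := by
  rw [leg, place_place _ (Fin.castLE_injective h), leg]
  congr 1
  funext a
  fin_cases a <;> rfl

theorem natAdd_injective {m l n : ℕ} (h : m + l = n) :
    Function.Injective (fun i : Fin l => (⟨m + i, by omega⟩ : Fin n)) := fun a b hab => by
  simpa [Fin.ext_iff] using hab

omit [Fintype ι] in
theorem place_add_leg (X : TMat ι 2 ℂ) {m l n : ℕ} (h : m + l = n) (i : ℕ) (hi : i + 1 < l) :
    place (fun i : Fin l => (⟨m + i, by omega⟩ : Fin n)) (leg X i hi) =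
      leg X (m + i) (by omega) := by
  rw [leg, place_place _ (natAdd_injective h), leg]
  congr 1
  funext a
  fin_cases a <;> rfl

variable {A : Type*} [Ring A] [Algebra ℂ A]

/-- The characteristic map as a linear map. -/
noncomputable def chLin (R F : TMat ι 2 ℂ) (M : Matrix ι ι A) (n : ℕ) : TMat ι n ℂ →ₗ[ℂ] A where
  toFun := chOp R F M
  map_add' X Y := by
    simp only [chOp, rTrace, map_add, mul_add, Matrix.add_apply, smul_add, Finset.sum_add_distrib]
  map_smul' c X := by
    simp only [chOp, rTrace, map_smul, mul_smul_comm, Matrix.smul_apply, Finset.smul_sum,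
      RingHom.id_apply]
    refine Finset.sum_congr rfl fun i _ => Finset.sum_congr rfl fun j _ => smul_comm _ _ _

theorem IsBMWType.bmwTrace {F : TMat ι 2 ℂ} (hR : IsBMWType q μ R) (hRs : SkewInvertible R)
    (hF : IsRMatrix F) (hRF : Compatible R F) (M : Matrix ι ι A)
    (hM : Commute (up A R) (matCopies F M 2)) :
    BMWTrace q μ (legs R) (legs R⁻¹) (legs (kappaOf q μ R)) (legAlg R) (chLin R F M) where
  gens := hR.bmwGens
  s_mem := legs_mem_legAlg R
  t_mem := hR.legs_inv_mem
  k_mem := legs_kappa_mem q μ R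
  tr n x hx y := chOp_mul_comm hRs hR.toIsRMatrix hF hRF M hM x hx y
  mul m l n h := by
    refine ⟨placeHom (Fin.castLE (by omega : m ≤ n)) (Fin.castLE_injective _),
      placeHom (fun i : Fin l => (⟨m + i, by omega⟩ : Fin n))
        (natAdd_injective h), fun i hi => ?_, fun i hi => ?_,
      fun x hx y hy => chOp_mul hRs hF hRF M h x hx y hy⟩
    · rw [placeHom_apply, placeHom_apply, legs_eq _ hi, legs_eq _ hi, legs_eq _ (by omega),
        legs_eq _ (by omega), place_castLE_leg, place_castLE_leg]
      exact ⟨rfl, rfl⟩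
    · rw [placeHom_apply, placeHom_apply, legs_eq _ hi, legs_eq _ hi, legs_eq _ (by omega),
        legs_eq _ (by omega), place_add_leg _ h, place_add_leg _ h]
      exact ⟨rfl, rfl⟩
  comm m l hm x hx y hy := chOp_commute hRs hR.toIsRMatrix hF hRF M hM hm x hx y hy
  zero := by
    change chOp R F M (1 : TMat ι 0 ℂ) = 1
    simp [chOp, rTrace, matCopies]

end Legs

/-! ### Identification with the elements of the quantum matrix algebra. -/

section Glue

variable {ι : Type*} [Fintype ι] [DecidableEq ι] {q μ : ℂ} {R : TMat ι 2 ℂ}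

theorem rho_sig (hR : IsBMWType q μ R) (n k : ℕ) (h : k + 1 < n) :
    rho hR n (sig q μ n k h) = legs R n k := by
  rw [rho, sig, RingQuot.liftAlgHom_mkAlgHom_apply, braidAlgebraRep_gen, legs_eq _ h]

theorem rho_kap (hR : IsBMWType q μ R) (n k : ℕ) (h : k + 1 < n) :
    rho hR n (kap q μ n k h) = legs (kappaOf q μ R) n k := by
  rw [kap, map_kappaOf, rho_sig, legs_eq _ h, leg_kappa, legs_eq _ h]

theorem rho_antisymmetrizer (hR : IsBMWType q μ R) (n i : ℕ) (h : i ≤ n) :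
    rho hR n (antisymmetrizer q μ n i h) =
      asym q μ (legs R n) (legs (kappaOf q μ R) n) i := by
  induction i with
  | zero => exact map_one _
  | succ i ih =>
    cases i with
    | zero => exact map_one _
    | succ i =>
      rw [antisymmetrizer, asym, map_smul, map_mul, map_mul, ih, bax]
      simp only [map_add, map_smul, map_one, rho_sig, rho_kap]

/-- Under q ↦ -q⁻¹ the two baxterized elements are exchanged, and the signs of the prefactor cancel
against those of the q-number. -/
theorem rho_symmetrizer (hR : IsBMWType q μ R) (n i : ℕ) (h : i ≤ n) :
    rho hR n (symmetrizer q μ n i h) =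
      asym (-q⁻¹) μ (legs R n) (legs (kappaOf q μ R) n) i := by
  induction i with
  | zero => exact map_one _
  | succ i ih =>
    cases i with
    | zero => exact map_one _
    | succ i =>
      rw [symmetrizer, asym, map_smul, map_mul, map_mul, ih, bax]
      simp only [map_add, map_smul, map_one, rho_sig, rho_kap]
      have e1 : (-q⁻¹) ^ (-2 * ((i : ℤ) + 1)) = q ^ (2 * ((i : ℤ) + 1)) := by
        rw [Even.neg_zpow ⟨-((i : ℤ) + 1), by ring⟩, inv_zpow, ← zpow_neg]
        congr 1
      have e2 : alphaC (-q⁻¹) μ (-1) = alphaC q μ 1 := by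
        simp [alphaC]
      have e3 : (-q⁻¹) ^ (i + 1) / qNum (-q⁻¹) (i + 2) = (q ^ (i + 1))⁻¹ / qNum q (i + 2) := by
        rw [qNum_dual, neg_pow, inv_pow, show -(-1 : ℂ) ^ (i + 2) = (-1) ^ (i + 1) by ring,
          mul_div_mul_left _ _ (pow_ne_zero _ (by norm_num))]
      rw [e1, e2, e3, neg_inv_sub]

theorem rho_prod_sig (hR : IsBMWType q μ R) (n : ℕ) (i : ℕ) (h : i + 1 ≤ n) :
    rho hR n (List.ofFn fun k : Fin i => sig q μ n k (by omega)).reverse.prod =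
      dsc (legs R n) 0 i := by
  induction i with
  | zero => simp [dsc]
  | succ i ih =>
    rw [List.ofFn_succ', List.concat_eq_append, List.reverse_append, List.reverse_singleton,
      List.singleton_append, List.prod_cons, map_mul, dsc, zero_add, rho_sig]
    congr 1
    exact ih (by omega)

theorem map_matCopy {A A' : Type*} [Ring A] [Algebra ℂ A] [Ring A'] [Algebra ℂ A'] (f : A →ₐ[ℂ] A')
    (F : TMat ι 2 ℂ) (M : Matrix ι ι A) (n k : ℕ) (h : k < n) :
    (matCopy F M n k h).map f = matCopy F (M.map f) n k h := by
  induction k with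
  | zero =>
    ext i j
    simp only [matCopy, place, Matrix.map_apply, Matrix.of_apply, Matrix.submatrix_apply]
    split_ifs <;> simp
  | succ k ih =>
    have e : ∀ X : TMat ι n ℂ, (X.map (algebraMap ℂ A)).map f = X.map (algebraMap ℂ A') := by
      intro X
      ext i j
      simp
    rw [matCopy, matCopy, Matrix.map_mul, Matrix.map_mul, ih, e, e]

theorem map_matCopies {A A' : Type*} [Ring A] [Algebra ℂ A] [Ring A'] [Algebra ℂ A']
    (f : A →ₐ[ℂ] A') (F : TMat ι 2 ℂ) (M : Matrix ι ι A) (n : ℕ) :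
    (matCopies F M n).map f = matCopies F (M.map f) n := by
  have h := map_list_prod f.mapMatrix (List.ofFn fun k : Fin n => matCopy F M n k k.isLt)
  rw [List.map_ofFn] at h
  rw [matCopies, matCopies]
  refine h.trans ?_
  congr 2
  funext k
  exact map_matCopy f F M n k k.isLt

theorem commute_matCopies_genM (R F : TMat ι 2 ℂ) :
    Commute (up (QMAlgebra R F) R) (matCopies F (genM R F) 2) := by
  rw [commute_iff_eq, genM, ← map_matCopies, ← up_eq_map]
  have e : R.map (algebraMap ℂ (QMAlgebra R F)) =
      (R.map (algebraMap ℂ (FreeAlgebra ℂ (ι × ι)))).map (RingQuot.mkAlgHom ℂ (QMRel R F)) := by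
    ext i j
    simp only [Matrix.map_apply, AlgHom.commutes]
  rw [e, ← Matrix.map_mul, ← Matrix.map_mul]
  ext i j
  exact RingQuot.mkAlgHom_rel ℂ (QMRel.entry i j)

variable {F : TMat ι 2 ℂ}

theorem ch_eq (hR : IsBMWType q μ R) {n : ℕ} (α : BMWAlgebra q μ n) :
    ch hR F α = chLin R F (genM R F) n (rho hR n α) := rfl

theorem powerSum_eq (hR : IsBMWType q μ R) (i : ℕ) :
    powerSum hR F (i + 1) = BMWTrace.pow (legs R) (chLin R F (genM R F)) (i + 1) := by
  rw [powerSum, ch_eq, BMWTrace.pow, rho_prod_sig hR (i + 1) i le_rfl, Nat.add_sub_cancel]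

theorem contraction_eq (hR : IsBMWType q μ R) :
    contraction hR F = BMWTrace.con q μ (legs (kappaOf q μ R)) (chLin R F (genM R F)) := by
  rw [contraction, ch_eq, map_smul, map_smul, rho_kap, BMWTrace.con]

theorem elemA_eq (hR : IsBMWType q μ R) (hRs : SkewInvertible R) (hF : IsRMatrix F)
    (hRF : Compatible R F) (i : ℕ) :
    elemA hR F i = BMWTrace.elem q μ (legs R) (legs (kappaOf q μ R)) (chLin R F (genM R F)) i := by
  cases i with
  | zero =>
    rw [(hR.bmwTrace hRs hF hRF (genM R F) (commute_matCopies_genM R F)).elem_zero, elemA]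
  | succ i => rw [elemA, ch_eq, BMWTrace.elem, rho_antisymmetrizer]

theorem elemS_eq (hR : IsBMWType q μ R) (hRs : SkewInvertible R) (hF : IsRMatrix F)
    (hRF : Compatible R F) (i : ℕ) :
    elemS hR F i =
      BMWTrace.elem (-q⁻¹) μ (legs R) (legs (kappaOf q μ R)) (chLin R F (genM R F)) i := by
  cases i with
  | zero =>
    rw [(hR.bmwTrace hRs hF hRF (genM R F) (commute_matCopies_genM R F)).dual.elem_zero, elemS]
  | succ i => rw [elemS, ch_eq, BMWTrace.elem, rho_symmetrizer]

end Glue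

end BMWQuantum

theorem theorem6p1 {ι : Type*} [Fintype ι] [DecidableEq ι] (q μ : ℂ)
    (R F : BMWQuantum.TMat ι 2 ℂ)
    (hR : BMWQuantum.IsBMWType q μ R) (hF : BMWQuantum.IsRMatrix F)
    (hRF : BMWQuantum.Compatible R F)
    (hRs : BMWQuantum.StrictSkewInvertible R) (hFs : BMWQuantum.StrictSkewInvertible F)
    (n : ℕ) :
    (BMWQuantum.AntisymDefined q μ n →
      ∑ i ∈ Finset.range n,
          (-q) ^ i • (BMWQuantum.elemA hR F i * BMWQuantum.powerSum hR F (n - i)) =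
        ((-1) ^ ((n : ℤ) - 1) * BMWQuantum.qNum q n) • BMWQuantum.elemA hR F n +
        (-1 : ℂ) ^ n • ∑ i ∈ Finset.Icc 1 (n / 2),
          (μ * q ^ ((n : ℤ) - 2 * i) - q ^ (1 - (n : ℤ) + 2 * i)) •
            (BMWQuantum.elemA hR F (n - 2 * i) * BMWQuantum.contraction hR F ^ i)) ∧
    (BMWQuantum.SymDefined q μ n →
      ∑ i ∈ Finset.range n,
          q ^ (-(i : ℤ)) • (BMWQuantum.elemS hR F i * BMWQuantum.powerSum hR F (n - i)) =
        BMWQuantum.qNum q n • BMWQuantum.elemS hR F n +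
        ∑ i ∈ Finset.Icc 1 (n / 2),
          (μ * q ^ (2 * (i : ℤ) - n) + q ^ ((n : ℤ) - 2 * i - 1)) •
            (BMWQuantum.elemS hR F (n - 2 * i) * BMWQuantum.contraction hR F ^ i)) ∧
    (BMWQuantum.AntisymDefined q μ n → BMWQuantum.SymDefined q μ n →
      ∑ i ∈ Finset.range (n + 1),
          (-1 : ℂ) ^ i • (BMWQuantum.elemA hR F i * BMWQuantum.elemS hR F (n - i)) =
        (if n = 0 then 1 else 0) - (if n = 2 then BMWQuantum.contraction hR F else 0)) := by
  have H := hR.bmwTrace hRs.1 hF hRF (BMWQuantum.genM R F)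
    (BMWQuantum.commute_matCopies_genM R F)
  have hq := hR.params.q_ne_zero
  -- The two definitions of the power sums have different values at index 0; only positive indices
  -- occur because i < n.
  have hp : ∀ i ∈ Finset.range n, BMWQuantum.powerSum hR F (n - i) =
      BMWQuantum.BMWTrace.pow (BMWQuantum.legs R)
        (BMWQuantum.chLin R F (BMWQuantum.genM R F)) (n - i) := fun i hi => by
    have := Finset.mem_range.mp hi
    rw [show n - i = n - i - 1 + 1 by omega, BMWQuantum.powerSum_eq]
  refine ⟨fun hA => ?_, fun hS => ?_, fun hA hS => ?_⟩
  · simp only [BMWQuantum.elemA_eq hR hRs.1 hF hRF, BMWQuantum.contraction_eq]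
    rw [Finset.sum_congr rfl fun i hi => by rw [hp i hi], H.newton hA le_rfl,
      BMWQuantum.contractSum_eq, Finset.smul_sum]
    congr 1
    · congr 1
      rw [zpow_sub_one₀ (by norm_num), zpow_natCast, inv_neg, inv_one]
      ring
    · refine Finset.sum_congr rfl fun i hi => ?_
      have hi := Finset.mem_Icc.mp hi
      rw [smul_smul]
      congr 1
      have e1 : (-1 : ℂ) ^ n = (-1) ^ (n - 2 * i) := by
        conv_lhs => rw [show n = n - 2 * i + 2 * i by omega]
        rw [pow_add, pow_mul]
        simp
      have e2 : (n : ℤ) - 2 * i = (n - 2 * i : ℕ) := by omega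
      rw [e1, show 1 - (n : ℤ) + 2 * i = 1 - (n - 2 * i) by ring, e2, zpow_sub₀ hq, zpow_one,
        zpow_natCast, div_eq_mul_inv]
  · simp only [BMWQuantum.elemS_eq hR hRs.1 hF hRF, BMWQuantum.contraction_eq]
    rw [Finset.sum_congr rfl fun i hi => by rw [hp i hi, zpow_neg, zpow_natCast],
      H.newton_dual hS le_rfl, BMWQuantum.contractSum_eq]
    congr 1
    refine Finset.sum_congr rfl fun i hi => ?_
    have hi := Finset.mem_Icc.mp hi
    congr 1
    have e2 : (n : ℤ) - 2 * i = (n - 2 * i : ℕ) := by omega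
    rw [show 2 * (i : ℤ) - n = -(n - 2 * i) by ring, e2, zpow_neg, zpow_natCast,
      zpow_sub_one₀ hq, zpow_natCast, mul_comm q⁻¹]
  · simp only [BMWQuantum.elemA_eq hR hRs.1 hF hRF, BMWQuantum.elemS_eq hR hRs.1 hF hRF,
      BMWQuantum.contraction_eq]
    exact H.wronski hA hS
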